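/- Let $N\ge 1$, let $\Omega\subset\mathbb{R}^N$ be a nonempty bounded open set (for instance a bounded domain with $C^{2,\alpha}$ boundary), let $p>1$ satisfy $\frac1p>\frac{(N-2)_+}{N+2}$, let $T>0$ and $\mathsf{c}=\frac{p}{(p-1)T}$. Boundary conditions are understood in the sense of $H^1_0(\Omega)$ and equations in the weak sense. Let $V$ be a bounded positive solution of $$-\Delta V=\mathsf{c}\,V^p\ \text{ in }\Omega,\qquad V=0\ \text{ on }\partial\Omega .$$ Let $0<\lambda_{V,1}<\lambda_{V,2}<\dots$ be the distinct eigenvalues of the Dirichlet Laplacian $-\Delta$ on $L^2(\Omega,V^{p-1}dx)$, i.e. of $-\Delta\varphi=\lambda V^{p-1}\varphi$ in $\Omega$, $\varphi=0$ on $\partial\Omega$, and for every $k\ge1$ let $\phi_{k,1},\dots,\phi_{k,N_k}$ be a basis, orthonormal in $L^2(\Omega,V^{p-1}dx)$, of the eigenspace of $\lambda_{V,k}$. Assume (H2) the problem $-\Delta\varphi=\mathsf{c}\,p\,V^{p-1}\varphi$ in $\Omega$, $\varphi=0$ on $\partial\Omega$, has only the trivial solution, and let $k_p$ be the largest integer $k\ge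 1$ with $\lambda_{V,k}<p\,\mathsf{c}$. For nonnegative functions $v$ on $\Omega$ set $$\mathcal{E}[v]=\int_\Omega\Big[(v^{p+1}-V^{p+1})-\tfrac{p+1}{p}(v^p-V^p)V\Big]dx,\qquad \mathcal{Q}_{k,j}[v]=\frac{\left|\int_\Omega (v^p-V^p)\,\phi_{k,j}\,dx\right|}{\mathcal{E}[v]^{1/2}},$$ with $\mathcal{Q}_{k,j}[v]=0$ when $\mathcal{E}[v]=0$ (that is, when $v=V$ a.e.). Then there is $\delta_0>0$ such that the following holds for every $\delta$ with $0<\delta<\frac1{2p}$ and $\delta<\delta_0$. Let $v\ge0$ be a weak energy solution of $$\partial_t v^p=\Delta v+\mathsf{c}\,v^p\ \text{ in }(0,\infty)\times\Omega,\qquad v=0\ \text{ on }(0,\infty)\times\partial\Omega,\qquad v^p(0,\cdot)=u_0\ \text{ in }\Omega ,$$ meaning that $v^p\in C([0,\infty);L^1(\Omega))$, $v\in L^2_{\rm loc}((0,\infty);H^1_0(\Omega))$, and the equation holds against test functions in $C_c^\infty((0,\infty)\times\Omega)$. Suppose that $v$ satisfies (H1$'$)$_\delta$ there is $t_1>0$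 such that $|v(t,x)-V(x)|\le\delta V(x)$ for a.e. $(t,x)\in[t_1,\infty)\times\Omega$, and that for some $\overline\kappa>0$, $\eta>0$ and $t_0\ge1$ $$\left\|\frac{v(t)}{V}-1\right\|_{L^\infty(\Omega)}\le\overline\kappa\,\mathcal{E}[v(t-1)]^{\eta}\qquad\text{for all }t\ge t_0 .$$ Then there exists a time $T_0\ge t_0$ such that $$\mathcal{Q}_{k,j}[v(t)]\le\mathcal{E}[v(t-1)]^{\eta/2}\qquad\text{for all }t\ge T_0,\ 1\le k\le k_p,\ 1\le j\le N_k .$$ -/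

import Mathlib

open MeasureTheory Set Filter Topology
open scoped ENNReal ContDiff

namespace FastDiffusion

noncomputable section

/-! ### Test functions and the space `H¹₀(Ω)` -/

/-- `ψ ∈ C_c^∞(U)`: `ψ` is smooth with compact support contained in `U`. -/
def IsTestFunction {F : Type*} [NormedAddCommGroup F] [NormedSpace ℝ F]
    (U : Set F) (ψ : F → ℝ) : Prop :=
  ContDiff ℝ ∞ ψ ∧ HasCompactSupport ψ ∧ tsupport ψ ⊆ U

/-- `f ∈ H¹₀(Ω)` with weak gradient `g`: the pair `(f, g)` is a limit in `L²(Ω)` of pairs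
`(ψₙ, ∇ψₙ)` with `ψₙ ∈ C_c^∞(Ω)`. The values of `f` and `g` outside `Ω` play no role. -/
def HasH10Gradient {N : ℕ} (Ω : Set (EuclideanSpace ℝ (Fin N)))
    (f : EuclideanSpace ℝ (Fin N) → ℝ)
    (g : EuclideanSpace ℝ (Fin N) → EuclideanSpace ℝ (Fin N)) : Prop :=
  MemLp f 2 (volume.restrict Ω) ∧ MemLp g 2 (volume.restrict Ω) ∧
    ∃ ψ : ℕ → EuclideanSpace ℝ (Fin N) → ℝ, (∀ n, IsTestFunction Ω (ψ n)) ∧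
      Tendsto (fun n => eLpNorm (fun x => f x - ψ n x) 2 (volume.restrict Ω)) atTop (𝓝 0) ∧
      Tendsto (fun n => eLpNorm (fun x => g x - gradient (ψ n) x) 2 (volume.restrict Ω))
        atTop (𝓝 0)

/-! ### The elliptic problem and the weighted Dirichlet spectrum -/

/-- `φ` solves `-Δφ = h` in `Ω`, `φ = 0` on `∂Ω`, in the weak sense in `H¹₀(Ω)`. -/
def SolvesDirichlet {N : ℕ} (Ω : Set (EuclideanSpace ℝ (Fin N)))
    (h φ : EuclideanSpace ℝ (Fin N) → ℝ) : Prop :=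
  ∃ g : EuclideanSpace ℝ (Fin N) → EuclideanSpace ℝ (Fin N), HasH10Gradient Ω φ g ∧
    ∀ ψ : EuclideanSpace ℝ (Fin N) → ℝ, IsTestFunction Ω ψ →
      ∫ x in Ω, inner ℝ (g x) (gradient ψ x) = ∫ x in Ω, h x * ψ x

/-- `V` is a bounded positive solution of `-ΔV = c V^p` in `Ω`, `V = 0` on `∂Ω`. -/
structure IsStationary {N : ℕ} (Ω : Set (EuclideanSpace ℝ (Fin N))) (p c : ℝ)
    (V : EuclideanSpace ℝ (Fin N) → ℝ) : Prop where
  pos : ∀ x ∈ Ω, 0 < V x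
  bounded : ∃ M : ℝ, ∀ x ∈ Ω, V x ≤ M
  solves : SolvesDirichlet Ω (fun x => c * V x ^ p) V

/-- `φ` solves `-Δφ = lam V^{p-1} φ` in `Ω`, `φ = 0` on `∂Ω`. -/
def SolvesEigen {N : ℕ} (Ω : Set (EuclideanSpace ℝ (Fin N))) (p : ℝ)
    (V : EuclideanSpace ℝ (Fin N) → ℝ) (lam : ℝ) (φ : EuclideanSpace ℝ (Fin N) → ℝ) : Prop :=
  SolvesDirichlet Ω (fun x => lam * V x ^ (p - 1) * φ x) φ

/-- The eigenvalues of `-Δ` on `L²(Ω, V^{p-1} dx)` with homogeneous Dirichlet conditions. -/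
def dirichletSpectrum {N : ℕ} (Ω : Set (EuclideanSpace ℝ (Fin N))) (p : ℝ)
    (V : EuclideanSpace ℝ (Fin N) → ℝ) : Set ℝ :=
  {lam | ∃ φ, SolvesEigen Ω p V lam φ ∧ ¬ (∀ᵐ x ∂volume.restrict Ω, φ x = 0)}

/-- `lamV Ω p V k` is, for `k ≥ 1`, the `k`-th smallest element of the spectrum, counted without
multiplicity; `lamV Ω p V 0 = 0` is an auxiliary value that starts the recursion
(all eigenvalues are positive). -/
def lamV {N : ℕ} (Ω : Set (EuclideanSpace ℝ (Fin N))) (p : ℝ)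
    (V : EuclideanSpace ℝ (Fin N) → ℝ) : ℕ → ℝ
  | 0 => 0
  | k + 1 => sInf {lam | lam ∈ dirichletSpectrum Ω p V ∧ lamV Ω p V k < lam}

/-- The largest integer `k ≥ 1` with `λ_{V,k} < p c`. -/
def kp {N : ℕ} (Ω : Set (EuclideanSpace ℝ (Fin N))) (p c : ℝ)
    (V : EuclideanSpace ℝ (Fin N) → ℝ) : ℕ :=
  sSup {k : ℕ | 1 ≤ k ∧ lamV Ω p V k < p * c}

/-- `φ 0, …, φ (n-1)` is an orthonormal basis, for the inner product of `L²(Ω, V^{p-1} dx)`, of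
the eigenspace of `-Δ` for the eigenvalue `lam`. -/
structure IsEigenbasis {N : ℕ} (Ω : Set (EuclideanSpace ℝ (Fin N))) (p : ℝ)
    (V : EuclideanSpace ℝ (Fin N) → ℝ) (lam : ℝ) {n : ℕ}
    (φ : Fin n → EuclideanSpace ℝ (Fin N) → ℝ) : Prop where
  solves : ∀ j, SolvesEigen Ω p V lam (φ j)
  orthonormal : ∀ i j, ∫ x in Ω, φ i x * φ j x * V x ^ (p - 1) = if i = j then 1 else 0
  spans : ∀ χ, SolvesEigen Ω p V lam χ →
    ∃ a : Fin n → ℝ, ∀ᵐ x ∂volume.restrict Ω, χ x = ∑ j, a j * φ j x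

/-- Hypothesis (H2): `-Δφ = c p V^{p-1} φ` in `Ω`, `φ = 0` on `∂Ω`, has only the trivial
solution. -/
def H2 {N : ℕ} (Ω : Set (EuclideanSpace ℝ (Fin N))) (p c : ℝ)
    (V : EuclideanSpace ℝ (Fin N) → ℝ) : Prop :=
  ∀ φ, SolvesEigen Ω p V (c * p) φ → ∀ᵐ x ∂volume.restrict Ω, φ x = 0

/-! ### The rescaled fast diffusion flow -/

/-- The constant `c = 1 / ((1 - m) T) = p / ((p - 1) T)`, where `m = 1 / p`. -/
def rate (p T : ℝ) : ℝ := p / ((p - 1) * T)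

/-- `v ≥ 0` is a weak (energy) solution of the rescaled Cauchy-Dirichlet problem
`∂ₜ(v^p) = Δv + c v^p` in `(0,∞) × Ω`, `v = 0` on `(0,∞) × ∂Ω`, `v^p(0,·) = u₀` in `Ω`. The
solution is written as a function of time, with `v^p` continuous in time with values in `L¹(Ω)`,
so that `v t` is defined up to null sets for every single `t ≥ 0`; the boundary condition is
`v(t) ∈ H¹₀(Ω)`, and `G` is the spatial gradient of `v`. -/
structure IsRCDPSolution {N : ℕ} (Ω : Set (EuclideanSpace ℝ (Fin N))) (p c : ℝ)
    (u₀ : EuclideanSpace ℝ (Fin N) → ℝ) (v : ℝ → EuclideanSpace ℝ (Fin N) → ℝ) : Prop where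
  nonneg : ∀ t, 0 ≤ t → ∀ᵐ x ∂volume.restrict Ω, 0 ≤ v t x
  integrable : ∀ t, 0 ≤ t → IntegrableOn (fun x => v t x ^ p) Ω
  continuous : ∀ s, 0 ≤ s →
    Tendsto (fun t => ∫ x in Ω, |v t x ^ p - v s x ^ p|) (𝓝[Ici 0] s) (𝓝 0)
  initial : ∀ᵐ x ∂volume.restrict Ω, v 0 x ^ p = u₀ x
  equation : ∃ G : ℝ → EuclideanSpace ℝ (Fin N) → EuclideanSpace ℝ (Fin N),
    (∀ᵐ t ∂volume.restrict (Ioi (0 : ℝ)), HasH10Gradient Ω (v t) (G t)) ∧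
    (∀ a b : ℝ, 0 < a → a < b →
      MemLp (fun z : ℝ × EuclideanSpace ℝ (Fin N) => v z.1 z.2) 2
        (volume.restrict (Ioo a b ×ˢ Ω)) ∧
      MemLp (fun z : ℝ × EuclideanSpace ℝ (Fin N) => G z.1 z.2) 2
        (volume.restrict (Ioo a b ×ˢ Ω))) ∧
    ∀ ψ : ℝ × EuclideanSpace ℝ (Fin N) → ℝ, IsTestFunction (Ioi (0 : ℝ) ×ˢ Ω) ψ →
      ∫ z in Ioi (0 : ℝ) ×ˢ Ω,
        (v z.1 z.2 ^ p * deriv (fun s => ψ (s, z.2)) z.1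
          - inner ℝ (G z.1 z.2) (gradient (fun y => ψ (z.1, y)) z.2)
          + c * v z.1 z.2 ^ p * ψ z) = 0

/-- Hypothesis (H1')_δ: from some time on, `|v - V| ≤ δ V` almost everywhere. -/
def H1prime {N : ℕ} (Ω : Set (EuclideanSpace ℝ (Fin N))) (V : EuclideanSpace ℝ (Fin N) → ℝ) (δ : ℝ)
    (v : ℝ → EuclideanSpace ℝ (Fin N) → ℝ) : Prop :=
  ∃ t₁ : ℝ, 0 < t₁ ∧
    ∀ᵐ z : ℝ × EuclideanSpace ℝ (Fin N) ∂volume.restrict (Ici t₁ ×ˢ Ω),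
      |v z.1 z.2 - V z.2| ≤ δ * V z.2

/-- The nonlinear entropy `𝓔[v]`. -/
def entropy {N : ℕ} (Ω : Set (EuclideanSpace ℝ (Fin N))) (p : ℝ)
    (V v : EuclideanSpace ℝ (Fin N) → ℝ) : ℝ :=
  ∫ x in Ω, ((v x ^ (p + 1) - V x ^ (p + 1)) - (p + 1) / p * (v x ^ p - V x ^ p) * V x)

/-- The nonlinear Rayleigh quotient `𝓠[v]` associated with `φ`; it is `0` when `v = V`. -/
def quotient {N : ℕ} (Ω : Set (EuclideanSpace ℝ (Fin N))) (p : ℝ)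
    (V v φ : EuclideanSpace ℝ (Fin N) → ℝ) : ℝ :=
  |∫ x in Ω, (v x ^ p - V x ^ p) * φ x| / Real.sqrt (entropy Ω p V v)

end

end FastDiffusion

open FastDiffusion

/-! Write w = v^p - V^p and f = v - V, so that ∂ₜw = Δf + c w. Testing with an eigenfunction φ of
eigenvalue λ, the mode A = ∫ w φ satisfies A' = c A - λβ with β = ∫ V^{p-1} f φ. Since w ≈ p V^{p-1}
f, this is A' = μA + (λ/p)(A - pβ) with μ = c - λ/p, and μ > 0 exactly when λ < pc. A bounded
solution of an unstable linear equation is controlled by its future forcing: |A(t)| ≤ sup_{s ≥ t}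
|λ/p| |A - pβ|(s) / μ (`abs_le_of_hasDerivAt_unstable`). The linearization error A - pβ is at most a
constant times ε √𝓔, where ε is the relative distance of v to V
(`IsPositiveBounded.sq_mode_sub_le`).

If 𝓔 is nonincreasing for large times, the assumed bound gives ε ≤ κ 𝓔[v(t-1)]^η at all times s ≥ t,
hence 𝓠 ≤ K 𝓔[v(t-1)]^η. If moreover 𝓔 → 0, half of the exponent eventually absorbs K
(`IsNearbyFlow.eventually_quotient_le`).

The main work is therefore `exists_decay_threshold`: for small δ, 𝓔 is eventually nonincreasing and
tends to 0. It combines three facts. First, the energy inequality 𝓔' ≤ ((p+1)/p)(-∫|∇f|² + c∫ w f)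
in integrated form (`IsNearbyFlow.entropy_sub_le`); v has no time derivative to test with, so
convexity of the entropy and averages of time translates replace the chain rule. Second, a spectral
gap (`exists_dirichlet_gap`): by (H2) and compactness of H¹₀ in L², ∫|∇f|² dominates Λ∫V^{p-1}f²
with Λ > pc, up to finitely many modes with λ < pc. Third, with Q the sum of the squares of those
modes, one gets 𝓔' ≤ -ν𝓔 + C Q and Q' ≥ μQ - O(δ)𝓔. If 𝓔 < θQ at some time, Q must become unbounded,
contradicting v ≈ V; so θQ ≤ 𝓔 throughout and 𝓔' ≤ -(ν/2)𝓔 (`antitone_tendsto_zero_of_coupled`). -/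

/-! ### Spectral gap for compact symmetric operators. -/

section CompactOperators

variable {X : Type*} [NormedAddCommGroup X] [InnerProductSpace ℝ X] [CompleteSpace X]

open Module.End in
/-- A nonzero compact symmetric nonnegative operator attains its norm as an eigenvalue. -/
theorem IsCompactOperator.hasEigenvalue_norm {K : X →L[ℝ] X} (hK : IsCompactOperator K)
    (hs : (K : X →ₗ[ℝ] X).IsSymmetric) (hpos : ∀ x, 0 ≤ inner ℝ (K x) x) (h0 : K ≠ 0) :
    HasEigenvalue (K : X →ₗ[ℝ] X) ‖K‖ := by
  have hsa : IsSelfAdjoint K := by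
    rwa [ContinuousLinearMap.isSelfAdjoint_iff_isSymmetric]
  have hr := K.spectralRadius_eq_nnnorm hsa
  have hne : (spectrum ℝ K).Nonempty := by
    by_contra hcon
    rw [Set.not_nonempty_iff_eq_empty] at hcon
    simp [spectralRadius, hcon] at hr
    exact h0 (by simpa using hr.symm)
  obtain ⟨k, hk, hk2⟩ := spectrum.exists_nnnorm_eq_spectralRadius_of_nonempty hne
  rw [hr, ENNReal.coe_inj] at hk2
  have hk3 : |k| = ‖K‖ := by simpa using congrArg NNReal.toReal hk2
  have hk0 : k ≠ 0 := by
    rintro rfl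
    simp at hk3
    exact h0 (by simpa using hk3.symm)
  have hev := (hK.hasEigenvalue_iff_mem_spectrum hk0).2 hk
  -- The spectral radius only gives |k| = ‖K‖; nonnegativity of the form excludes k = -‖K‖.
  have hkpos : 0 ≤ k := eigenvalue_nonneg_of_nonneg (T := (K : X →ₗ[ℝ] X)) hev (fun x => by
    simpa [real_inner_comm] using hpos x)
  rw [← hk3, abs_of_nonneg hkpos]
  exact hev

-- Unit eigenvectors for distinct eigenvalues are orthogonal, so by Pythagoras their images under
-- `K` lie at mutual distance more than q. Infinitely many of them would contradict relative
-- compactness of the image of the unit ball.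
open Module.End in
omit [CompleteSpace X] in
theorem IsCompactOperator.finite_eigenvalues_gt {K : X →L[ℝ] X} (hK : IsCompactOperator K)
    (hs : (K : X →ₗ[ℝ] X).IsSymmetric) {q : ℝ} (hq : 0 < q) :
    {k : ℝ | q < k ∧ HasEigenvalue (K : X →ₗ[ℝ] X) k}.Finite := by
  by_contra hinf
  have hinf : {k : ℝ | q < k ∧ HasEigenvalue (K : X →ₗ[ℝ] X) k}.Infinite := hinf
  set k := hinf.natEmbedding
  have hev : ∀ n, ∃ x : X, ‖x‖ = 1 ∧ K x = (k n : ℝ) • x := by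
    intro n
    obtain ⟨x, hx, hx0⟩ := (k n).2.2.exists_hasEigenvector
    rw [mem_eigenspace_iff] at hx
    refine ⟨(‖x‖⁻¹ : ℝ) • x, ?_, ?_⟩
    · rw [norm_smul, norm_inv, norm_norm, inv_mul_cancel₀ (by simpa using hx0)]
    · have : K x = (k n : ℝ) • x := hx
      rw [map_smul, this, smul_comm]
  choose x hx1 hxk using hev
  have horth : ∀ m n, m ≠ n → inner ℝ (x m) (x n) = 0 := by
    intro m n hmn
    have h := hs (x m) (x n)
    simp only [ContinuousLinearMap.coe_coe, hxk, inner_smul_left, inner_smul_right] at h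
    have hne : (k m : ℝ) ≠ k n := fun h => hmn (k.injective (Subtype.ext h))
    have : ((k m : ℝ) - k n) * inner ℝ (x m) (x n) = 0 := by
      rw [sub_mul, sub_eq_zero]; exact h
    exact (mul_eq_zero.1 this).resolve_left (sub_ne_zero.2 hne)
  have hcomp : IsCompact (closure (K '' Metric.closedBall 0 1)) :=
    hK.isCompact_closure_image_closedBall 1
  obtain ⟨a, -, φ, hφ, hlim⟩ := hcomp.tendsto_subseq (x := fun n => K (x n))
    (fun n => subset_closure ⟨x n, by simp [hx1], rfl⟩)
  have hc := hlim.cauchySeq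
  rw [Metric.cauchySeq_iff] at hc
  obtain ⟨M, hM⟩ := hc q hq
  have h1 := hM M le_rfl (M + 1) (by omega)
  have hne : φ M ≠ φ (M + 1) := (hφ (Nat.lt_succ_self M)).ne
  simp only [Function.comp, dist_eq_norm] at h1
  have h2 : ‖K (x (φ M)) - K (x (φ (M + 1)))‖ ^ 2 = (k (φ M) : ℝ) ^ 2 + (k (φ (M+1)) : ℝ) ^ 2 := by
    rw [norm_sub_sq_real, hxk, hxk, norm_smul, norm_smul, hx1, hx1, inner_smul_left,
      inner_smul_right, horth _ _ hne]
    simp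
  have h3 : q < (k (φ M) : ℝ) := (k (φ M)).2.1
  have h4 : 0 ≤ ‖K (x (φ M)) - K (x (φ (M + 1)))‖ := norm_nonneg _
  nlinarith [sq_nonneg (k (φ (M+1)) : ℝ)]

open Module.End in
/-- Spectral gap below a non-eigenvalue `q > 0` of a compact symmetric nonnegative operator, in
terms of finitely many eigenvectors. -/
theorem IsCompactOperator.exists_spectral_gap {K : X →L[ℝ] X} (hK : IsCompactOperator K)
    (hs : (K : X →ₗ[ℝ] X).IsSymmetric) (hpos : ∀ x, 0 ≤ inner ℝ (K x) x) {q : ℝ} (hq : 0 < q)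
    (hne : ∀ x, K x = q • x → x = 0) :
    ∃ (m : ℕ) (e : Fin m → X) (k : Fin m → ℝ) (q' C : ℝ), 0 < q' ∧ q' < q ∧ 0 ≤ C ∧
      (∀ i, q < k i ∧ K (e i) = k i • e i) ∧
      ∀ x, inner ℝ (K x) x ≤ q' * ‖x‖ ^ 2 + C * ∑ i, inner ℝ (K (e i)) x ^ 2 := by
  set S := {k : ℝ | q < k ∧ HasEigenvalue (K : X →ₗ[ℝ] X) k} with hS
  have hfin : S.Finite := hK.finite_eigenvalues_gt hs hq
  have : Finite S := hfin
  -- `W` collects all eigenvectors with eigenvalue above q. It is finite-dimensional, and both `W`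
  -- and its orthogonal complement are invariant, so the quadratic form splits.
  set W : Submodule ℝ X := ⨆ k : S, eigenspace (K : X →ₗ[ℝ] X) k with hW
  have : ∀ k : S, FiniteDimensional ℝ (eigenspace (K : X →ₗ[ℝ] X) k) := fun k =>
    ContinuousLinearMap.finite_dimensional_eigenspace hK _ (hq.trans k.2.1).ne'
  have : FiniteDimensional ℝ W := by rw [hW]; infer_instance
  have hWinv : ∀ x ∈ W, (K : X →ₗ[ℝ] X) x ∈ W := by
    intro x hx
    refine Submodule.iSup_induction _ (motive := fun x => (K : X →ₗ[ℝ] X) x ∈ W) hx ?_ ?_ ?_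
    · intro k y hy
      rw [mem_eigenspace_iff.1 hy]
      exact W.smul_mem _ (Submodule.mem_iSup_of_mem k hy)
    · simp
    · intro y z hy hz
      rw [map_add]; exact W.add_mem hy hz
  have hWo : ∀ x ∈ Wᗮ, (K : X →ₗ[ℝ] X) x ∈ Wᗮ := by
    intro x hx
    rw [Submodule.mem_orthogonal] at hx ⊢
    intro u hu
    rw [← hs]
    exact hx _ (hWinv u hu)
  have hsW := hs.restrict_invariant hWinv
  set b := hsW.eigenvectorBasis rfl
  set k := hsW.eigenvalues rfl
  have hbk : ∀ i, K (b i) = k i • (b i : X) := fun i => by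
    exact congrArg Subtype.val (hsW.apply_eigenvectorBasis rfl i)
  -- An eigenvector in `W` with eigenvalue at most q would be orthogonal to every eigenspace
  -- spanning `W`, hence to itself.
  have hkq : ∀ i, q < k i := by
    intro i
    by_contra hcon
    have hmem : (b i : X) ∈ eigenspace (K : X →ₗ[ℝ] X) (k i) := mem_eigenspace_iff.2 (hbk i)
    have : (b i : X) ∈ Wᗮ := by
      have hWt : Wᗮ = ⨅ k : S, (eigenspace (K : X →ₗ[ℝ] X) k)ᗮ := by
        rw [hW, Submodule.iInf_orthogonal]
      rw [hWt, Submodule.mem_iInf]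
      intro l
      rw [Submodule.mem_orthogonal]
      intro u hu
      have hlk : (l : ℝ) ≠ k i := fun h => hcon (h ▸ l.2.1)
      have := hs.orthogonalFamily_eigenspaces hlk ⟨u, hu⟩ ⟨b i, hmem⟩
      simpa using this
    have h0 : (b i : X) = 0 := by
      have := (Submodule.mem_orthogonal _ _).1 this (b i) (b i).2
      simpa using this
    have h1 := b.orthonormal.1 i
    rw [show b i = 0 from Subtype.ext h0] at h1
    simp at h1
  -- On the complement, the norm of the restriction is an eigenvalue of `K` unless it is 0. It is
  -- not q by hypothesis, and above q its eigenvector would lie in `W`; hence it is below q.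
  obtain ⟨q', hq'0, hq'q, hq'⟩ : ∃ q', 0 < q' ∧ q' < q ∧ ∀ x ∈ Wᗮ, inner ℝ (K x) x ≤ q' * ‖x‖^2 := by
    set R : Wᗮ →L[ℝ] Wᗮ := K.restrict hWo
    have hR : ∀ x, (R x : X) = K x := fun x => rfl
    have hRq : ‖R‖ < q := by
      by_cases hR0 : R = 0
      · exact (R.opNorm_le_bound le_rfl fun x => by simp [hR0]).trans_lt hq
      have hRc : IsCompactOperator R := hK.restrict' hWo
      have hRs : (R : Wᗮ →ₗ[ℝ] Wᗮ).IsSymmetric := hs.restrict_invariant hWo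
      have hev := hRc.hasEigenvalue_norm hRs (fun x => hpos x) hR0
      obtain ⟨x, hx, hx0⟩ := hev.exists_hasEigenvector
      have hx1 : K x = ‖R‖ • (x : X) := congrArg Subtype.val (mem_eigenspace_iff.1 hx)
      have hx0' : (x : X) ≠ 0 := by simpa using hx0
      rcases lt_trichotomy ‖R‖ q with h | h | h
      · exact h
      · exact absurd (hne x (h ▸ hx1)) hx0'
      · exfalso
        have hmem : (x : X) ∈ eigenspace (K : X →ₗ[ℝ] X) ‖R‖ := mem_eigenspace_iff.2 hx1
        have hev' : HasEigenvalue (K : X →ₗ[ℝ] X) ‖R‖ :=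
          hasEigenvalue_of_hasEigenvector ⟨hmem, hx0'⟩
        have hxW : (x : X) ∈ W := Submodule.mem_iSup_of_mem (⟨‖R‖, h, hev'⟩ : S) hmem
        exact hx0' (by simpa using (Submodule.mem_orthogonal _ _).1 x.2 x hxW)
    -- The maximum with q / 2 only keeps q' positive when the restriction vanishes.
    refine ⟨max ‖R‖ (q / 2), by positivity, max_lt hRq (by linarith), fun x hx => ?_⟩
    have h1 : inner ℝ (K x) x ≤ ‖R ⟨x, hx⟩‖ * ‖x‖ := real_inner_le_norm _ _
    have h2 := R.le_opNorm ⟨x, hx⟩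
    have h3 : ‖(⟨x, hx⟩ : Wᗮ)‖ = ‖x‖ := rfl
    rw [h3] at h2
    calc _ ≤ (‖R‖ * ‖x‖) * ‖x‖ := h1.trans (by gcongr)
      _ = ‖R‖ * ‖x‖ ^ 2 := by ring
      _ ≤ _ := by gcongr; exact le_max_left _ _
  -- On `W` the form is a sum of k⟨b,x⟩², and k ≤ k²/q because k > q; since K b = k b, the constant
  -- q⁻¹ suffices.
  refine ⟨_, fun i => (b i : X), k, q', q⁻¹, hq'0, hq'q, by positivity, fun i => ⟨hkq i, hbk i⟩, ?_⟩
  intro x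
  set y : X := W.starProjection x with hy
  have hyW : y ∈ W := Submodule.starProjection_apply_mem W x
  set z : X := x - y with hz
  have hzW : z ∈ Wᗮ := Submodule.sub_starProjection_mem_orthogonal x
  have hxyz : x = y + z := by simp [hz]
  have hKy := hWinv y hyW
  have hKz := hWo z hzW
  have hyz : inner ℝ y z = 0 := (Submodule.mem_orthogonal _ _).1 hzW y hyW
  have h1 : inner ℝ (K x) x = inner ℝ (K y) y + inner ℝ (K z) z := by
    have e1 : inner ℝ (K y) z = 0 := (Submodule.mem_orthogonal _ _).1 hzW _ hKy
    have e2 : inner ℝ (K z) y = 0 := by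
      rw [real_inner_comm]; exact (Submodule.mem_orthogonal _ _).1 hKz _ hyW
    rw [hxyz, map_add, inner_add_left, inner_add_right, inner_add_right, e1, e2]; ring
  have h2 : ‖z‖ ^ 2 ≤ ‖x‖ ^ 2 := by
    rw [hxyz, norm_add_sq_real, hyz]; nlinarith [sq_nonneg ‖y‖]
  have hbx : ∀ i, inner ℝ (b i : X) x = inner ℝ (b i : X) y := fun i => by
    have : inner ℝ (b i : X) z = 0 := (Submodule.mem_orthogonal _ _).1 hzW _ (b i).2
    rw [hxyz, inner_add_right, this, add_zero]
  have h3 : inner ℝ (K y) y = ∑ i, k i * inner ℝ (b i : X) x ^ 2 := by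
    have hsum := b.sum_inner_mul_inner (⟨K y, hKy⟩ : W) (⟨y, hyW⟩ : W)
    have : inner ℝ (K y) y = ∑ i, inner ℝ (K y) (b i : X) * inner ℝ (b i : X) y := hsum.symm
    rw [this]
    refine Finset.sum_congr rfl fun i _ => ?_
    have : inner ℝ (K y) (b i : X) = k i * inner ℝ (b i : X) y := by
      rw [show inner ℝ (K y) (b i : X) = inner ℝ y (K (b i)) from hs y (b i), hbk,
        inner_smul_right, real_inner_comm]
    rw [this, hbx]; ring
  rw [h1, h3, add_comm]
  refine add_le_add ((hq' z hzW).trans (by gcongr)) ?_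
  rw [Finset.mul_sum]
  refine Finset.sum_le_sum fun i _ => ?_
  rw [hbk, inner_smul_left]
  have hk0 := hkq i
  simp only [RCLike.conj_to_real]
  rw [inv_mul_eq_div, le_div_iff₀ hq, mul_pow]
  nlinarith [mul_nonneg (mul_nonneg (sub_nonneg.2 hk0.le) (hq.trans hk0).le) (sq_nonneg (inner ℝ (b i : X) x))]

end CompactOperators

/-! ### L² estimates for translations and local averages of smooth functions. -/

section Inequalities

theorem MeasureTheory.lintegral_sq_le {α : Type*} [MeasurableSpace α] {μ : Measure α}
    {f : α → ℝ≥0∞} (hf : AEMeasurable f μ) :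
    (∫⁻ x, f x ∂μ) ^ 2 ≤ μ univ * ∫⁻ x, f x ^ 2 ∂μ := by
  have h := ENNReal.lintegral_mul_le_Lp_mul_Lq μ Real.HolderConjugate.two_two
    (f := fun _ => 1) aemeasurable_const hf
  simp only [Pi.mul_apply, one_mul, ENNReal.one_rpow, lintegral_const] at h
  have e : ∀ a : ℝ≥0∞, (a ^ (1 / (2 : ℝ))) ^ 2 = a := fun a => by
    rw [← ENNReal.rpow_natCast, ← ENNReal.rpow_mul]; norm_num
  calc (∫⁻ x, f x ∂μ) ^ 2 ≤ _ := pow_le_pow_left₀ zero_le h 2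
    _ = _ := by rw [mul_pow, e, e]; simp

theorem MeasureTheory.sq_enorm_integral_le {α : Type*} [MeasurableSpace α] {μ : Measure α}
    {f : α → ℝ} (hf : AEStronglyMeasurable f μ) :
    ‖∫ x, f x ∂μ‖ₑ ^ 2 ≤ μ univ * ∫⁻ x, ‖f x‖ₑ ^ 2 ∂μ :=
  (pow_le_pow_left₀ zero_le (enorm_integral_le_lintegral_enorm f) 2).trans
    (lintegral_sq_le hf.enorm)

theorem MeasureTheory.eLpNorm_two_sq {α F : Type*} [MeasurableSpace α] {μ : Measure α}
    [NormedAddCommGroup F] (f : α → F) :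
    eLpNorm f 2 μ ^ 2 = ∫⁻ x, ‖f x‖ₑ ^ 2 ∂μ := by
  have := eLpNorm_nnreal_pow_eq_lintegral (f := f) (μ := μ) (p := 2) two_ne_zero
  simpa using this

variable {E : Type*} [NormedAddCommGroup E] [InnerProductSpace ℝ E] [CompleteSpace E]

theorem ContDiff.continuous_gradient {ψ : E → ℝ} (h : ContDiff ℝ ∞ ψ) :
    Continuous (gradient ψ) := by
  unfold gradient
  exact (InnerProductSpace.toDual ℝ E).symm.continuous.comp (h.continuous_fderiv (by simp))

theorem HasCompactSupport.gradient {ψ : E → ℝ} (h : HasCompactSupport ψ) :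
    HasCompactSupport (gradient ψ) :=
  (h.fderiv (𝕜 := ℝ)).comp_left (g := (InnerProductSpace.toDual ℝ E).symm) (map_zero _)

variable [FiniteDimensional ℝ E] [MeasurableSpace E] [BorelSpace E]

/-- Translations of a smooth function are Lipschitz in `L²`, with constant the norm of the gradient. -/
theorem ContDiff.lintegral_translate_sub_le {ψ : E → ℝ} (h : ContDiff ℝ ∞ ψ) (z : E) :
    ∫⁻ x, ‖ψ (x + z) - ψ x‖ₑ ^ 2 ≤ ‖z‖ₑ ^ 2 * ∫⁻ x, ‖gradient ψ x‖ₑ ^ 2 := by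
  have hg := h.continuous_gradient
  have hcont : ∀ x, Continuous fun s : ℝ => Inner.inner ℝ (gradient ψ (x + s • z)) z := fun x =>
    Continuous.inner (hg.comp (by fun_prop)) continuous_const
  -- Fundamental theorem of calculus along the segment from x to x + z, then Cauchy–Schwarz on the
  -- unit interval.
  have hpt : ∀ x, ‖ψ (x + z) - ψ x‖ₑ ^ 2 ≤
      ∫⁻ s in Ioc (0:ℝ) 1, ‖z‖ₑ ^ 2 * ‖gradient ψ (x + s • z)‖ₑ ^ 2 := by
    intro x
    have hder : ∀ s : ℝ, HasDerivAt (fun s : ℝ => ψ (x + s • z))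
        (Inner.inner ℝ (gradient ψ (x + s • z)) z) s := by
      intro s
      have h1 : HasFDerivAt ψ (fderiv ℝ ψ (x + s • z)) (x + s • z) :=
        (h.differentiable (by simp) _).hasFDerivAt
      have h2 : HasDerivAt (fun s : ℝ => x + s • z) z s := by
        simpa using ((hasDerivAt_id s).smul_const z).const_add x
      have h3 := h1.comp_hasDerivAt s h2
      have h4 : Inner.inner ℝ (gradient ψ (x + s • z)) z = fderiv ℝ ψ (x + s • z) z :=
        InnerProductSpace.toDual_symm_apply (𝕜 := ℝ)
      rw [h4]; exact h3
    have hftc := intervalIntegral.integral_eq_sub_of_hasDerivAt (a := 0) (b := 1)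
      (fun s _ => hder s) ((hcont x).intervalIntegrable 0 1)
    simp only [one_smul, zero_smul, add_zero] at hftc
    rw [← hftc, intervalIntegral.integral_of_le zero_le_one]
    refine (sq_enorm_integral_le (hcont x).aestronglyMeasurable).trans ?_
    simp only [MeasurableSet.univ, Measure.restrict_apply, univ_inter, Real.volume_Ioc, sub_zero,
      ENNReal.ofReal_one, one_mul]
    refine lintegral_mono fun s => ?_
    rw [← mul_pow, mul_comm]
    refine pow_le_pow_left₀ zero_le ?_ 2
    simp only [← ofReal_norm]
    rw [← ENNReal.ofReal_mul (norm_nonneg _)]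
    exact ENNReal.ofReal_le_ofReal (norm_inner_le_norm _ _)
  refine (lintegral_mono hpt).trans ?_
  rw [lintegral_lintegral_swap]
  · have : ∀ s : ℝ, ∫⁻ x, ‖z‖ₑ ^ 2 * ‖gradient ψ (x + s • z)‖ₑ ^ 2 =
        ‖z‖ₑ ^ 2 * ∫⁻ x, ‖gradient ψ x‖ₑ ^ 2 := fun s => by
      rw [lintegral_const_mul' _ _ (by simp),
        lintegral_add_right_eq_self (fun x => ‖gradient ψ x‖ₑ ^ 2)]
    simp [this]
  · have : Continuous fun q : E × ℝ => gradient ψ (q.1 + q.2 • z) := hg.comp (by fun_prop)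
    exact (this.enorm.measurable.pow_const 2).const_mul _ |>.aemeasurable

/-- Poincaré inequality for functions supported in a bounded set. -/
theorem ContDiff.lintegral_sq_le_of_bounded {ψ : E → ℝ} (h : ContDiff ℝ ∞ ψ) {Ω : Set E} {z : E}
    (hz : ∀ x ∈ Ω, x + z ∉ Ω) (hsupp : tsupport ψ ⊆ Ω) :
    ∫⁻ x, ‖ψ x‖ₑ ^ 2 ≤ ‖z‖ₑ ^ 2 * ∫⁻ x, ‖gradient ψ x‖ₑ ^ 2 := by
  -- On Ω the translate ψ(x + z) vanishes, so ψ(x) is, up to sign, the increment of ψ.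
  refine le_trans (lintegral_mono fun x => ?_) (h.lintegral_translate_sub_le z)
  by_cases hx : x ∈ Ω
  · rw [show ψ (x + z) = 0 from image_eq_zero_of_notMem_tsupport fun h => hz x hx (hsupp h)]
    simp
  · simp [show ψ x = 0 from image_eq_zero_of_notMem_tsupport fun h => hx (hsupp h)]

/-- Quantitative approximation of a smooth function by its averages on small sets `Q x ∋ x`. -/
theorem ContDiff.lintegral_sub_average_le {ψ : E → ℝ} (h : ContDiff ℝ ∞ ψ)
    {Q : E → Set E} (hQm : ∀ x, MeasurableSet (Q x)) {r : ℝ}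
    (hQr : ∀ x, ∀ y ∈ Q x, ‖y - x‖ ≤ r) {a : ℝ} (ha : 0 < a)
    (hQa : ∀ x, volume (Q x) = ENNReal.ofReal a) :
    ∫⁻ x, ‖ψ x - a⁻¹ * ∫ y in Q x, ψ y‖ₑ ^ 2 ≤
      (ENNReal.ofReal a)⁻¹ * volume (Metric.closedBall (0 : E) r) * ENNReal.ofReal r ^ 2 *
        ∫⁻ x, ‖gradient ψ x‖ₑ ^ 2 := by
  have hψ := h.continuous
  set A := ENNReal.ofReal a with hA
  have hA0 : A ≠ 0 := by simpa [hA] using ha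
  have hAt : A ≠ ⊤ := by simp [hA]
  have hfin : ∀ x, IsFiniteMeasure (volume.restrict (Q x)) := fun x => ⟨by simp [hQa, hAt.lt_top]⟩
  -- After Cauchy–Schwarz, `Q x` is enlarged to the ball of radius r about x. This makes the domain
  -- of integration independent of x, so that the integrals can be exchanged; the price is the ratio
  -- of the volumes.
  have hpt : ∀ x, ‖ψ x - a⁻¹ * ∫ y in Q x, ψ y‖ₑ ^ 2 ≤
      A⁻¹ * ∫⁻ z in Metric.closedBall (0 : E) r, ‖ψ (x + z) - ψ x‖ₑ ^ 2 := by
    intro x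
    have hint : IntegrableOn ψ (Q x) := by
      refine IntegrableOn.mono_set (hψ.continuousOn.integrableOn_compact
        (isCompact_closedBall x r)) fun y hy => ?_
      rw [mem_closedBall_iff_norm]; exact hQr x y hy
    have e1 : ψ x - a⁻¹ * ∫ y in Q x, ψ y = a⁻¹ * ∫ y in Q x, (ψ x - ψ y) := by
      rw [integral_sub (integrable_const _) hint]
      simp [Measure.real, hQa, hA, ha.le]
      field_simp
    have e2 : ‖a⁻¹‖ₑ = A⁻¹ := by
      rw [← ofReal_norm, Real.norm_of_nonneg (by positivity), ENNReal.ofReal_inv_of_pos ha]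
    rw [e1, enorm_mul, mul_pow, e2]
    have e3 := sq_enorm_integral_le (μ := volume.restrict (Q x)) (f := fun y => ψ x - ψ y)
      (by fun_prop)
    simp only [Measure.restrict_apply MeasurableSet.univ, univ_inter, hQa] at e3
    calc A⁻¹ ^ 2 * ‖∫ y in Q x, (ψ x - ψ y)‖ₑ ^ 2
        ≤ A⁻¹ ^ 2 * (A * ∫⁻ y in Q x, ‖ψ x - ψ y‖ₑ ^ 2) := by gcongr
      _ = A⁻¹ * ∫⁻ y in Q x, ‖ψ x - ψ y‖ₑ ^ 2 := by
        rw [sq, ← mul_assoc, mul_assoc A⁻¹, ENNReal.inv_mul_cancel hA0 hAt, mul_one]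
      _ ≤ _ := by
        refine mul_le_mul le_rfl ?_ zero_le zero_le
        rw [← lintegral_indicator (hQm x), ← lintegral_indicator measurableSet_closedBall]
        refine (lintegral_add_left_eq_self _ x).symm.trans_le (lintegral_mono fun z => ?_)
        by_cases hz : x + z ∈ Q x
        · have : z ∈ Metric.closedBall (0 : E) r := by
            simpa using hQr x _ hz
          rw [indicator_of_mem hz, indicator_of_mem this, ← enorm_neg, neg_sub]
        · rw [indicator_of_notMem hz]; exact zero_le
  refine (lintegral_mono hpt).trans ?_
  rw [lintegral_const_mul' _ _ (by simpa using hA0), lintegral_lintegral_swap]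
  · rw [mul_assoc, mul_assoc]
    gcongr
    calc _ ≤ ∫⁻ z in Metric.closedBall (0 : E) r,
          ENNReal.ofReal r ^ 2 * ∫⁻ x, ‖gradient ψ x‖ₑ ^ 2 := by
          refine setLIntegral_mono' measurableSet_closedBall fun z hz => ?_
          refine (h.lintegral_translate_sub_le z).trans ?_
          gcongr
          rw [← ofReal_norm]
          exact ENNReal.ofReal_le_ofReal (by simpa using hz)
      _ = _ := by rw [lintegral_const]; simp [mul_comm]
  · have : Continuous fun q : E × E => ψ (q.1 + q.2) - ψ q.1 := by fun_prop
    exact (this.enorm.measurable.pow_const 2).aemeasurable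

end Inequalities

/-! ### Partition of space into half-open grid cubes. -/

section Cubes

variable {N : ℕ}

/-- The cube of side `h` of the grid `hℤᴺ` with index `m`. -/
def gridCube (h : ℝ) (m : Fin N → ℤ) : Set (EuclideanSpace ℝ (Fin N)) :=
  {x | ∀ i, ⌊x i / h⌋ = m i}

theorem measurableSet_gridCube (h : ℝ) (m : Fin N → ℤ) : MeasurableSet (gridCube h m) := by
  rw [gridCube, ofPred_forall]
  refine MeasurableSet.iInter fun i => ?_
  have : Measurable fun x : EuclideanSpace ℝ (Fin N) => ⌊x i / h⌋ := by fun_prop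
  exact this (measurableSet_singleton (m i))

theorem volume_gridCube {h : ℝ} (hh : 0 < h) (m : Fin N → ℤ) :
    volume (gridCube h m) = ENNReal.ofReal (h ^ N) := by
  have hmp := EuclideanSpace.volume_preserving_symm_measurableEquiv_toLp (Fin N)
  have : gridCube h m = (MeasurableEquiv.toLp 2 (Fin N → ℝ)).symm ⁻¹'
      (Set.pi univ fun i => Ico (m i * h) ((m i + 1) * h)) := by
    ext x
    simp only [gridCube, mem_ofPred_eq, mem_preimage, Set.mem_pi, mem_univ, true_imp_iff, mem_Ico]
    refine forall_congr' fun i => ?_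
    rw [Int.floor_eq_iff, le_div_iff₀ hh, div_lt_iff₀ hh]
    exact Iff.rfl
  rw [this, hmp.measure_preimage_equiv, Real.volume_pi_Ico]
  simp [add_mul, ENNReal.ofReal_pow hh.le]

theorem norm_sub_le_of_mem_gridCube {h : ℝ} (hh : 0 < h) {m : Fin N → ℤ}
    {x y : EuclideanSpace ℝ (Fin N)} (hx : x ∈ gridCube h m) (hy : y ∈ gridCube h m) :
    ‖y - x‖ ≤ Real.sqrt N * h := by
  rw [EuclideanSpace.norm_eq]
  have : ∑ i, ‖(y - x) i‖ ^ 2 ≤ N * h ^ 2 := by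
    calc _ ≤ ∑ _i : Fin N, h ^ 2 := by
          refine Finset.sum_le_sum fun i _ => ?_
          have h1 := (hx i).trans (hy i).symm
          have h2 := Int.abs_sub_lt_one_of_floor_eq_floor h1
          rw [← sub_div, abs_div, abs_of_pos hh, div_lt_one hh] at h2
          rw [Real.norm_eq_abs, sq_abs]
          have h3 := abs_lt.1 h2
          simp only [PiLp.sub_apply]
          nlinarith
      _ = _ := by simp
  calc _ ≤ Real.sqrt (N * h ^ 2) := Real.sqrt_le_sqrt this
    _ = _ := by rw [Real.sqrt_mul (by positivity), Real.sqrt_sq hh.le]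

theorem finite_gridCube_inter {h : ℝ} (hh : 0 < h) {Ω : Set (EuclideanSpace ℝ (Fin N))}
    (hΩ : Bornology.IsBounded Ω) : {m : Fin N → ℤ | (gridCube h m ∩ Ω).Nonempty}.Finite := by
  obtain ⟨R, hR⟩ := hΩ.subset_closedBall 0
  refine (Set.Finite.pi' (fun _ : Fin N => Set.finite_Icc ⌊-R / h⌋ ⌊R / h⌋)).subset ?_
  rintro m ⟨x, hx, hxΩ⟩ i
  have h1 : ‖x‖ ≤ R := by simpa using hR hxΩ
  have h2 := abs_le.1 ((Real.norm_eq_abs _ ▸ PiLp.norm_apply_le x i).trans h1)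
  rw [← hx i]
  exact ⟨Int.floor_le_floor (by gcongr; exact h2.1), Int.floor_le_floor (by gcongr; exact h2.2)⟩

end Cubes

/-! ### H¹₀(Ω) as a Hilbert space, Poincaré inequality and compact embedding in L²(Ω). -/

noncomputable section SobolevSpace

variable {N : ℕ} {Ω : Set (EuclideanSpace ℝ (Fin N))}

local notation "𝔼" => EuclideanSpace ℝ (Fin N)

theorem FastDiffusion.IsTestFunction.memLp {ψ : 𝔼 → ℝ} (h : IsTestFunction Ω ψ) (μ : Measure 𝔼)
    [IsFiniteMeasureOnCompacts μ] : MemLp ψ 2 μ :=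
  h.1.continuous.memLp_of_hasCompactSupport h.2.1

theorem FastDiffusion.IsTestFunction.memLp_gradient {ψ : 𝔼 → ℝ} (h : IsTestFunction Ω ψ)
    (μ : Measure 𝔼) [IsFiniteMeasureOnCompacts μ] : MemLp (gradient ψ) 2 μ :=
  h.1.continuous_gradient.memLp_of_hasCompactSupport h.2.1.gradient

theorem gradient_add_of_differentiable {ψ₁ ψ₂ : 𝔼 → ℝ} (h₁ : Differentiable ℝ ψ₁)
    (h₂ : Differentiable ℝ ψ₂) :
    gradient (fun x => ψ₁ x + ψ₂ x) = fun x => gradient ψ₁ x + gradient ψ₂ x := by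
  ext1 x
  unfold gradient
  rw [fderiv_fun_add (h₁ x) (h₂ x), map_add]

theorem gradient_const_mul_of_differentiable {ψ : 𝔼 → ℝ} (h : Differentiable ℝ ψ) (a : ℝ) :
    gradient (fun x => a * ψ x) = fun x => a • gradient ψ x := by
  ext1 x
  unfold gradient
  rw [fderiv_const_mul (h x), map_smul]

theorem FastDiffusion.IsTestFunction.add {ψ₁ ψ₂ : 𝔼 → ℝ} (h₁ : IsTestFunction Ω ψ₁)
    (h₂ : IsTestFunction Ω ψ₂) : IsTestFunction Ω (fun x => ψ₁ x + ψ₂ x) :=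
  ⟨h₁.1.add h₂.1, h₁.2.1.add h₂.2.1,
    (tsupport_add ψ₁ ψ₂).trans (union_subset h₁.2.2 h₂.2.2)⟩

theorem FastDiffusion.IsTestFunction.const_mul {ψ : 𝔼 → ℝ} (h : IsTestFunction Ω ψ) (a : ℝ) :
    IsTestFunction Ω (fun x => a * ψ x) :=
  ⟨contDiff_const.mul h.1, h.2.1.mul_left, (tsupport_mul_subset_right).trans h.2.2⟩

theorem FastDiffusion.IsTestFunction.zero : IsTestFunction Ω (fun _ : 𝔼 => (0 : ℝ)) := by
  refine ⟨contDiff_const, HasCompactSupport.zero, ?_⟩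
  rw [show (fun _ : 𝔼 => (0 : ℝ)) = 0 from rfl, tsupport_zero]
  exact empty_subset _

theorem FastDiffusion.IsTestFunction.differentiable {ψ : 𝔼 → ℝ} (h : IsTestFunction Ω ψ) :
    Differentiable ℝ ψ := h.1.differentiable (by simp)

variable (Ω) in
/-- Pairs `(ψ, ∇ψ)` with `ψ` a test function, as elements of `L² × L²`. -/
def testGraph : Submodule ℝ (Lp ℝ 2 (volume.restrict Ω) × Lp 𝔼 2 (volume.restrict Ω)) where
  carrier := {z | ∃ ψ, IsTestFunction Ω ψ ∧ z.1 =ᵐ[volume.restrict Ω] ψ ∧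
    z.2 =ᵐ[volume.restrict Ω] gradient ψ}
  add_mem' := by
    rintro z w ⟨ψ₁, h₁, e₁, g₁⟩ ⟨ψ₂, h₂, e₂, g₂⟩
    refine ⟨_, h₁.add h₂, ?_, ?_⟩
    · exact (Lp.coeFn_add _ _).trans (e₁.add e₂)
    · rw [gradient_add_of_differentiable h₁.differentiable h₂.differentiable]
      exact (Lp.coeFn_add _ _).trans (g₁.add g₂)
  zero_mem' := by
    refine ⟨_, IsTestFunction.zero, Lp.coeFn_zero _ _ _, ?_⟩
    have : gradient (fun _ : 𝔼 => (0 : ℝ)) = fun _ => 0 := by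
      ext1 x
      simp [gradient]
    rw [this]
    exact Lp.coeFn_zero _ _ _
  smul_mem' := by
    rintro a z ⟨ψ, h, e, g⟩
    refine ⟨_, h.const_mul a, ?_, ?_⟩
    · exact (Lp.coeFn_smul _ _).trans (e.const_smul a)
    · rw [gradient_const_mul_of_differentiable h.differentiable]
      exact (Lp.coeFn_smul _ _).trans (g.const_smul a)

variable (Ω) in
/-- The graph of the weak gradient on `H¹₀(Ω)`. -/
def h10Graph : Submodule ℝ (Lp ℝ 2 (volume.restrict Ω) × Lp 𝔼 2 (volume.restrict Ω)) :=
  (testGraph Ω).topologicalClosure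

/-- The approximating sequences of the definition are exactly the sequences witnessing closure in L²
× L². This turns weak gradients into elements of a closed subspace. -/
theorem hasH10Gradient_iff {f : 𝔼 → ℝ} {g : 𝔼 → 𝔼} :
    HasH10Gradient Ω f g ↔
      ∃ z ∈ h10Graph Ω, f =ᵐ[volume.restrict Ω] z.1 ∧ g =ᵐ[volume.restrict Ω] z.2 := by
  constructor
  · rintro ⟨hf, hg, ψ, hψ, h1, h2⟩
    refine ⟨(hf.toLp f, hg.toLp g), ?_, hf.coeFn_toLp.symm, hg.coeFn_toLp.symm⟩
    have hmem : ∀ n, (((hψ n).memLp (volume.restrict Ω)).toLp (ψ n),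
        ((hψ n).memLp_gradient (volume.restrict Ω)).toLp (gradient (ψ n))) ∈ testGraph Ω := fun n =>
      ⟨ψ n, hψ n, MemLp.coeFn_toLp ((hψ n).memLp _), MemLp.coeFn_toLp ((hψ n).memLp_gradient _)⟩
    refine mem_closure_of_tendsto (b := atTop) (Tendsto.prodMk_nhds ?_ ?_) (Eventually.of_forall hmem)
    · rw [tendsto_iff_edist_tendsto_0]
      refine h1.congr fun n => ?_
      rw [edist_comm, Lp.edist_toLp_toLp]; rfl
    · rw [tendsto_iff_edist_tendsto_0]
      refine h2.congr fun n => ?_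
      rw [edist_comm, Lp.edist_toLp_toLp]; rfl
  · rintro ⟨z, hz, hf, hg⟩
    refine ⟨(memLp_congr_ae hf).2 (Lp.memLp _), (memLp_congr_ae hg).2 (Lp.memLp _), ?_⟩
    obtain ⟨w, hw, hlim⟩ := mem_closure_iff_seq_limit.1 hz
    choose ψ hψ h1 h2 using hw
    refine ⟨ψ, hψ, ?_, ?_⟩
    · have := tendsto_iff_edist_tendsto_0.1 ((continuous_fst.tendsto z).comp hlim)
      refine this.congr fun n => ?_
      rw [edist_comm, Lp.edist_def]
      exact eLpNorm_congr_ae (hf.symm.sub (h1 n))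
    · have := tendsto_iff_edist_tendsto_0.1 ((continuous_snd.tendsto z).comp hlim)
      refine this.congr fun n => ?_
      rw [edist_comm, Lp.edist_def]
      exact eLpNorm_congr_ae (hg.symm.sub (h2 n))

theorem FastDiffusion.IsTestFunction.eq_zero {ψ : 𝔼 → ℝ} (h : IsTestFunction Ω ψ) {x : 𝔼}
    (hx : x ∉ Ω) : ψ x = 0 :=
  image_eq_zero_of_notMem_tsupport fun hc => hx (h.2.2 hc)

theorem FastDiffusion.IsTestFunction.gradient_eq_zero {ψ : 𝔼 → ℝ} (h : IsTestFunction Ω ψ) {x : 𝔼}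
    (hx : x ∉ Ω) : gradient ψ x = 0 := by
  have : fderiv ℝ ψ x = 0 := by
    by_contra hc
    exact hx (h.2.2 (support_fderiv_subset ℝ hc))
  simp [gradient, this]

theorem FastDiffusion.IsTestFunction.lintegral_gradient_sq_eq {ψ : 𝔼 → ℝ}
    (h : IsTestFunction Ω ψ) :
    ∫⁻ x in Ω, ‖gradient ψ x‖ₑ ^ 2 = ∫⁻ x, ‖gradient ψ x‖ₑ ^ 2 := by
  refine setLIntegral_eq_of_support_subset fun x hx => ?_
  by_contra hc
  simp [h.gradient_eq_zero hc] at hx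

theorem MeasureTheory.Lp.norm_le_of_lintegral_le {α F G : Type*} [MeasurableSpace α]
    {μ : Measure α} [NormedAddCommGroup F] [NormedAddCommGroup G] {u : Lp F 2 μ} {w : Lp G 2 μ}
    {C : ℝ} (hC : 0 ≤ C)
    (h : ∫⁻ x, ‖u x‖ₑ ^ 2 ∂μ ≤ ENNReal.ofReal C ^ 2 * ∫⁻ x, ‖w x‖ₑ ^ 2 ∂μ) : ‖u‖ ≤ C * ‖w‖ := by
  rw [← eLpNorm_two_sq, ← eLpNorm_two_sq, ← Lp.enorm_def, ← Lp.enorm_def, ← mul_pow,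
    ENNReal.pow_le_pow_left_iff two_ne_zero, ← ofReal_norm, ← ofReal_norm,
    ← ENNReal.ofReal_mul hC] at h
  exact (ENNReal.ofReal_le_ofReal_iff (by positivity)).1 h

/-- Both sides are continuous in z, so an estimate on test functions survives the closure. `P = 0`
gives Poincaré; grid averages give compactness. -/
theorem norm_sub_le_of_mem_h10Graph
    (P : Lp ℝ 2 (volume.restrict Ω) →L[ℝ] Lp ℝ 2 (volume.restrict Ω)) {C : ℝ}
    (h : ∀ z ∈ testGraph Ω, ‖z.1 - P z.1‖ ≤ C * ‖z.2‖) :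
    ∀ z ∈ h10Graph Ω, ‖z.1 - P z.1‖ ≤ C * ‖z.2‖ := by
  have : (testGraph Ω : Set (Lp ℝ 2 (volume.restrict Ω) × Lp 𝔼 2 (volume.restrict Ω))) ⊆
      {z | ‖z.1 - P z.1‖ ≤ C * ‖z.2‖} := h
  exact closure_minimal this (isClosed_le
    (continuous_fst.sub (P.continuous.comp continuous_fst)).norm
    (continuous_const.mul continuous_snd.norm))

/-- Poincaré inequality in `H¹₀(Ω)`. -/
theorem exists_poincare (hN : 1 ≤ N) (hΩ : Bornology.IsBounded Ω) :
    ∃ C : ℝ, 0 < C ∧ ∀ z ∈ h10Graph Ω, ‖z.1‖ ≤ C * ‖z.2‖ := by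
  obtain ⟨R, hR0, hR⟩ := hΩ.exists_pos_norm_le
  -- A shift by 3R exceeds the diameter bound 2R, so it moves Ω off itself; N ≥ 1 provides the
  -- direction.
  set e : 𝔼 := EuclideanSpace.single ⟨0, hN⟩ (3 * R) with he
  have hen : ‖e‖ = 3 * R := by simp [he, abs_of_pos hR0]
  have hsep : ∀ x ∈ Ω, x + e ∉ Ω := fun x hx hxe => by
    have h1 := hR _ hxe
    have h2 := hR _ hx
    have h3 : ‖e‖ ≤ ‖x + e‖ + ‖x‖ := by simpa using norm_sub_le (x + e) x
    linarith
  refine ⟨3 * R, by positivity, fun z hz => ?_⟩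
  have := norm_sub_le_of_mem_h10Graph (Ω := Ω) 0 (C := 3 * R) ?_ z hz
  · simpa using this
  rintro w ⟨ψ, hψ, h1, h2⟩
  simp only [_root_.zero_apply, sub_zero]
  refine Lp.norm_le_of_lintegral_le (by positivity) ?_
  have e1 : ∫⁻ x in Ω, ‖w.1 x‖ₑ ^ 2 = ∫⁻ x in Ω, ‖ψ x‖ₑ ^ 2 :=
    lintegral_congr_ae (h1.mono fun x hx => by simp only [hx])
  have e2 : ∫⁻ x in Ω, ‖w.2 x‖ₑ ^ 2 = ∫⁻ x in Ω, ‖gradient ψ x‖ₑ ^ 2 :=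
    lintegral_congr_ae (h2.mono fun x hx => by simp only [hx])
  rw [e1, e2, hψ.lintegral_gradient_sq_eq]
  refine (setLIntegral_le_lintegral _ _).trans
    ((hψ.1.lintegral_sq_le_of_bounded hsep hψ.2.2).trans_eq ?_)
  rw [← hen, ofReal_norm]

/-- The indicator of a grid cube in `L²(Ω)`. -/
def gridIndicator (Ω : Set 𝔼) {h : ℝ} (hh : 0 < h) (m : Fin N → ℤ) :
    Lp ℝ 2 (volume.restrict Ω) :=
  indicatorConstLp 2 (measurableSet_gridCube h m)
    ((Measure.restrict_apply_le _ _).trans_lt (by rw [volume_gridCube hh]; simp)).ne (1 : ℝ)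

/-- The cubes are disjoint, so at x only the term indexed by the cube containing x survives. -/
theorem coeFn_sum_smul_gridIndicator {h : ℝ} (hh : 0 < h) (M : Finset (Fin N → ℤ))
    (c : (Fin N → ℤ) → ℝ) : ∀ᵐ x ∂volume.restrict Ω, (fun i => ⌊x i / h⌋) ∈ M →
      (∑ m ∈ M, c m • gridIndicator Ω hh m : Lp ℝ 2 (volume.restrict Ω)) x =
        c (fun i => ⌊x i / h⌋) := by
  have e2 : ∀ᵐ x ∂volume.restrict Ω, ∀ m ∈ M,
      (gridIndicator Ω hh m) x = (gridCube h m).indicator (fun _ => 1) x := by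
    rw [eventually_all_finset]
    exact fun m _ => indicatorConstLp_coeFn
  have e3 : ∀ᵐ x ∂volume.restrict Ω, ∀ m ∈ M,
      (c m • gridIndicator Ω hh m : Lp ℝ 2 (volume.restrict Ω)) x =
        c m * (gridIndicator Ω hh m) x := by
    rw [eventually_all_finset]
    exact fun m _ => Lp.coeFn_smul _ _
  filter_upwards [Lp.coeFn_finsetSum M (fun m => c m • gridIndicator Ω hh m), e2, e3]
    with x hx1 hx2 hx3 hm₀M
  rw [hx1, Finset.sum_apply]
  have hm₀ : x ∈ gridCube h (fun i => ⌊x i / h⌋) := fun i => rfl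
  rw [Finset.sum_eq_single_of_mem _ hm₀M]
  · rw [hx3 _ hm₀M, hx2 _ hm₀M, indicator_of_mem hm₀, mul_one]
  · intro m hm hne
    rw [hx3 m hm, hx2 m hm, indicator_of_notMem, mul_zero]
    intro hc
    exact hne (funext fun i => (hc i).symm)

theorem isCompactOperator_smulRight {H : Type*} [NormedAddCommGroup H] [NormedSpace ℝ H]
    (l : H →L[ℝ] ℝ) (x : H) : IsCompactOperator (l.smulRight x) := by
  have h1 : IsCompactOperator (ContinuousLinearMap.toSpanSingleton ℝ x) := by
    rw [isCompactOperator_iff_exists_mem_nhds_image_subset_compact]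
    refine ⟨Metric.closedBall 0 1, Metric.closedBall_mem_nhds 0 one_pos, _,
      (isCompact_closedBall (0 : ℝ) 1).image (ContinuousLinearMap.continuous _), subset_rfl⟩
  exact h1.comp_clm l

/-- Averaging over the cubes of a grid is a compact operator of `L²(Ω)`. -/
theorem exists_gridAverage (hΩm : MeasurableSet Ω) (hΩ : Bornology.IsBounded Ω) {h : ℝ}
    (hh : 0 < h) :
    ∃ P : Lp ℝ 2 (volume.restrict Ω) →L[ℝ] Lp ℝ 2 (volume.restrict Ω), IsCompactOperator P ∧
      ∀ u : Lp ℝ 2 (volume.restrict Ω), P u =ᵐ[volume.restrict Ω] fun x =>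
        (h ^ N)⁻¹ * ∫ y in gridCube h (fun i => ⌊x i / h⌋), u y ∂volume.restrict Ω := by
  set M := (finite_gridCube_inter hh hΩ).toFinset
  refine ⟨∑ m ∈ M, ((h ^ N)⁻¹ : ℝ) •
    (innerSL ℝ (gridIndicator Ω hh m)).smulRight (gridIndicator Ω hh m), ?_, fun u => ?_⟩
  · refine Submodule.sum_mem (compactOperator (RingHom.id ℝ) (Lp ℝ 2 (volume.restrict Ω))
      (Lp ℝ 2 (volume.restrict Ω))) fun m _ => ?_
    exact Submodule.smul_mem _ _ (isCompactOperator_smulRight _ _)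
  · have e1 : (∑ m ∈ M, ((h ^ N)⁻¹ : ℝ) • (innerSL ℝ (gridIndicator Ω hh m)).smulRight
        (gridIndicator Ω hh m)) u = ∑ m ∈ M, ((h ^ N)⁻¹ * ∫ y in gridCube h m, u y
          ∂volume.restrict Ω) • gridIndicator Ω hh m := by
      rw [sum_apply]
      refine Finset.sum_congr rfl fun m _ => ?_
      rw [smul_apply, ContinuousLinearMap.smulRight_apply, innerSL_apply_apply,
        gridIndicator, L2.inner_indicatorConstLp_one, smul_smul]
    rw [e1]
    filter_upwards [coeFn_sum_smul_gridIndicator hh M (fun m => (h ^ N)⁻¹ *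
      ∫ y in gridCube h m, u y ∂volume.restrict Ω), ae_restrict_mem hΩm] with x hx hxΩ
    exact hx ((finite_gridCube_inter hh hΩ).mem_toFinset.2 ⟨x, fun i => rfl, hxΩ⟩)

/-- Finite rank averaging operators approximate the identity of `H¹₀(Ω)` in `L²(Ω)`. -/
theorem exists_compact_approx (hΩm : MeasurableSet Ω) (hΩ : Bornology.IsBounded Ω) {ε : ℝ}
    (hε : 0 < ε) :
    ∃ P : Lp ℝ 2 (volume.restrict Ω) →L[ℝ] Lp ℝ 2 (volume.restrict Ω), IsCompactOperator P ∧
      ∀ z ∈ h10Graph Ω, ‖z.1 - P z.1‖ ≤ ε * ‖z.2‖ := by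
  set v := (volume (Metric.ball (0 : 𝔼) 1)).toReal with hv
  -- The averaging estimate has the factor |B(0, √N h)| / hᴺ · (√N h)², which is this constant times
  -- h².
  obtain ⟨h, hh, hhε⟩ : ∃ h : ℝ, 0 < h ∧ (Real.sqrt N ^ N * v * Real.sqrt N ^ 2) * h ^ 2 ≤ ε ^ 2 := by
    set D := Real.sqrt N ^ N * v * Real.sqrt N ^ 2
    have hD : 0 ≤ D := by positivity
    refine ⟨ε / (D + 1), by positivity, ?_⟩
    rw [div_pow, mul_div_assoc', div_le_iff₀ (by positivity)]
    nlinarith [sq_nonneg ε, mul_nonneg hD (sq_nonneg ε), mul_nonneg (mul_nonneg hD hD) (sq_nonneg ε)]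
  obtain ⟨P, hPc, hPu⟩ := exists_gridAverage hΩm hΩ hh
  refine ⟨P, hPc, norm_sub_le_of_mem_h10Graph P ?_⟩
  rintro ⟨u, w⟩ ⟨ψ, hψ, h1, h2⟩
  simp only at h1 h2 ⊢
  have hP : P u =ᵐ[volume.restrict Ω] fun x =>
      (h ^ N)⁻¹ * ∫ y in gridCube h (fun i => ⌊x i / h⌋), ψ y := by
    -- Cubes may cross the boundary of Ω; since ψ vanishes outside Ω, integrating over the whole
    -- cube changes nothing.
    have e0 : ∀ m, ∫ y in gridCube h m, u y ∂volume.restrict Ω = ∫ y in gridCube h m, ψ y := by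
      intro m
      rw [setIntegral_congr_ae (g := ψ) (measurableSet_gridCube h m)
        (h1.mono fun x hx _ => hx), Measure.restrict_restrict (measurableSet_gridCube h m)]
      exact (setIntegral_eq_of_subset_of_forall_sdiff_eq_zero (measurableSet_gridCube h m)
        inter_subset_left fun x hx => hψ.eq_zero fun hc => hx.2 ⟨hx.1, hc⟩).symm
    filter_upwards [hPu u] with x hx
    rw [hx, e0]
  refine Lp.norm_le_of_lintegral_le hε.le ?_
  have e1 : ∫⁻ x in Ω, ‖(u - P u : Lp ℝ 2 (volume.restrict Ω)) x‖ₑ ^ 2 =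
      ∫⁻ x in Ω, ‖ψ x - (h ^ N)⁻¹ * ∫ y in gridCube h (fun i => ⌊x i / h⌋), ψ y‖ₑ ^ 2 := by
    refine lintegral_congr_ae ?_
    filter_upwards [h1, hP, Lp.coeFn_sub u (P u)] with x hx1 hx2 hx3
    rw [hx3, Pi.sub_apply, hx1, hx2]
  have e2 : ∫⁻ x in Ω, ‖w x‖ₑ ^ 2 = ∫⁻ x in Ω, ‖gradient ψ x‖ₑ ^ 2 :=
    lintegral_congr_ae (h2.mono fun x hx => by simp only [hx])
  rw [e1, e2, hψ.lintegral_gradient_sq_eq]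
  refine (setLIntegral_le_lintegral _ _).trans
    ((hψ.1.lintegral_sub_average_le (r := Real.sqrt N * h) (fun x => measurableSet_gridCube h _)
      (fun x y hy => norm_sub_le_of_mem_gridCube hh (fun i => rfl) hy) (pow_pos hh N)
      (fun x => volume_gridCube hh _)).trans ?_)
  refine mul_le_mul ?_ le_rfl zero_le zero_le
  rw [Measure.addHaar_closedBall _ _ (by positivity), finrank_euclideanSpace_fin,
    ← ENNReal.ofReal_toReal (measure_ball_lt_top (μ := volume) (x := (0:𝔼)) (r := 1)).ne, ← hv,
    ← ENNReal.ofReal_inv_of_pos (by positivity), ← ENNReal.ofReal_mul (by positivity),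
    ← ENNReal.ofReal_mul (by positivity), ← ENNReal.ofReal_pow (by positivity),
    ← ENNReal.ofReal_mul (by positivity), ← ENNReal.ofReal_pow hε.le]
  refine ENNReal.ofReal_le_ofReal (le_trans (le_of_eq ?_) hhε)
  rw [mul_pow, mul_pow]
  field_simp

/-- A closed graph over its second projection, when the first component is controlled by the
second, is the graph of a bounded operator defined on a closed subspace. -/
theorem exists_operator_of_graph {A B : Type*} [NormedAddCommGroup A] [NormedSpace ℝ A]
    [CompleteSpace A] [NormedAddCommGroup B] [NormedSpace ℝ B] [CompleteSpace B]
    (G : Submodule ℝ (A × B)) (hG : IsClosed (G : Set (A × B))) {C : ℝ}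
    (hC : ∀ z ∈ G, ‖z.1‖ ≤ C * ‖z.2‖) :
    ∃ (X : Submodule ℝ B) (J : X →L[ℝ] A), IsClosed (X : Set B) ∧
      ∀ z : A × B, z ∈ G ↔ ∃ x : X, z = (J x, x.1) := by
  set S : G →L[ℝ] B := (ContinuousLinearMap.snd ℝ A B).comp G.subtypeL
  have : CompleteSpace G := hG.completeSpace_coe
  -- The second projection is bounded below on the graph, hence injective with closed range; `J` is
  -- its inverse followed by the first projection.
  have hS : ∀ z : G, ‖z‖ ≤ (max C 1) * ‖S z‖ := fun z => by
    have h1 := hC z z.2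
    have h2 : ‖z‖ = max ‖z.1.1‖ ‖z.1.2‖ := rfl
    rw [h2]
    refine max_le (h1.trans ?_) ?_
    · exact mul_le_mul_of_nonneg_right (le_max_left _ _) (norm_nonneg _)
    · exact le_mul_of_one_le_left (norm_nonneg _) (le_max_right _ _)
  have hanti : AntilipschitzWith (max C 1).toNNReal S :=
    ContinuousLinearMap.antilipschitz_of_bound S fun z => by
      rw [Real.coe_toNNReal _ (by positivity)]; exact hS z
  have hcl := hanti.isClosed_range S.uniformContinuous
  set e := LinearEquiv.ofInjective (S : G →ₗ[ℝ] B) hanti.injective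
  have he : ∀ z, (e z : B) = z.1.2 := fun z => rfl
  have hes : ∀ x, (e.symm x).1.2 = (x : B) := fun x => by
    rw [← he, e.apply_symm_apply]
  refine ⟨LinearMap.range (S : G →ₗ[ℝ] B),
    LinearMap.mkContinuous ((LinearMap.fst ℝ A B).comp (G.subtype.comp e.symm.toLinearMap)) C
      (fun x => by
        have := hC _ (e.symm x).2
        rw [hes] at this
        exact this), hcl, fun z => ⟨fun hz => ⟨e ⟨z, hz⟩, ?_⟩, ?_⟩⟩
  · refine Prod.ext ?_ rfl
    change z.1 = (e.symm (e ⟨z, hz⟩)).1.1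
    rw [e.symm_apply_apply]
  · rintro ⟨x, rfl⟩
    have : (((LinearMap.fst ℝ A B).comp (G.subtype.comp e.symm.toLinearMap)) x, (x : B)) =
        ((e.symm x : G) : A × B) := Prod.ext rfl (hes x).symm
    change (((LinearMap.fst ℝ A B).comp (G.subtype.comp e.symm.toLinearMap)) x, (x : B)) ∈ G
    rw [this]
    exact (e.symm x).2

/-- `H¹₀(Ω)` as a Hilbert space of weak gradients, compactly embedded in `L²(Ω)`. -/
theorem exists_h10_space (hN : 1 ≤ N) (hΩm : MeasurableSet Ω) (hΩ : Bornology.IsBounded Ω) :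
    ∃ (X : Submodule ℝ (Lp 𝔼 2 (volume.restrict Ω))) (J : X →L[ℝ] Lp ℝ 2 (volume.restrict Ω)),
      IsClosed (X : Set (Lp 𝔼 2 (volume.restrict Ω))) ∧ IsCompactOperator J ∧
      ∀ (f : 𝔼 → ℝ) (g : 𝔼 → 𝔼), HasH10Gradient Ω f g ↔
        ∃ x : X, f =ᵐ[volume.restrict Ω] J x ∧ g =ᵐ[volume.restrict Ω] x.1 := by
  obtain ⟨C, hC0, hC⟩ := exists_poincare hN hΩ
  obtain ⟨X, J, hX, hJ⟩ := exists_operator_of_graph (h10Graph Ω)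
    (Submodule.isClosed_topologicalClosure (testGraph Ω)) hC
  refine ⟨X, J, hX, ?_, fun f g => ?_⟩
  -- `J` is the operator-norm limit of the compact operators `P n ∘ J`, because `X` carries the norm
  -- of the gradient.
  · choose P hPc hP using
      fun n : ℕ => exists_compact_approx hΩm hΩ (ε := 1 / ((n : ℝ) + 1)) (by positivity)
    refine isCompactOperator_of_tendsto (F := fun n => (P n).comp J) (l := atTop) ?_
      (Eventually.of_forall fun n => (hPc n).comp_clm J)
    rw [tendsto_iff_norm_sub_tendsto_zero]
    refine squeeze_zero (fun _ => norm_nonneg _) (fun n => ?_)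
      tendsto_one_div_add_atTop_nhds_zero_nat
    refine ContinuousLinearMap.opNorm_le_bound _ (by positivity) fun x => ?_
    have := hP n _ ((hJ _).2 ⟨x, rfl⟩)
    rw [norm_sub_rev] at this
    exact this
  · rw [hasH10Gradient_iff]
    constructor
    · rintro ⟨z, hz, h1, h2⟩
      obtain ⟨x, rfl⟩ := (hJ z).1 hz
      exact ⟨x, h1, h2⟩
    · rintro ⟨x, h1, h2⟩
      exact ⟨_, (hJ _).2 ⟨x, rfl⟩, h1, h2⟩

end SobolevSpace

/-! ### Spectral gap for the weighted Dirichlet Laplacian. -/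

section Gap

variable {N : ℕ} {Ω : Set (EuclideanSpace ℝ (Fin N))}

local notation "𝔼" => EuclideanSpace ℝ (Fin N)

/-- Multiplication by a bounded function as an operator of `L²`. -/
theorem exists_mulOperator {α : Type*} [MeasurableSpace α] {μ : Measure α} {W : α → ℝ}
    (hWm : AEStronglyMeasurable W μ) {M : ℝ} (hW : ∀ᵐ x ∂μ, ‖W x‖ ≤ M) :
    ∃ T : Lp ℝ 2 μ →L[ℝ] Lp ℝ 2 μ, ∀ u : Lp ℝ 2 μ, T u =ᵐ[μ] fun x => W x * u x := by
  have hWi : MemLp W ∞ μ := memLp_top_of_bound hWm M hW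
  have hmem : ∀ u : Lp ℝ 2 μ, MemLp (fun x => W x * u x) 2 μ := fun u =>
    (Lp.memLp u).mul hWi
  set T₀ : Lp ℝ 2 μ →ₗ[ℝ] Lp ℝ 2 μ :=
    { toFun := fun u => (hmem u).toLp _
      map_add' := fun u w => by
        rw [← MemLp.toLp_add, MemLp.toLp_eq_toLp_iff]
        filter_upwards [Lp.coeFn_add u w] with x hx
        simp only [hx, Pi.add_apply, mul_add]
      map_smul' := fun a u => by
        rw [RingHom.id_apply, ← MemLp.toLp_const_smul, MemLp.toLp_eq_toLp_iff]
        filter_upwards [Lp.coeFn_smul a u] with x hx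
        simp only [hx, Pi.smul_apply, smul_eq_mul]; ring }
  refine ⟨T₀.mkContinuous M fun u => ?_, fun u => (hmem u).coeFn_toLp⟩
  refine Lp.norm_le_mul_norm_of_ae_le_mul ?_
  filter_upwards [hW, (hmem u).coeFn_toLp] with x hx hx2
  change ‖((hmem u).toLp _ : Lp ℝ 2 μ) x‖ ≤ _
  rw [hx2, norm_mul]
  gcongr

theorem FastDiffusion.IsTestFunction.hasH10Gradient {ψ : 𝔼 → ℝ} (h : IsTestFunction Ω ψ) :
    HasH10Gradient Ω ψ (gradient ψ) :=
  ⟨h.memLp _, h.memLp_gradient _, fun _ => ψ, fun _ => h, by simp, by simp⟩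

/-- Spectral gap for a compact nonnegative quadratic form relative to the inner product. -/
theorem exists_form_gap {X H : Type*} [NormedAddCommGroup X] [InnerProductSpace ℝ X]
    [CompleteSpace X] [NormedAddCommGroup H] [InnerProductSpace ℝ H] [CompleteSpace H]
    {J : X →L[ℝ] H} (hJ : IsCompactOperator J) {T : H →L[ℝ] H}
    (hTs : ∀ u w, inner ℝ (T u) w = inner ℝ (T w) u) (hT0 : ∀ u, 0 ≤ inner ℝ (T u) u) {L : ℝ}
    (hL : 0 < L) (hne : ∀ x, (∀ y, inner ℝ x y = L * inner ℝ (T (J x)) (J y)) → J x = 0) :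
    ∃ (m : ℕ) (e : Fin m → X) (lam : Fin m → ℝ) (Λ C : ℝ), L < Λ ∧ 0 ≤ C ∧
      (∀ i, 0 < lam i ∧ lam i < L ∧ ∀ y, inner ℝ (e i) y = lam i * inner ℝ (T (J (e i))) (J y)) ∧
      ∀ x, Λ * inner ℝ (T (J x)) (J x) ≤
        ‖x‖ ^ 2 + C * ∑ i, inner ℝ (T (J (e i))) (J x) ^ 2 := by
  -- K = J* T J represents the weighted form in the inner product of `X`. Its eigenvalues k > 0 are
  -- the inverses of the Dirichlet eigenvalues, so a gap below L⁻¹ for `K` is a gap above L for the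
  -- Laplacian.
  obtain ⟨K, hKdef⟩ : ∃ K : X →L[ℝ] X, K = (ContinuousLinearMap.adjoint J).comp (T.comp J) :=
    ⟨_, rfl⟩
  have hK : ∀ x y, inner ℝ (K x) y = inner ℝ (T (J x)) (J y) := by
    intro x y
    rw [hKdef, ContinuousLinearMap.comp_apply, ContinuousLinearMap.adjoint_inner_left]
    rfl
  have hKc : IsCompactOperator K := by
    rw [hKdef]
    exact (hJ.clm_comp T).clm_comp (ContinuousLinearMap.adjoint J)
  have hKs : (K : X →ₗ[ℝ] X).IsSymmetric := fun x y => by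
    change inner ℝ (K x) y = inner ℝ x (K y)
    rw [real_inner_comm (K y) x, hK, hK, hTs]
  have hKpos : ∀ x, 0 ≤ inner ℝ (K x) x := fun x => by
    rw [hK]; exact hT0 _
  have hsolve : ∀ x (k : ℝ), 0 < k → K x = k • x →
      ∀ y, inner ℝ x y = k⁻¹ * inner ℝ (T (J x)) (J y) := by
    intro x k hk hx y
    rw [← hK, hx, real_inner_smul_left]
    field_simp
  obtain ⟨m, e, k, q', C, hq'0, hq'q, hC, hek, hgap⟩ := hKc.exists_spectral_gap hKs hKpos
    (q := L⁻¹) (by positivity) (fun x hx => by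
      -- Triviality is only known for J x, but J x = 0 gives K x = 0, and K x = L⁻¹ x then forces x
      -- = 0.
      have h2 := hne x (by simpa using hsolve x L⁻¹ (by positivity) hx)
      have h3 : K x = 0 := by
        rw [hKdef, ContinuousLinearMap.comp_apply, ContinuousLinearMap.comp_apply, h2, map_zero,
          map_zero]
      rw [h3] at hx
      exact (smul_eq_zero.1 hx.symm).resolve_left (by positivity))
  have hk0 : ∀ i, 0 < k i := fun i => (inv_pos.2 hL).trans (hek i).1
  refine ⟨m, e, fun i => (k i)⁻¹, q'⁻¹, C / q', ?_, by positivity, fun i =>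
    ⟨inv_pos.2 (hk0 i), ?_, hsolve _ _ (hk0 i) (hek i).2⟩, fun x => ?_⟩
  · rwa [lt_inv_comm₀ hL hq'0]
  · rw [inv_lt_comm₀ (hk0 i) hL]; exact (hek i).1
  · have h := hgap x
    simp only [hK] at h
    calc q'⁻¹ * inner ℝ (T (J x)) (J x) ≤ q'⁻¹ * (q' * ‖x‖ ^ 2 +
          C * ∑ i, inner ℝ (T (J (e i))) (J x) ^ 2) := by gcongr
      _ = _ := by field_simp

/-- If `L` is not a Dirichlet eigenvalue of `-Δ` with bounded weight `W ≥ 0`, then the eigenvalues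
below `L` are separated from the rest of the spectrum by a gap. -/
theorem exists_dirichlet_gap (hN : 1 ≤ N) (hΩm : MeasurableSet Ω) (hΩ : Bornology.IsBounded Ω)
    {W : 𝔼 → ℝ} (hWm : AEStronglyMeasurable W (volume.restrict Ω))
    (hW0 : ∀ᵐ x ∂volume.restrict Ω, 0 ≤ W x) {M : ℝ}
    (hWM : ∀ᵐ x ∂volume.restrict Ω, W x ≤ M) {L : ℝ} (hL : 0 < L)
    (hne : ∀ φ, SolvesDirichlet Ω (fun x => L * W x * φ x) φ →
      ∀ᵐ x ∂volume.restrict Ω, φ x = 0) :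
    ∃ (m : ℕ) (χ : Fin m → 𝔼 → ℝ) (lam : Fin m → ℝ) (Λ C : ℝ), L < Λ ∧ 0 ≤ C ∧
      (∀ i, 0 < lam i ∧ lam i < L ∧ SolvesDirichlet Ω (fun x => lam i * W x * χ i x) (χ i)) ∧
      ∀ f g, HasH10Gradient Ω f g → Λ * ∫ x in Ω, W x * f x ^ 2 ≤
        (∫ x in Ω, ‖g x‖ ^ 2) + C * ∑ i, (∫ x in Ω, W x * χ i x * f x) ^ 2 := by
  obtain ⟨X, J, hX, hJc, hJ⟩ := exists_h10_space hN hΩm hΩ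
  have : CompleteSpace X := hX.completeSpace_coe
  obtain ⟨T, hT⟩ := exists_mulOperator hWm (M := M) (by
    filter_upwards [hW0, hWM] with x h1 h2
    rwa [Real.norm_of_nonneg h1])
  have hTi : ∀ u w, inner ℝ (T u) w = ∫ a in Ω, W a * u a * w a := by
    intro u w
    rw [L2.inner_def]
    refine integral_congr_ae ?_
    filter_upwards [hT u] with a ha
    rw [ha]
    simp only [RCLike.inner_apply, RCLike.conj_to_real]
    ring
  have hX2 : ∀ x y : X, inner ℝ x y = ∫ a in Ω, inner ℝ (x.1 a) (y.1 a) := fun x y => by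
    rw [Submodule.coe_inner, L2.inner_def]
  have hsolve : ∀ x (k : ℝ), (∀ y, inner ℝ x y = k * inner ℝ (T (J x)) (J y)) →
      SolvesDirichlet Ω (fun a => k * W a * J x a) (J x) := by
    intro x k hx
    refine ⟨x.1, (hJ _ _).2 ⟨x, EventuallyEq.rfl, EventuallyEq.rfl⟩, fun ψ hψ => ?_⟩
    obtain ⟨y, hy1, hy2⟩ := (hJ _ _).1 hψ.hasH10Gradient
    have h1 : ∫ a in Ω, inner ℝ (x.1 a) (gradient ψ a) = inner ℝ x y := by
      rw [hX2]
      exact integral_congr_ae (hy2.mono fun a ha => by simp only [ha])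
    have h2 : ∫ a in Ω, k * W a * J x a * ψ a = k * inner ℝ (T (J x)) (J y) := by
      rw [hTi, ← integral_const_mul]
      exact integral_congr_ae (hy1.mono fun a ha => by simp only [ha]; ring)
    rw [h1, h2, hx]
  obtain ⟨m, e, lam, Λ, C, hΛ, hC, he, hgap⟩ := exists_form_gap hJc (T := T)
    (fun u w => by
      rw [hTi, hTi]
      exact integral_congr_ae (Eventually.of_forall fun a => by ring))
    (fun u => by
      rw [hTi]
      refine integral_nonneg_of_ae ?_
      filter_upwards [hW0] with a ha
      rw [mul_assoc]
      exact mul_nonneg ha (mul_self_nonneg _))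
    hL (fun x hx => Lp.ext (EventuallyEq.trans (hne _ (hsolve x L hx)) (Lp.coeFn_zero _ _ _).symm))
  refine ⟨m, fun i => J (e i), lam, Λ, C, hΛ, hC, fun i =>
    ⟨(he i).1, (he i).2.1, hsolve _ _ (he i).2.2⟩, fun f g hfg => ?_⟩
  obtain ⟨x, hx1, hx2⟩ := (hJ _ _).1 hfg
  have h := hgap x
  have h1 : ∫ a in Ω, W a * f a ^ 2 = inner ℝ (T (J x)) (J x) := by
    rw [hTi]
    exact integral_congr_ae (hx1.mono fun a ha => by simp only [ha]; ring)
  have h2 : ∫ a in Ω, ‖g a‖ ^ 2 = ‖x‖ ^ 2 := by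
    rw [← real_inner_self_eq_norm_sq, hX2]
    exact integral_congr_ae (hx2.mono fun a ha => by
      simp only [ha, real_inner_self_eq_norm_sq])
  have h3 : ∀ i, ∫ a in Ω, W a * J (e i) a * f a = inner ℝ (T (J (e i))) (J x) := fun i => by
    rw [hTi]
    exact integral_congr_ae (hx1.mono fun a ha => by simp only [ha])
  simp only [h1, h2, h3]
  exact h

end Gap

/-! ### Pointwise comparison of powers, entropy density and linearization. -/

section Pointwise

/-- The derivative has the sign of x - 1, so `h` has its minimum over the interval at 1, where it is
0. -/
theorem nonneg_of_deriv_mul_nonneg {h h' : ℝ → ℝ} (h1 : h 1 = 0)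
    (hd : ∀ x, 0 < x → HasDerivAt h (h' x) x)
    (hs : ∀ x ∈ Icc (1/2 : ℝ) (3/2), 0 ≤ h' x * (x - 1)) {x : ℝ} (hx : x ∈ Icc (1/2 : ℝ) (3/2)) :
    0 ≤ h x := by
  obtain ⟨hx1, hx2⟩ := hx
  rcases lt_trichotomy x 1 with hlt | rfl | hlt
  · obtain ⟨ξ, hξ, he⟩ := exists_hasDerivAt_eq_slope h h' hlt
      (fun y hy => (hd y (by linarith [hy.1])).continuousAt.continuousWithinAt)
      (fun y hy => hd y (by linarith [hy.1]))
    have := hs ξ ⟨by linarith [hξ.1], by linarith [hξ.2]⟩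
    have hneg : h' ξ ≤ 0 := by
      by_contra hc
      nlinarith [hξ.2]
    rw [he, h1, div_le_iff₀ (by linarith)] at hneg
    linarith
  · exact h1.ge
  · obtain ⟨ξ, hξ, he⟩ := exists_hasDerivAt_eq_slope h h' hlt
      (fun y hy => (hd y (by linarith [hy.1])).continuousAt.continuousWithinAt)
      (fun y hy => hd y (by linarith [hy.1]))
    have := hs ξ ⟨by linarith [hξ.1], by linarith [hξ.2]⟩
    have hpos : 0 ≤ h' ξ := by
      by_contra hc
      nlinarith [hξ.1]
    rw [he, h1, le_div_iff₀ (by linarith)] at hpos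
    linarith

theorem exists_rpow_bounds (a : ℝ) : ∃ b B : ℝ, 0 < b ∧ 0 < B ∧
    ∀ x ∈ Icc (1/2 : ℝ) (3/2), b ≤ x ^ a ∧ x ^ a ≤ B := by
  have hc : ContinuousOn (fun x : ℝ => x ^ a) (Icc (1/2) (3/2)) := fun x hx =>
    (Real.continuousAt_rpow_const x a (Or.inl (by linarith [hx.1]))).continuousWithinAt
  obtain ⟨y, hy, hmin⟩ := isCompact_Icc.exists_isMinOn ⟨1, by norm_num⟩ hc
  obtain ⟨z, hz, hmax⟩ := isCompact_Icc.exists_isMaxOn ⟨1, by norm_num⟩ hc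
  exact ⟨y ^ a, z ^ a, Real.rpow_pos_of_pos (by linarith [hy.1]) _,
    Real.rpow_pos_of_pos (by linarith [hz.1]) _, fun x hx => ⟨hmin hx, hmax hx⟩⟩

theorem exists_abs_rpow_sub_rpow_bounds (a : ℝ) : ∃ b B : ℝ, 0 < b ∧ 0 < B ∧
    ∀ x ∈ Icc (1/2 : ℝ) (3/2), ∀ y ∈ Icc (1/2 : ℝ) (3/2),
      |a| * b * |x - y| ≤ |x ^ a - y ^ a| ∧ |x ^ a - y ^ a| ≤ |a| * B * |x - y| := by
  obtain ⟨b, B, hb, hB, hbB⟩ := exists_rpow_bounds (a - 1)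
  refine ⟨b, B, hb, hB, ?_⟩
  have key : ∀ x ∈ Icc (1/2 : ℝ) (3/2), ∀ y ∈ Icc (1/2 : ℝ) (3/2), x < y →
      |a| * b * |y - x| ≤ |y ^ a - x ^ a| ∧ |y ^ a - x ^ a| ≤ |a| * B * |y - x| := by
    intro x hx y hy hxy
    obtain ⟨ξ, hξ, he⟩ := exists_hasDerivAt_eq_slope (fun x : ℝ => x ^ a)
      (fun x => a * x ^ (a - 1)) hxy
      (fun z hz => (Real.continuousAt_rpow_const z a
        (Or.inl (by linarith [hz.1, hx.1]))).continuousWithinAt)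
      (fun z hz => Real.hasDerivAt_rpow_const (Or.inl (by linarith [hz.1, hx.1])))
    have hξ' : ξ ∈ Icc (1/2 : ℝ) (3/2) := ⟨by linarith [hξ.1, hx.1], by linarith [hξ.2, hy.2]⟩
    obtain ⟨h1, h2⟩ := hbB ξ hξ'
    rw [eq_div_iff (by linarith)] at he
    rw [← he, abs_mul, abs_mul, abs_of_pos (hb.trans_le h1)]
    constructor <;> gcongr
  intro x hx y hy
  rcases lt_trichotomy x y with h | rfl | h
  · rw [abs_sub_comm x y, abs_sub_comm (x ^ a)]; exact key x hx y hy h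
  · simp
  · exact key y hy x hx h

/-- Elementary inequalities for powers near `1`. -/
theorem exists_power_constants {p : ℝ} (hp : 1 < p) : ∃ C : ℝ, 1 ≤ C ∧
    ∀ x ∈ Icc (1/2 : ℝ) (3/2), ∀ y ∈ Icc (1/2 : ℝ) (3/2),
      |x ^ p - 1 - p * (x - 1)| ≤ C * (x - 1) ^ 2 ∧
      (x - 1) ^ 2 ≤ C * (x ^ (p + 1) - 1 - (p + 1) / p * (x ^ p - 1)) ∧
      x ^ (p + 1) - 1 - (p + 1) / p * (x ^ p - 1) ≤ C * (x - 1) ^ 2 ∧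
      |x ^ p - 1| ≤ C * |x - 1| ∧
      |x - y| ≤ C * |x ^ p - y ^ p| ∧
      |(x ^ (p + 1) - (p + 1) / p * x ^ p) - (y ^ (p + 1) - (p + 1) / p * y ^ p)| ≤
        C * |x ^ p - y ^ p| := by
  obtain ⟨b, B, hb, hB, hbB⟩ := exists_rpow_bounds (p - 1)
  obtain ⟨b0, B0, hb0, hB0, h0⟩ := exists_abs_rpow_sub_rpow_bounds (p - 1)
  obtain ⟨b1, B1, hb1, hB1, h1⟩ := exists_abs_rpow_sub_rpow_bounds p
  obtain ⟨b2, B2, hb2, hB2, h2⟩ := exists_abs_rpow_sub_rpow_bounds (p + 1)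
  have hp0 : 0 < p := by linarith
  have one : (1 : ℝ) ∈ Icc (1/2 : ℝ) (3/2) := by norm_num
  rw [abs_of_pos (by linarith)] at h0 h1 h2
  -- `D1` to `D6` serve the six estimates in turn; the final constant is 1 plus their sum, so it
  -- dominates each.
  set D1 := p * ((p - 1) * B0) / 2
  set D2 := 2 / ((p + 1) * b)
  set D3 := (p + 1) * B / 2
  set D4 := p * B1
  set D5 := 1 / (p * b1)
  set D6 := (p + 1) * B2 * D5 + (p + 1) / p
  have e1 : 0 ≤ D1 := by have : 0 < p - 1 := by linarith
                         positivity
  have e2 : 0 ≤ D2 := by positivity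
  have e3 : 0 ≤ D3 := by positivity
  have e4 : 0 ≤ D4 := by positivity
  have e5 : 0 ≤ D5 := by positivity
  have e6 : 0 ≤ D6 := by positivity
  have hder : ∀ a x : ℝ, 0 < x → HasDerivAt (fun x : ℝ => x ^ a) (a * x ^ (a - 1)) x :=
    fun a x hx => Real.hasDerivAt_rpow_const (Or.inl hx.ne')
  have hsq : ∀ x : ℝ, HasDerivAt (fun x : ℝ => (x - 1) ^ 2) (2 * (x - 1)) x := fun x => by
    exact (((hasDerivAt_id x).sub_const 1).pow 2).congr_deriv (by simp)
  have hlin : ∀ x : ℝ, HasDerivAt (fun x : ℝ => p * (x - 1)) p x := fun x => by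
    simpa using ((hasDerivAt_id x).sub_const 1).const_mul p
  refine ⟨1 + D1 + D2 + D3 + D4 + D5 + D6, by linarith, fun x hx y hy => ?_⟩
  have hx0 : 0 < x := by linarith [hx.1]
  -- The derivative of the normalized entropy density factors through x - 1 with a positive
  -- coefficient bounded above and below, which makes the density comparable to (x - 1)².
  have hψ' : ∀ x : ℝ, 0 < x → HasDerivAt
      (fun x : ℝ => x ^ (p + 1) - 1 - (p + 1) / p * (x ^ p - 1))
      ((p + 1) * x ^ (p - 1) * (x - 1)) x := fun x hx => by
    have := ((hder (p + 1) x hx).sub_const 1).sub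
      (((hder p x hx).sub_const 1).const_mul ((p + 1) / p))
    refine this.congr_deriv ?_
    rw [show p + 1 - 1 = (p - 1) + 1 by ring, Real.rpow_add_one hx.ne']
    field_simp
  have f5 : |x - y| ≤ D5 * |x ^ p - y ^ p| := by
    have := (h1 x hx y hy).1
    rw [div_mul_eq_mul_div, one_mul, le_div_iff₀ (by positivity)]
    linarith
  have up : ∀ {D u v : ℝ}, 0 ≤ u → D ≤ 1 + D1 + D2 + D3 + D4 + D5 + D6 → v ≤ D * u →
      v ≤ (1 + D1 + D2 + D3 + D4 + D5 + D6) * u := fun hu hD h =>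
    h.trans (mul_le_mul_of_nonneg_right hD hu)
  refine ⟨up (sq_nonneg _) (D := D1) (by linarith) ?_, ?_, up (sq_nonneg _) (D := D3) (by linarith) ?_,
    up (abs_nonneg _) (D := D4) (by linarith) ?_, up (abs_nonneg _) (D := D5) (by linarith) f5,
    up (abs_nonneg _) (D := D6) (by linarith) ?_⟩
  · have hbd : ∀ z ∈ Icc (1/2 : ℝ) (3/2), |z ^ (p - 1) - 1| ≤ (p - 1) * B0 * |z - 1| := fun z hz => by
      simpa using (h0 z hz 1 one).2
    rw [abs_le]
    constructor
    · have := nonneg_of_deriv_mul_nonneg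
        (h := fun x => D1 * (x - 1) ^ 2 + (x ^ p - 1 - p * (x - 1)))
        (h' := fun x => D1 * (2 * (x - 1)) + (p * x ^ (p - 1) - p)) (by simp)
        (fun z hz => ((hsq z).const_mul D1).add (((hder p z hz).sub_const 1).sub (hlin z)))
        (fun z hz => by
          have h := hbd z hz
          have h3 : |(z ^ (p - 1) - 1) * (z - 1)| ≤ (p - 1) * B0 * (z - 1) ^ 2 := by
            rw [abs_mul, ← sq_abs (z - 1), sq, ← mul_assoc]; gcongr
          have h4 := (abs_le.1 h3).1
          have : D1 * (2 * (z - 1)) * (z - 1) = p * ((p - 1) * B0 * (z - 1) ^ 2) := by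
            simp only [D1]; ring
          have h5 := mul_le_mul_of_nonneg_left h4 hp0.le
          linarith [this, h5]) hx
      linarith
    · have := nonneg_of_deriv_mul_nonneg
        (h := fun x => D1 * (x - 1) ^ 2 - (x ^ p - 1 - p * (x - 1)))
        (h' := fun x => D1 * (2 * (x - 1)) - (p * x ^ (p - 1) - p)) (by simp)
        (fun z hz => ((hsq z).const_mul D1).sub (((hder p z hz).sub_const 1).sub (hlin z)))
        (fun z hz => by
          have h := hbd z hz
          have h3 : |(z ^ (p - 1) - 1) * (z - 1)| ≤ (p - 1) * B0 * (z - 1) ^ 2 := by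
            rw [abs_mul, ← sq_abs (z - 1), sq, ← mul_assoc]; gcongr
          have h4 := (abs_le.1 h3).2
          have : D1 * (2 * (z - 1)) * (z - 1) = p * ((p - 1) * B0 * (z - 1) ^ 2) := by
            simp only [D1]; ring
          have h5 := mul_le_mul_of_nonneg_left h4 hp0.le
          linarith [this, h5]) hx
      linarith
  · have h := nonneg_of_deriv_mul_nonneg
      (h := fun x => D2 * (x ^ (p + 1) - 1 - (p + 1) / p * (x ^ p - 1)) - (x - 1) ^ 2)
      (h' := fun x => D2 * ((p + 1) * x ^ (p - 1) * (x - 1)) - 2 * (x - 1)) (by simp)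
      (fun z hz => ((hψ' z hz).const_mul D2).sub (hsq z))
      (fun z hz => by
        have h := (hbB z hz).1
        have h3 : 2 ≤ D2 * ((p + 1) * z ^ (p - 1)) := by
          simp only [D2]
          rw [div_mul_eq_mul_div, le_div_iff₀ (by positivity)]
          gcongr
        nlinarith [mul_nonneg (sub_nonneg.2 h3) (sq_nonneg (z - 1))]) hx
    have hψ0 : 0 ≤ x ^ (p + 1) - 1 - (p + 1) / p * (x ^ p - 1) := by
      have hD2 : 0 < D2 := by positivity
      by_contra hc
      push Not at hc
      nlinarith [sq_nonneg (x - 1)]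
    exact up hψ0 (D := D2) (by linarith) (by simpa using h)
  · have h := nonneg_of_deriv_mul_nonneg
      (h := fun x => D3 * (x - 1) ^ 2 - (x ^ (p + 1) - 1 - (p + 1) / p * (x ^ p - 1)))
      (h' := fun x => D3 * (2 * (x - 1)) - ((p + 1) * x ^ (p - 1) * (x - 1))) (by simp)
      (fun z hz => ((hsq z).const_mul D3).sub (hψ' z hz))
      (fun z hz => by
        have h := (hbB z hz).2
        have h3 : (p + 1) * z ^ (p - 1) ≤ 2 * D3 := by
          simp only [D3]
          have : (p + 1) * z ^ (p - 1) ≤ (p + 1) * B := by gcongr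
          linarith
        nlinarith [mul_nonneg (sub_nonneg.2 h3) (sq_nonneg (z - 1))]) hx
    simpa using h
  · simpa using (h1 x hx 1 one).2
  · have g1 := (h2 x hx y hy).2
    have g2 : (p + 1) * B2 * |x - y| ≤ (p + 1) * B2 * (D5 * |x ^ p - y ^ p|) := by gcongr
    have g3 : (x ^ (p + 1) - (p + 1) / p * x ^ p) - (y ^ (p + 1) - (p + 1) / p * y ^ p) =
      (x ^ (p + 1) - y ^ (p + 1)) - (p + 1) / p * (x ^ p - y ^ p) := by ring
    rw [g3]
    refine (abs_sub _ _).trans ?_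
    rw [abs_mul, abs_of_pos (show 0 < (p + 1) / p by positivity)]
    simp only [D6]
    linarith

/-- `C` is a constant for which the elementary comparison estimates between `v` and `V` hold in the
range `|v - V| ≤ V / 2`. -/
def IsComparisonConstant (p C : ℝ) : Prop := 1 ≤ C ∧
    ∀ V v v' : ℝ, 0 < V → |v - V| ≤ V / 2 → |v' - V| ≤ V / 2 →
      (∀ ε, |v - V| ≤ ε * V →
        |v ^ p - V ^ p - p * V ^ (p - 1) * (v - V)| ≤ C * ε * (V ^ (p - 1) * |v - V|)) ∧
      V ^ (p - 1) * (v - V) ^ 2 ≤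
        C * ((v ^ (p + 1) - V ^ (p + 1)) - (p + 1) / p * (v ^ p - V ^ p) * V) ∧
      (v ^ (p + 1) - V ^ (p + 1)) - (p + 1) / p * (v ^ p - V ^ p) * V ≤
        C * (V ^ (p - 1) * (v - V) ^ 2) ∧
      |v ^ p - V ^ p| ≤ C * (V ^ (p - 1) * |v - V|) ∧
      V ^ (p - 1) * |v - v'| ≤ C * |v ^ p - v' ^ p| ∧
      |((v ^ (p + 1) - V ^ (p + 1)) - (p + 1) / p * (v ^ p - V ^ p) * V) -
        ((v' ^ (p + 1) - V ^ (p + 1)) - (p + 1) / p * (v' ^ p - V ^ p) * V)| ≤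
        C * V * |v ^ p - v' ^ p|

/-- Pointwise comparison of the entropy density, the nonlinearity and its linearization. -/
theorem exists_isComparisonConstant {p : ℝ} (hp : 1 < p) : ∃ C : ℝ, IsComparisonConstant p C := by
  unfold IsComparisonConstant
  obtain ⟨C, hC1, hC⟩ := exists_power_constants hp
  refine ⟨C, hC1, fun V v v' hV hv hv' => ?_⟩
  have hC0 : 0 ≤ C := by linarith
  -- By homogeneity, v = V x and v' = V y reduce every estimate to the case V = 1 with x and y in
  -- [1/2, 3/2].
  obtain ⟨x, rfl⟩ : ∃ x, v = V * x := ⟨v / V, by field_simp⟩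
  obtain ⟨y, rfl⟩ : ∃ y, v' = V * y := ⟨v' / V, by field_simp⟩
  have hxy : ∀ x, |V * x - V| ≤ V / 2 → x ∈ Icc (1/2 : ℝ) (3/2) := fun x hx => by
    rw [show V * x - V = V * (x - 1) by ring, abs_mul, abs_of_pos hV,
      show V / 2 = V * (1 / 2) by ring, mul_le_mul_iff_right₀ hV, abs_le] at hx
    constructor <;> linarith [hx.1, hx.2]
  have hx := hxy x hv
  have hy := hxy y hv'
  obtain ⟨f1, f2, f3, f4, f5, f6⟩ := hC x hx y hy
  have hx0 : 0 ≤ x := by linarith [hx.1]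
  have hy0 : 0 ≤ y := by linarith [hy.1]
  set q := V ^ (p - 1) with hq
  have hq0 : 0 < q := Real.rpow_pos_of_pos hV _
  have hVp : V ^ p = q * V := by
    rw [hq, ← Real.rpow_add_one hV.ne']; ring_nf
  have hVp1 : V ^ (p + 1) = q * V ^ 2 := by
    rw [Real.rpow_add_one hV.ne', hVp]; ring
  rw [Real.mul_rpow hV.le hx0, Real.mul_rpow hV.le hx0, Real.mul_rpow hV.le hy0,
    Real.mul_rpow hV.le hy0, hVp, hVp1]
  have hV1 : |V * x - V| = V * |x - 1| := by
    rw [show V * x - V = V * (x - 1) by ring, abs_mul, abs_of_pos hV]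
  have hqV : 0 < q * V := by positivity
  refine ⟨fun ε hε => ?_, ?_, ?_, ?_, ?_, ?_⟩
  · rw [hV1] at hε ⊢
    have hε' : |x - 1| ≤ ε := by
      rw [mul_comm] at hε; exact le_of_mul_le_mul_right hε hV
    rw [show q * V * x ^ p - q * V - p * q * (V * x - V) = q * V * (x ^ p - 1 - p * (x - 1)) by ring,
      abs_mul, abs_of_pos hqV]
    calc q * V * |x ^ p - 1 - p * (x - 1)| ≤ q * V * (C * (x - 1) ^ 2) := by gcongr
      _ = C * |x - 1| * (q * (V * |x - 1|)) := by rw [← sq_abs]; ring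
      _ ≤ _ := by gcongr
  · calc q * (V * x - V) ^ 2 = q * V ^ 2 * (x - 1) ^ 2 := by ring
      _ ≤ q * V ^ 2 * (C * (x ^ (p + 1) - 1 - (p + 1) / p * (x ^ p - 1))) := by gcongr
      _ = _ := by ring
  · calc _ = q * V ^ 2 * (x ^ (p + 1) - 1 - (p + 1) / p * (x ^ p - 1)) := by ring
      _ ≤ q * V ^ 2 * (C * (x - 1) ^ 2) := by gcongr
      _ = _ := by ring
  · rw [hV1, show q * V * x ^ p - q * V = q * V * (x ^ p - 1) by ring, abs_mul, abs_of_pos hqV]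
    calc _ ≤ q * V * (C * |x - 1|) := by gcongr
      _ = _ := by ring
  · rw [← mul_sub, ← mul_sub, abs_mul, abs_mul, abs_of_pos hV, abs_of_pos hqV]
    calc _ = q * V * |x - y| := by ring
      _ ≤ q * V * (C * |x ^ p - y ^ p|) := by gcongr
      _ = _ := by ring
  · rw [← mul_sub, abs_mul, abs_of_pos hqV]
    have : ∀ a b : ℝ, (q * V ^ 2 * a - q * V ^ 2 - (p + 1) / p * (q * V * b - q * V) * V) =
      q * V ^ 2 * (a - (p + 1) / p * b) + (-q * V ^ 2 + (p + 1) / p * q * V ^ 2) := fun a b => by ring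
    rw [this, this, add_sub_add_right_eq_sub, ← mul_sub, abs_mul, abs_of_pos (by positivity)]
    calc _ ≤ q * V ^ 2 * (C * |x ^ p - y ^ p|) := by gcongr
      _ = _ := by ring

/-- Convexity inequality behind the dissipation of the entropy. -/
theorem rpow_add_one_sub_le {p : ℝ} (hp : 1 < p) {v v' : ℝ} (hv : 0 ≤ v) (hv' : 0 ≤ v') :
    v ^ (p + 1) - v' ^ (p + 1) ≤ (p + 1) / p * (v * (v ^ p - v' ^ p)) := by
  have hp0 : 0 < p := by linarith
  have hc : (p + 1).HolderConjugate ((p + 1) / p) := by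
    rw [Real.holderConjugate_iff]
    refine ⟨by linarith, ?_⟩
    field_simp
    ring
  -- Young's inequality for v · v'^p with the conjugate exponents p + 1 and (p + 1)/p.
  have h := Real.young_inequality_of_nonneg hv (Real.rpow_nonneg hv' p) hc
  rw [← Real.rpow_mul hv', mul_div_cancel₀ _ hp0.ne'] at h
  have h1 : v * v ^ p = v ^ (p + 1) := by
    rw [Real.rpow_add_one' hv (by linarith), mul_comm]
  rw [mul_sub, h1]
  have h2 : (p + 1) / p * (v * v' ^ p) ≤
      (p + 1) / p * (v ^ (p + 1) / (p + 1) + v' ^ (p + 1) / ((p + 1) / p)) := by gcongr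
  have h3 : (p + 1) / p * (v ^ (p + 1) / (p + 1) + v' ^ (p + 1) / ((p + 1) / p)) =
      v ^ (p + 1) / p + v' ^ (p + 1) := by field_simp
  have h4 : (p + 1) / p * v ^ (p + 1) = v ^ (p + 1) + v ^ (p + 1) / p := by field_simp
  rw [mul_sub, h4]
  linarith

end Pointwise

/-! ### Unstable scalar equation and coupled differential inequalities. -/

section ODE

/-- A bounded solution of `A' = μ A + n` with `μ > 0` is controlled by the forcing term. -/
theorem abs_le_of_hasDerivAt_unstable {A n : ℝ → ℝ} {μ D B t : ℝ} (hμ : 0 < μ)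
    (hA : ∀ s, t ≤ s → HasDerivAt A (μ * A s + n s) s) (hn : ∀ s, t ≤ s → |n s| ≤ D)
    (hB : ∀ s, t ≤ s → |A s| ≤ B) : |A t| ≤ D / μ := by
  have key : ∀ (A n : ℝ → ℝ), (∀ s, t ≤ s → HasDerivAt A (μ * A s + n s) s) →
      (∀ s, t ≤ s → |n s| ≤ D) → (∀ s, t ≤ s → |A s| ≤ B) → A t ≤ D / μ := by
    intro A n hA hn hB
    -- The integrating factor makes g nondecreasing, and g → 0 because `A` is bounded; therefore
    -- g(t) ≤ 0, which is the upper bound.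
    set g : ℝ → ℝ := fun s => Real.exp (-μ * (s - t)) * (A s - D / μ)
    have hexp : ∀ s, HasDerivAt (fun s => Real.exp (-μ * (s - t)))
        (Real.exp (-μ * (s - t)) * (-μ)) s := fun s => by
      have h : HasDerivAt (fun s => -μ * (s - t)) (-μ) s := by
        simpa using ((hasDerivAt_id s).sub_const t).const_mul (-μ)
      exact h.exp
    have hg : ∀ s, t ≤ s → HasDerivAt g (Real.exp (-μ * (s - t)) * (n s + D)) s := fun s hs => by
      have := (hexp s).mul ((hA s hs).sub_const (D / μ))
      refine this.congr_deriv ?_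
      field_simp
      ring
    have hmono : MonotoneOn g (Ici t) := by
      refine monotoneOn_of_deriv_nonneg (convex_Ici t)
        (fun s hs => (hg s hs).continuousAt.continuousWithinAt)
        (fun s hs => (hg s (interior_subset hs)).differentiableAt.differentiableWithinAt)
        (fun s hs => ?_)
      have hs' : t ≤ s := interior_subset hs
      rw [(hg s hs').deriv]
      have := (abs_le.1 (hn s hs')).1
      exact mul_nonneg (Real.exp_pos _).le (by linarith)
    have hlim : Tendsto g atTop (𝓝 0) := by
      have h1 : Tendsto (fun s => Real.exp (-μ * (s - t))) atTop (𝓝 0) := by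
        refine Real.tendsto_exp_atBot.comp ?_
        have : Tendsto (fun s => μ * (s - t)) atTop atTop :=
          (tendsto_atTop_add_const_right atTop (-t) tendsto_id).const_mul_atTop hμ
        exact (tendsto_neg_atTop_atBot.comp this).congr fun s => by simp
      refine squeeze_zero_norm' (a := fun s => Real.exp (-μ * (s - t)) * (B + |D / μ|)) ?_
        (by simpa using h1.mul_const (B + |D / μ|))
      filter_upwards [eventually_ge_atTop t] with s hs
      rw [norm_mul, Real.norm_of_nonneg (Real.exp_pos _).le]
      gcongr
      exact (abs_sub _ _).trans (add_le_add_left (hB s hs) _)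
    have h0 : g t ≤ 0 := ge_of_tendsto hlim (by
      filter_upwards [eventually_ge_atTop t] with s hs
      exact hmono self_mem_Ici hs hs)
    simp only [g, sub_self, mul_zero, Real.exp_zero, one_mul] at h0
    linarith
  rw [abs_le]
  refine ⟨?_, key A n hA hn hB⟩
  have := key (fun s => -A s) (fun s => -n s)
    (fun s hs => (hA s hs).neg.congr_deriv (by ring))
    (fun s hs => by simpa using hn s hs) (fun s hs => by simpa using hB s hs)
  linarith

/-- Coupled differential inequalities: a bounded pair with `E' ≤ -ν E + C Q` and
`Q' ≥ μ Q - ε E` decays, provided the coupling `ε` is small. -/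
theorem antitone_tendsto_zero_of_coupled {E Q : ℝ → ℝ} {a ν C μ ε θ B : ℝ} (hν : 0 < ν)
    (hC : 0 < C) (hθ : 0 < θ) (hθμ : 2 * C ≤ θ * μ) (hθε : θ * ε ≤ ν / 2)
    (hθν : 2 * C ≤ θ * ν) (hEc : ContinuousOn E (Ici a)) (hQc : ContinuousOn Q (Ici a))
    (hE0 : ∀ t, a ≤ t → 0 ≤ E t) (hQ0 : ∀ t, a ≤ t → 0 ≤ Q t) (hQB : ∀ t, a ≤ t → Q t ≤ B)
    (hE : ∀ s t, a ≤ s → s ≤ t → E t - E s ≤ ∫ τ in s..t, (-ν * E τ + C * Q τ))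
    (hQ : ∀ s t, a ≤ s → s ≤ t → ∫ τ in s..t, (μ * Q τ - ε * E τ) ≤ Q t - Q s) :
    AntitoneOn E (Ici a) ∧ Tendsto E atTop (𝓝 0) := by
  have hint : ∀ {f : ℝ → ℝ}, ContinuousOn f (Ici a) → ∀ s t, a ≤ s → s ≤ t →
      IntervalIntegrable f volume s t := fun hf s t hs hst =>
    (hf.mono (by rw [uIcc_of_le hst]; exact fun x hx => hs.trans hx.1)).intervalIntegrable
  -- E - θQ is a Lyapunov function: 2C ≤ θμ turns +CQ into -CQ, and θε ≤ ν/2 costs only half of the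
  -- decay of E.
  have hL : ∀ s t, a ≤ s → s ≤ t → (E t - θ * Q t) - (E s - θ * Q s) ≤
      ∫ τ in s..t, (-(ν / 2) * E τ - C * Q τ) := by
    intro s t hs hst
    have h1 := hE s t hs hst
    have h2 := mul_le_mul_of_nonneg_left (hQ s t hs hst) hθ.le
    have h3 : (∫ τ in s..t, (-ν * E τ + C * Q τ)) - θ * ∫ τ in s..t, (μ * Q τ - ε * E τ) ≤
        ∫ τ in s..t, (-(ν / 2) * E τ - C * Q τ) := by
      rw [← intervalIntegral.integral_const_mul, ← intervalIntegral.integral_sub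
        (hint (by fun_prop) s t hs hst) (hint (by fun_prop) s t hs hst)]
      refine intervalIntegral.integral_mono_on hst (hint (by fun_prop) s t hs hst)
        (hint (by fun_prop) s t hs hst) fun τ hτ => ?_
      have e1 := mul_le_mul_of_nonneg_right hθε (hE0 τ (hs.trans hτ.1))
      have e2 := mul_le_mul_of_nonneg_right hθμ (hQ0 τ (hs.trans hτ.1))
      nlinarith
    linarith
  -- With this κ, the rate (ν/2)E + CQ is at least κ(θQ - E).
  obtain ⟨κ, hκ0, hκ1, hκ2⟩ : ∃ κ, 0 < κ ∧ κ ≤ ν / 2 ∧ κ * θ ≤ C :=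
    ⟨min (ν / 2) (C / θ), by positivity, min_le_left _ _, by
      calc _ ≤ C / θ * θ := by gcongr; exact min_le_right _ _
        _ = C := by field_simp⟩
  -- If θQ - E = l > 0 at time s, it stays at least l and then grows at least linearly, at rate κl;
  -- this contradicts the bound on Q.
  have hLpos : ∀ s, a ≤ s → θ * Q s ≤ E s := by
    intro s hs
    by_contra hcon
    push Not at hcon
    set l := θ * Q s - E s with hl
    have hl0 : 0 < l := by linarith
    have hneg : ∀ t, s ≤ t → l ≤ θ * Q t - E t := by
      intro t hst
      have h1 := hL s t hs hst
      have h2 : ∫ τ in s..t, (-(ν / 2) * E τ - C * Q τ) ≤ 0 := by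
        have h4 : 0 ≤ ∫ τ in s..t, -(-(ν / 2) * E τ - C * Q τ) :=
          intervalIntegral.integral_nonneg hst fun τ hτ => by
            have e1 := hE0 τ (hs.trans hτ.1)
            have e2 := hQ0 τ (hs.trans hτ.1)
            nlinarith [mul_nonneg hν.le e1, mul_nonneg hC.le e2]
        rw [intervalIntegral.integral_neg] at h4
        linarith
      linarith
    have hgrow : ∀ t, s ≤ t → κ * l * (t - s) ≤ θ * B := by
      intro t hst
      have h1 := hL s t hs hst
      have h2 : ∫ τ in s..t, (-(ν / 2) * E τ - C * Q τ) ≤ ∫ _τ in s..t, -(κ * l) := by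
        refine intervalIntegral.integral_mono_on hst (hint (by fun_prop) s t hs hst)
          (by simp) fun τ hτ => ?_
        have e1 := hE0 τ (hs.trans hτ.1)
        have e2 := hQ0 τ (hs.trans hτ.1)
        have e3 := mul_le_mul_of_nonneg_left (hneg τ hτ.1) hκ0.le
        have e4 := mul_le_mul_of_nonneg_right hκ2 e2
        nlinarith [mul_le_mul_of_nonneg_right hκ1 e1, mul_nonneg hκ0.le e1]
      rw [intervalIntegral.integral_const, smul_eq_mul] at h2
      have e3 := mul_le_mul_of_nonneg_left (hQB t (hs.trans hst)) hθ.le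
      have e4 := hE0 t (hs.trans hst)
      nlinarith
    have h1 := hgrow (s + (|θ * B| + 1) / (κ * l)) (by
      have : 0 < (|θ * B| + 1) / (κ * l) := by positivity
      linarith)
    rw [add_sub_cancel_left, mul_div_cancel₀ _ (by positivity)] at h1
    linarith [le_abs_self (θ * B)]
  have hE2 : ∀ s t, a ≤ s → s ≤ t → E t - E s ≤ -(ν / 2) * ∫ τ in s..t, E τ := by
    intro s t hs hst
    refine (hE s t hs hst).trans ?_
    rw [← intervalIntegral.integral_const_mul]
    refine intervalIntegral.integral_mono_on hst (hint (by fun_prop) s t hs hst)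
      (hint (by fun_prop) s t hs hst) fun τ hτ => ?_
    have e1 := hLpos τ (hs.trans hτ.1)
    have e2 := hQ0 τ (hs.trans hτ.1)
    have e3 := mul_le_mul_of_nonneg_right hθν e2
    nlinarith
  have hanti : AntitoneOn E (Ici a) := by
    intro s hs t ht hst
    have h1 := hE2 s t hs hst
    have h2 : 0 ≤ ∫ τ in s..t, E τ :=
      intervalIntegral.integral_nonneg hst fun τ hτ => hE0 τ (le_trans hs hτ.1)
    nlinarith
  refine ⟨hanti, ?_⟩
  -- Monotonicity and ∫E ≤ (2/ν)E(a) give decay like 1/(t - a), enough for the limit without any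
  -- exponential rate.
  have hbound : ∀ t, a < t → E t ≤ (2 / ν * E a) * (t - a)⁻¹ := by
    intro t hat
    have h1 := hE2 a t le_rfl hat.le
    have h2 : ∫ _τ in a..t, E t ≤ ∫ τ in a..t, E τ := by
      refine intervalIntegral.integral_mono_on hat.le (by simp)
        (hint hEc a t le_rfl hat.le) fun τ hτ => hanti hτ.1 hat.le hτ.2
    rw [intervalIntegral.integral_const, smul_eq_mul] at h2
    rw [← div_eq_mul_inv, le_div_iff₀ (by linarith), div_mul_eq_mul_div, le_div_iff₀ hν]
    have h3 := hE0 t hat.le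
    nlinarith
  refine squeeze_zero' (by filter_upwards [eventually_ge_atTop a] with t ht using hE0 t ht)
    (by filter_upwards [eventually_gt_atTop a] with t ht using hbound t ht) ?_
  have : Tendsto (fun t => (t - a)⁻¹) atTop (𝓝 0) :=
    tendsto_inv_atTop_zero.comp (tendsto_atTop_add_const_right atTop (-a) tendsto_id)
  simpa using this.const_mul (2 / ν * E a)

end ODE

/-! ### Inner products, Cauchy–Schwarz and convergence in L². -/

section L2

variable {α H : Type*} [MeasurableSpace α] {μ : Measure α} [NormedAddCommGroup H]
  [InnerProductSpace ℝ H]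

theorem MeasureTheory.MemLp.integrable_inner_two {u w : α → H} (hu : MemLp u 2 μ)
    (hw : MemLp w 2 μ) : Integrable (fun x => inner ℝ (u x) (w x)) μ := by
  refine (L2.integrable_inner (𝕜 := ℝ) (hu.toLp u) (hw.toLp w)).congr ?_
  filter_upwards [hu.coeFn_toLp, hw.coeFn_toLp] with x h1 h2
  rw [h1, h2]

theorem MeasureTheory.MemLp.norm_toLp_sq {u : α → H} (hu : MemLp u 2 μ) :
    ‖hu.toLp u‖ ^ 2 = ∫ x, ‖u x‖ ^ 2 ∂μ := by
  rw [← real_inner_self_eq_norm_sq, L2.inner_def]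
  refine integral_congr_ae ?_
  filter_upwards [hu.coeFn_toLp] with x h1
  rw [h1, real_inner_self_eq_norm_sq]

theorem MeasureTheory.MemLp.inner_toLp {u w : α → H} (hu : MemLp u 2 μ) (hw : MemLp w 2 μ) :
    inner ℝ (hu.toLp u) (hw.toLp w) = ∫ x, inner ℝ (u x) (w x) ∂μ := by
  rw [L2.inner_def]
  refine integral_congr_ae ?_
  filter_upwards [hu.coeFn_toLp, hw.coeFn_toLp] with x h1 h2
  rw [h1, h2]

/-- Cauchy–Schwarz inequality in `L²`. -/
theorem MeasureTheory.MemLp.sq_integral_inner_le {u w : α → H} (hu : MemLp u 2 μ)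
    (hw : MemLp w 2 μ) :
    (∫ x, inner ℝ (u x) (w x) ∂μ) ^ 2 ≤ (∫ x, ‖u x‖ ^ 2 ∂μ) * ∫ x, ‖w x‖ ^ 2 ∂μ := by
  rw [← hu.inner_toLp hw, ← hu.norm_toLp_sq, ← hw.norm_toLp_sq, ← mul_pow, ← sq_abs]
  exact pow_le_pow_left₀ (abs_nonneg _) (abs_real_inner_le_norm _ _) 2

theorem MeasureTheory.MemLp.abs_integral_inner_le {u w : α → H} (hu : MemLp u 2 μ)
    (hw : MemLp w 2 μ) :
    |∫ x, inner ℝ (u x) (w x) ∂μ| ≤ (∫ x, ‖u x‖ ^ 2 ∂μ) + ∫ x, ‖w x‖ ^ 2 ∂μ := by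
  rw [← hu.inner_toLp hw, ← hu.norm_toLp_sq, ← hw.norm_toLp_sq]
  refine (abs_real_inner_le_norm _ _).trans ?_
  nlinarith [sq_nonneg (‖hu.toLp u‖ - ‖hw.toLp w‖), sq_nonneg (‖hu.toLp u‖ + ‖hw.toLp w‖)]

omit [InnerProductSpace ℝ H] in
theorem MeasureTheory.tendsto_toLp_of_eLpNorm {u : α → H} {w : ℕ → α → H} (hu : MemLp u 2 μ)
    (hw : ∀ n, MemLp (w n) 2 μ)
    (h : Tendsto (fun n => eLpNorm (fun x => u x - w n x) 2 μ) atTop (𝓝 0)) :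
    Tendsto (fun n => (hw n).toLp (w n)) atTop (𝓝 (hu.toLp u)) := by
  rw [tendsto_iff_edist_tendsto_0]
  refine h.congr fun n => ?_
  rw [edist_comm, Lp.edist_toLp_toLp]; rfl

theorem MeasureTheory.tendsto_integral_inner {u : α → H} {w : ℕ → α → H} {k : α → H}
    (hk : MemLp k 2 μ) (hu : MemLp u 2 μ) (hw : ∀ n, MemLp (w n) 2 μ)
    (h : Tendsto (fun n => eLpNorm (fun x => u x - w n x) 2 μ) atTop (𝓝 0)) :
    Tendsto (fun n => ∫ x, inner ℝ (k x) (w n x) ∂μ) atTop (𝓝 (∫ x, inner ℝ (k x) (u x) ∂μ)) := by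
  rw [← hk.inner_toLp hu]
  refine Tendsto.congr (fun n => hk.inner_toLp (hw n)) ?_
  exact tendsto_const_nhds.inner (tendsto_toLp_of_eLpNorm hu hw h)

theorem MeasureTheory.exists_bound_integral_sq {u : α → H} {w : ℕ → α → H}
    (hu : MemLp u 2 μ) (hw : ∀ n, MemLp (w n) 2 μ)
    (h : Tendsto (fun n => eLpNorm (fun x => u x - w n x) 2 μ) atTop (𝓝 0)) :
    ∃ B, ∀ n, ∫ x, ‖w n x‖ ^ 2 ∂μ ≤ B := by
  have h1 := ((tendsto_toLp_of_eLpNorm hu hw h).norm.pow 2).bddAbove_range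
  obtain ⟨B, hB⟩ := h1
  exact ⟨B, fun n => by
    rw [← (hw n).norm_toLp_sq]; exact hB ⟨n, rfl⟩⟩

end L2

/-! ### Weak derivatives in one time variable. -/

section TimeWeak

open Real in
theorem deriv_smoothTransition_eq_zero {x : ℝ} (hx : x < 0 ∨ 1 < x) :
    deriv smoothTransition x = 0 := by
  rcases hx with h | h
  · have : smoothTransition =ᶠ[𝓝 x] fun _ => 0 := by
      filter_upwards [Iio_mem_nhds h] with y hy using smoothTransition.zero_of_nonpos hy.le
    rw [this.deriv_eq, deriv_const]
  · have : smoothTransition =ᶠ[𝓝 x] fun _ => 1 := by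
      filter_upwards [Ioi_mem_nhds h] with y hy using smoothTransition.one_of_one_le (le_of_lt hy)
    rw [this.deriv_eq, deriv_const]

open Real in
theorem hasDerivAt_smoothTransition (x : ℝ) :
    HasDerivAt smoothTransition (deriv smoothTransition x) x :=
  ((smoothTransition.contDiff (n := 1)).differentiable (by simp) x).hasDerivAt

open Real in
theorem continuous_deriv_smoothTransition : Continuous (deriv smoothTransition) :=
  (smoothTransition.contDiff (n := 1)).continuous_deriv le_rfl

open Real in
theorem hasDerivAt_smoothTransition_scaled (n u τ : ℝ) :
    HasDerivAt (fun τ => smoothTransition (n * (τ - u)))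
      (n * deriv smoothTransition (n * (τ - u))) τ := by
  have h : HasDerivAt (fun τ => n * (τ - u)) n τ := by
    simpa using ((hasDerivAt_id τ).sub_const u).const_mul n
  exact ((hasDerivAt_smoothTransition _).comp τ h).congr_deriv (mul_comm _ _)

open Real in
/-- The derivatives of steep smooth steps at `u` are an approximate identity. -/
theorem tendsto_integral_deriv_smoothTransition {a : ℝ → ℝ} {s t u : ℝ} (hsu : s ≤ u) (hut : u < t)
    (ha : ContinuousOn a (Icc s t)) :
    Tendsto (fun n : ℕ => ∫ τ in s..t, (n * deriv smoothTransition (n * (τ - u))) * a τ) atTop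
      (𝓝 (a u)) := by
  have hst : s ≤ t := by linarith
  have hc : ∀ n : ℕ, Continuous fun τ : ℝ => n * deriv smoothTransition (n * (τ - u)) := fun n =>
    continuous_const.mul (continuous_deriv_smoothTransition.comp (by fun_prop))
  have hau := ha u ⟨hsu, hut.le⟩
  rw [Metric.tendsto_nhds]
  intro ε hε
  have h1 := (Metric.continuousWithinAt_iff.1 hau) (ε / 2) (by positivity)
  obtain ⟨d, hd, hda⟩ := h1
  -- The kernel lives on [u, u + 1/n]. Large n puts this interval inside the window of continuity
  -- and to the left of t, so the full mass 1 is captured; being one-sided, the kernel allows u = s.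
  obtain ⟨n₀, hn₀⟩ := exists_nat_gt (max (1 / d) (1 / (t - u)))
  filter_upwards [eventually_ge_atTop n₀] with n hn
  have hnr : max (1 / d) (1 / (t - u)) < n := hn₀.trans_le (by exact_mod_cast hn)
  have hnd := (le_max_left _ _).trans_lt hnr
  have hnt := (le_max_right _ _).trans_lt hnr
  have hn0 : (0 : ℝ) < n := (by positivity : 0 < 1 / d).trans hnd
  rw [div_lt_iff₀ hd] at hnd
  rw [div_lt_iff₀ (by linarith)] at hnt
  have hk0 : ∀ τ, 0 ≤ n * deriv smoothTransition (n * (τ - u)) := fun τ =>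
    mul_nonneg hn0.le smoothTransition.monotone.deriv_nonneg
  have hone : ∫ τ in s..t, n * deriv smoothTransition (n * (τ - u)) = 1 := by
    rw [intervalIntegral.integral_eq_sub_of_hasDerivAt
      (fun τ _ => hasDerivAt_smoothTransition_scaled n u τ) ((hc n).intervalIntegrable _ _),
      smoothTransition.one_of_one_le hnt.le, smoothTransition.zero_of_nonpos
        (mul_nonpos_of_nonneg_of_nonpos hn0.le (by linarith)), sub_zero]
  have hia : IntervalIntegrable (fun τ => (n * deriv smoothTransition (n * (τ - u))) * a τ)
      volume s t :=
    (((hc n).continuousOn).mul (by rwa [uIcc_of_le hst])).intervalIntegrable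
  have hdiff : (∫ τ in s..t, (n * deriv smoothTransition (n * (τ - u))) * a τ) - a u =
      ∫ τ in s..t, (n * deriv smoothTransition (n * (τ - u))) * (a τ - a u) := by
    have hsplit : (fun τ => (n * deriv smoothTransition (n * (τ - u))) * (a τ - a u)) = fun τ =>
        (n * deriv smoothTransition (n * (τ - u))) * a τ -
          (n * deriv smoothTransition (n * (τ - u))) * a u := by
      ext τ; ring
    have hib : IntervalIntegrable (fun τ => (n * deriv smoothTransition (n * (τ - u))) * a u)
        volume s t := ((hc n).mul continuous_const).intervalIntegrable _ _
    rw [hsplit, intervalIntegral.integral_sub hia hib, intervalIntegral.integral_mul_const, hone, one_mul]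
  rw [Real.dist_eq, hdiff]
  have hb : |∫ τ in s..t, (n * deriv smoothTransition (n * (τ - u))) * (a τ - a u)| ≤
      ∫ τ in s..t, (n * deriv smoothTransition (n * (τ - u))) * (ε / 2) := by
    rw [← Real.norm_eq_abs]
    refine (intervalIntegral.norm_integral_le_integral_norm hst).trans ?_
    refine intervalIntegral.integral_mono_on hst ?_
      (((hc n).mul continuous_const).intervalIntegrable _ _) fun τ hτ => ?_
    · exact (((hc n).continuousOn).mul ((by rwa [uIcc_of_le hst] :
        ContinuousOn a (uIcc s t)).sub continuousOn_const)).norm.intervalIntegrable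
    · rw [norm_mul, Real.norm_of_nonneg (hk0 τ)]
      by_cases hz : n * (τ - u) < 0 ∨ 1 < n * (τ - u)
      · rw [deriv_smoothTransition_eq_zero hz]; simp
      · push Not at hz
        refine mul_le_mul_of_nonneg_left ?_ (hk0 τ)
        have h2 : 0 ≤ τ - u := by
          by_contra hc
          exact absurd hz.1 (not_le.2 (mul_neg_of_pos_of_neg hn0 (not_le.1 hc)))
        have h3 : τ - u < d := by
          by_contra hc
          push Not at hc
          nlinarith
        have := hda hτ (by rw [Real.dist_eq, abs_of_nonneg h2]; exact h3)
        rw [Real.dist_eq] at this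
        exact this.le
  refine hb.trans_lt ?_
  rw [intervalIntegral.integral_mul_const, hone]
  linarith

open Real in
/-- A weak derivative of a continuous function of one variable is its derivative in integrated
form. -/
theorem sub_eq_integral_of_weak {a b : ℝ → ℝ} {t₁ : ℝ} (ha : ContinuousOn a (Ioi t₁))
    (hb : ∀ s t, t₁ < s → s ≤ t → IntervalIntegrable b volume s t)
    (h : ∀ θ : ℝ → ℝ, IsTestFunction (Ioi t₁) θ →
      ∫ τ in Ioi t₁, (deriv θ τ * a τ + θ τ * b τ) = 0) {s t : ℝ} (hs : t₁ < s) (hst : s ≤ t) :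
    a t - a s = ∫ τ in s..t, b τ := by
  have hac : ContinuousOn a (Icc s (t + 1)) := ha.mono fun x hx => hs.trans_le hx.1
  have hst1 : s ≤ t + 1 := by linarith
  -- Plateaus with ramps of width 1/n starting at s and at t: they tend to the indicator of (s, t]
  -- and their derivatives to δ_s - δ_t. The interval up to t + 1 contains the falling ramp.
  set θ : ℕ → ℝ → ℝ := fun n τ => smoothTransition (n * (τ - s)) - smoothTransition (n * (τ - t))
  have hθd : ∀ n τ, HasDerivAt (θ n) (n * deriv smoothTransition (n * (τ - s)) -
      n * deriv smoothTransition (n * (τ - t))) τ := fun n τ =>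
    (hasDerivAt_smoothTransition_scaled n s τ).sub (hasDerivAt_smoothTransition_scaled n t τ)
  have hθ0 : ∀ n : ℕ, 1 ≤ n → ∀ τ, τ ∉ Icc s (t + 1) → θ n τ = 0 := by
    intro n hn τ hτ
    have hn1 : (1 : ℝ) ≤ n := by exact_mod_cast hn
    rw [mem_Icc, not_and_or, not_le, not_le] at hτ
    rcases hτ with h | h
    · simp only [θ]
      rw [smoothTransition.zero_of_nonpos, smoothTransition.zero_of_nonpos, sub_zero] <;> nlinarith
    · simp only [θ]
      rw [smoothTransition.one_of_one_le, smoothTransition.one_of_one_le, sub_self] <;> nlinarith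
  have htest : ∀ n : ℕ, 1 ≤ n → IsTestFunction (Ioi t₁) (θ n) := by
    intro n hn
    have hsub : tsupport (θ n) ⊆ Icc s (t + 1) := by
      refine closure_minimal (fun τ hτ => ?_) isClosed_Icc
      by_contra hc
      exact hτ (hθ0 n hn τ hc)
    refine ⟨?_, isCompact_Icc.of_isClosed_subset (isClosed_tsupport _) hsub,
      hsub.trans fun x hx => hs.trans_le hx.1⟩
    exact (smoothTransition.contDiff.comp (by fun_prop)).sub
      (smoothTransition.contDiff.comp (by fun_prop))
  have heq : ∀ n : ℕ, 1 ≤ n →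
      (∫ τ in s..(t + 1), (n * deriv smoothTransition (n * (τ - s))) * a τ) -
      (∫ τ in s..(t + 1), (n * deriv smoothTransition (n * (τ - t))) * a τ) +
      ∫ τ in s..(t + 1), θ n τ * b τ = 0 := by
    intro n hn
    have h1 := h (θ n) (htest n hn)
    have hc : ∀ u : ℝ, Continuous fun τ : ℝ => n * deriv smoothTransition (n * (τ - u)) := fun u =>
      continuous_const.mul (continuous_deriv_smoothTransition.comp (by fun_prop))
    have hi : ∀ u : ℝ, IntervalIntegrable
        (fun τ => (n * deriv smoothTransition (n * (τ - u))) * a τ) volume s (t + 1) := fun u =>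
      ((hc u).continuousOn.mul (by rwa [uIcc_of_le hst1])).intervalIntegrable
    have hib : IntervalIntegrable (fun τ => θ n τ * b τ) volume s (t + 1) :=
      (hb s (t + 1) hs hst1).continuousOn_mul
        ((htest n hn).1.continuous.continuousOn)
    rw [← intervalIntegral.integral_sub (hi s) (hi t), ← intervalIntegral.integral_add
      ((hi s).sub (hi t)) hib, intervalIntegral.integral_of_le hst1, ← integral_Icc_eq_integral_Ioc,
      ← h1]
    symm
    have hsubset : Icc s (t + 1) ⊆ Ioi t₁ := fun x hx => hs.trans_le hx.1
    rw [setIntegral_eq_of_subset_of_forall_sdiff_eq_zero measurableSet_Ioi hsubset]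
    · refine setIntegral_congr_fun measurableSet_Icc fun τ _ => ?_
      simp only [(hθd n τ).deriv, sub_mul]
    · intro τ hτ
      have hz : θ n =ᶠ[𝓝 τ] fun _ => 0 := by
        filter_upwards [isClosed_Icc.isOpen_compl.mem_nhds hτ.2] with y hy using hθ0 n hn y hy
      rw [hz.deriv_eq, hθ0 n hn τ hτ.2]
      simp
  have hl1 := tendsto_integral_deriv_smoothTransition (u := s) le_rfl
    (by linarith : s < t + 1) hac
  have hl2 := tendsto_integral_deriv_smoothTransition (u := t) hst
    (by linarith : t < t + 1) hac
  have hl3 : Tendsto (fun n : ℕ => ∫ τ in s..(t + 1), θ n τ * b τ) atTop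
      (𝓝 (∫ τ in s..(t + 1), (Iic t).indicator b τ)) := by
    refine intervalIntegral.tendsto_integral_filter_of_dominated_convergence (fun τ => |b τ|) ?_ ?_
      (hb s (t + 1) hs hst1).norm ?_
    · filter_upwards [eventually_ge_atTop 1] with n hn
      exact (htest n hn).1.continuous.aestronglyMeasurable.mul
        ((hb s (t + 1) hs hst1).def'.aestronglyMeasurable)
    · refine Eventually.of_forall fun n => Eventually.of_forall fun τ _ => ?_
      rw [norm_mul]
      refine mul_le_of_le_one_left (norm_nonneg _) ?_
      rw [Real.norm_eq_abs, abs_le]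
      have e1 := smoothTransition.le_one (n * (τ - s))
      have e2 := smoothTransition.nonneg (n * (τ - s))
      have e3 := smoothTransition.le_one (n * (τ - t))
      have e4 := smoothTransition.nonneg (n * (τ - t))
      constructor <;> simp only [θ] <;> linarith
    · refine Eventually.of_forall fun τ hτ => ?_
      rw [uIoc_of_le hst1] at hτ
      have hstep : ∀ u, u < τ → ∀ᶠ n : ℕ in atTop, smoothTransition (n * (τ - u)) = 1 := by
        intro u hu
        obtain ⟨n₀, hn₀⟩ := exists_nat_gt (1 / (τ - u))
        filter_upwards [eventually_ge_atTop n₀] with n hn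
        refine smoothTransition.one_of_one_le ?_
        have : 1 / (τ - u) < n := hn₀.trans_le (by exact_mod_cast hn)
        rw [div_lt_iff₀ (by linarith)] at this
        exact this.le
      refine tendsto_nhds_of_eventually_eq ?_
      by_cases hτt : τ ≤ t
      · filter_upwards [hstep s hτ.1] with n hn
        rw [indicator_of_mem (show τ ∈ Iic t from hτt)]
        simp only [θ]
        rw [hn, smoothTransition.zero_of_nonpos]
        · ring
        · exact mul_nonpos_of_nonneg_of_nonpos (by positivity) (by linarith)
      · filter_upwards [hstep s hτ.1, hstep t (not_le.1 hτt)] with n hn hn'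
        rw [indicator_of_notMem (show τ ∉ Iic t from hτt)]
        simp only [θ]
        rw [hn, hn']
        ring
  have hlim := (hl1.sub hl2).add hl3
  have h0 : a s - a t + ∫ τ in s..(t + 1), (Iic t).indicator b τ = 0 := by
    refine tendsto_nhds_unique hlim (tendsto_nhds_of_eventually_eq ?_)
    filter_upwards [eventually_ge_atTop 1] with n hn using heq n hn
  have h1 : ∫ τ in s..(t + 1), (Iic t).indicator b τ = ∫ τ in s..t, b τ := by
    rw [intervalIntegral.integral_of_le hst1, intervalIntegral.integral_of_le hst,
      integral_indicator measurableSet_Iic, Measure.restrict_restrict measurableSet_Iic]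
    congr 2
    ext x
    simp only [mem_inter_iff, mem_Iic, mem_Ioc]
    constructor
    · rintro ⟨h1, h2, -⟩; exact ⟨h2, h1⟩
    · rintro ⟨h1, h2⟩; exact ⟨h2, h1, by linarith⟩
  rw [h1] at h0
  linarith

end TimeWeak

/-! ### Testing elliptic equations with H¹₀ functions. -/

section Dirichlet

variable {N : ℕ} {Ω : Set (EuclideanSpace ℝ (Fin N))}

local notation "𝔼" => EuclideanSpace ℝ (Fin N)

theorem FastDiffusion.HasH10Gradient.sub {f₁ f₂ : 𝔼 → ℝ} {g₁ g₂ : 𝔼 → 𝔼}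
    (h₁ : HasH10Gradient Ω f₁ g₁) (h₂ : HasH10Gradient Ω f₂ g₂) :
    HasH10Gradient Ω (fun x => f₁ x - f₂ x) (fun x => g₁ x - g₂ x) := by
  obtain ⟨z₁, hz₁, a₁, b₁⟩ := hasH10Gradient_iff.1 h₁
  obtain ⟨z₂, hz₂, a₂, b₂⟩ := hasH10Gradient_iff.1 h₂
  refine hasH10Gradient_iff.2 ⟨z₁ - z₂, (h10Graph Ω).sub_mem hz₁ hz₂, ?_, ?_⟩
  · exact (a₁.sub a₂).trans (Lp.coeFn_sub _ _).symm
  · exact (b₁.sub b₂).trans (Lp.coeFn_sub _ _).symm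

/-- The weak formulation of a Dirichlet problem extends to test functions in `H¹₀(Ω)`. -/
theorem integral_inner_eq_of_hasH10Gradient {h : 𝔼 → ℝ} {g : 𝔼 → 𝔼}
    (hg : MemLp g 2 (volume.restrict Ω)) (hh : MemLp h 2 (volume.restrict Ω))
    (hsol : ∀ ψ : 𝔼 → ℝ, IsTestFunction Ω ψ →
      ∫ x in Ω, inner ℝ (g x) (gradient ψ x) = ∫ x in Ω, h x * ψ x)
    {f : 𝔼 → ℝ} {F : 𝔼 → 𝔼} (hf : HasH10Gradient Ω f F) :
    ∫ x in Ω, inner ℝ (g x) (F x) = ∫ x in Ω, h x * f x := by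
  obtain ⟨hf2, hF2, ψ, hψ, h1, h2⟩ := hf
  have l1 := tendsto_integral_inner hg hF2 (fun n => (hψ n).memLp_gradient _) h2
  have l2 := tendsto_integral_inner hh hf2 (fun n => (hψ n).memLp _) h1
  refine tendsto_nhds_unique l1 ?_
  have : ∀ u : 𝔼 → ℝ, ∫ x in Ω, inner ℝ (h x) (u x) = ∫ x in Ω, h x * u x := fun u =>
    integral_congr_ae (Eventually.of_forall fun x => by simp [mul_comm])
  rw [this] at l2
  refine l2.congr fun n => ?_
  rw [this, hsol _ (hψ n)]

end Dirichlet

/-! ### From the space-time weak formulation to time slices. -/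

section SpaceTime

variable {N : ℕ} {Ω : Set (EuclideanSpace ℝ (Fin N))}

local notation "𝔼" => EuclideanSpace ℝ (Fin N)

theorem volume_restrict_prod (I : Set ℝ) :
    (volume : Measure (ℝ × 𝔼)).restrict (I ×ˢ Ω) =
      (volume.restrict I).prod (volume.restrict Ω) := by
  rw [Measure.prod_restrict, Measure.volume_eq_prod]

theorem FastDiffusion.IsTestFunction.exists_bound {F : Type*} [NormedAddCommGroup F]
    [NormedSpace ℝ F] {U : Set F} {ψ : F → ℝ} (h : IsTestFunction U ψ) : ∃ C, ∀ x, ‖ψ x‖ ≤ C :=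
  h.2.1.exists_bound_of_continuous h.1.continuous

theorem FastDiffusion.IsTestFunction.exists_bound_gradient {ψ : 𝔼 → ℝ} (h : IsTestFunction Ω ψ) :
    ∃ C, ∀ x, ‖gradient ψ x‖ ≤ C :=
  h.2.1.gradient.exists_bound_of_continuous h.1.continuous_gradient

theorem FastDiffusion.IsTestFunction.exists_bound_deriv {U : Set ℝ} {θ : ℝ → ℝ}
    (h : IsTestFunction U θ) : ∃ C, ∀ x, ‖deriv θ x‖ ≤ C :=
  h.2.1.deriv.exists_bound_of_continuous (h.1.continuous_deriv (by simp))

theorem FastDiffusion.IsTestFunction.prod_mul {U : Set ℝ} {θ : ℝ → ℝ} {ψ : 𝔼 → ℝ}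
    (hθ : IsTestFunction U θ) (hψ : IsTestFunction Ω ψ) :
    IsTestFunction (U ×ˢ Ω) (fun z : ℝ × 𝔼 => θ z.1 * ψ z.2) := by
  have hsub : tsupport (fun z : ℝ × 𝔼 => θ z.1 * ψ z.2) ⊆ tsupport θ ×ˢ tsupport ψ := by
    refine closure_minimal (fun z hz => ?_)
      ((isClosed_tsupport θ).prod (isClosed_tsupport ψ))
    have hz' : θ z.1 * ψ z.2 ≠ 0 := hz
    exact ⟨subset_tsupport _ (left_ne_zero_of_mul hz'),
      subset_tsupport _ (right_ne_zero_of_mul hz')⟩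
  refine ⟨(hθ.1.comp contDiff_fst).mul (hψ.1.comp contDiff_snd), ?_,
    hsub.trans (prod_mono hθ.2.2 hψ.2.2)⟩
  exact (hθ.2.1.prod hψ.2.1).of_isClosed_subset (isClosed_tsupport _) hsub

theorem eventuallyEq_zero_of_notMem_tsupport {F : Type*} [NormedAddCommGroup F] {θ : F → ℝ} {x : F}
    (h : x ∉ tsupport θ) : θ =ᶠ[𝓝 x] fun _ => 0 :=
  notMem_tsupport_iff_eventuallyEq.1 h

/-- Space-time integrability of the terms of the weak formulation. -/
theorem integrable_weak_terms [IsFiniteMeasure (volume.restrict Ω)] {w : ℝ → 𝔼 → ℝ}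
    {G : ℝ → 𝔼 → 𝔼} {a b M : ℝ}
    (hw : AEStronglyMeasurable (fun z : ℝ × 𝔼 => w z.1 z.2) (volume.restrict (Ioo a b ×ˢ Ω)))
    (hwM : ∀ᵐ z ∂volume.restrict (Ioo a b ×ˢ Ω), |w z.1 z.2| ≤ M)
    (hG : MemLp (fun z : ℝ × 𝔼 => G z.1 z.2) 2 (volume.restrict (Ioo a b ×ˢ Ω)))
    {ψ : 𝔼 → ℝ} (hψ : IsTestFunction Ω ψ) :
    Integrable (fun z : ℝ × 𝔼 => w z.1 z.2 * ψ z.2) (volume.restrict (Ioo a b ×ˢ Ω)) ∧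
    Integrable (fun z : ℝ × 𝔼 => inner ℝ (G z.1 z.2) (gradient ψ z.2))
      (volume.restrict (Ioo a b ×ˢ Ω)) := by
  have : IsFiniteMeasure ((volume : Measure (ℝ × 𝔼)).restrict (Ioo a b ×ˢ Ω)) := by
    rw [volume_restrict_prod]; infer_instance
  obtain ⟨C, hC⟩ := hψ.exists_bound
  obtain ⟨D, hD⟩ := hψ.exists_bound_gradient
  refine ⟨?_, hG.integrable_inner_two ?_⟩
  · refine Integrable.mono' (g := fun _ => M * C) (integrable_const _) (hw.mul
      (hψ.1.continuous.comp continuous_snd).aestronglyMeasurable) ?_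
    filter_upwards [hwM] with z hz
    rw [norm_mul]
    exact mul_le_mul hz (hC _) (norm_nonneg _) ((abs_nonneg _).trans hz)
  · exact MemLp.of_bound (hψ.1.continuous_gradient.comp continuous_snd).aestronglyMeasurable D
      (Eventually.of_forall fun z => hD _)

/-- The weak formulation tested with a product `θ(t) ψ(x)`. -/
theorem weak_form_product [IsFiniteMeasure (volume.restrict Ω)] {v : ℝ → 𝔼 → ℝ}
    {G : ℝ → 𝔼 → 𝔼} {p c t₁ M : ℝ} (ht₁ : 0 < t₁)
    (hw : ∀ b, AEStronglyMeasurable (fun z : ℝ × 𝔼 => v z.1 z.2 ^ p)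
      (volume.restrict (Ioo t₁ b ×ˢ Ω)))
    (hwM : ∀ b, ∀ᵐ z ∂volume.restrict (Ioo t₁ b ×ˢ Ω), |v z.1 z.2 ^ p| ≤ M)
    (hG : ∀ b, MemLp (fun z : ℝ × 𝔼 => G z.1 z.2) 2 (volume.restrict (Ioo t₁ b ×ˢ Ω)))
    (heq : ∀ ψ : ℝ × 𝔼 → ℝ, IsTestFunction (Ioi (0 : ℝ) ×ˢ Ω) ψ →
      ∫ z in Ioi (0 : ℝ) ×ˢ Ω,
        (v z.1 z.2 ^ p * deriv (fun s => ψ (s, z.2)) z.1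
          - inner ℝ (G z.1 z.2) (gradient (fun y => ψ (z.1, y)) z.2)
          + c * v z.1 z.2 ^ p * ψ z) = 0)
    (hΩm : MeasurableSet Ω) {ψ : 𝔼 → ℝ} (hψ : IsTestFunction Ω ψ) {θ : ℝ → ℝ}
    (hθ : IsTestFunction (Ioi t₁) θ) :
    ∫ τ in Ioi t₁, (deriv θ τ * (∫ x in Ω, v τ x ^ p * ψ x) +
      θ τ * (-(∫ x in Ω, inner ℝ (G τ x) (gradient ψ x)) + c * ∫ x in Ω, v τ x ^ p * ψ x)) = 0 := by
  -- Integrability is only available on bounded time intervals; cutting off at β beyond the support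
  -- of θ makes Fubini applicable.
  obtain ⟨β, hβ⟩ : ∃ β, tsupport θ ⊆ Iio β := by
    obtain ⟨β, hβ⟩ := hθ.2.1.isBounded.bddAbove
    exact ⟨β + 1, fun x hx => (hβ hx).trans_lt (by linarith [mem_Iio.1 (show β ∈ Iio (β+1) by simp)])⟩
  have hI : tsupport θ ⊆ Ioo t₁ β := fun x hx => ⟨hθ.2.2 hx, hβ hx⟩
  have hθ' : IsTestFunction (Ioi (0 : ℝ)) θ :=
    ⟨hθ.1, hθ.2.1, hθ.2.2.trans (Ioi_subset_Ioi ht₁.le)⟩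
  have h0 := heq _ (hθ'.prod_mul hψ)
  have hd : ∀ z : ℝ × 𝔼, deriv (fun s => θ s * ψ z.2) z.1 = deriv θ z.1 * ψ z.2 := fun z =>
    deriv_mul_const (hθ.1.differentiable (by simp) _) _
  have hg : ∀ z : ℝ × 𝔼, gradient (fun y => θ z.1 * ψ y) z.2 = θ z.1 • gradient ψ z.2 := fun z => by
    rw [gradient_const_mul_of_differentiable hψ.differentiable]
  simp only [hd, hg, inner_smul_right] at h0
  obtain ⟨i1, i2⟩ := integrable_weak_terms (w := fun τ x => v τ x ^ p) (hw β) (hwM β) (hG β) hψ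
  obtain ⟨C, hC⟩ := hθ.exists_bound
  obtain ⟨D, hD⟩ := hθ.exists_bound_deriv
  have hθc : Continuous fun z : ℝ × 𝔼 => θ z.1 := hθ.1.continuous.comp continuous_fst
  have hθdc : Continuous fun z : ℝ × 𝔼 => deriv θ z.1 :=
    (hθ.1.continuous_deriv (by simp)).comp continuous_fst
  have j1 := i1.bdd_mul hθdc.aestronglyMeasurable (c := D) (Eventually.of_forall fun z => hD z.1)
  have j2 := i2.bdd_mul hθc.aestronglyMeasurable (c := C) (Eventually.of_forall fun z => hC z.1)
  have j3 := (i1.bdd_mul hθc.aestronglyMeasurable (c := C)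
    (Eventually.of_forall fun z => hC z.1)).const_mul c
  have hInt := (j1.sub j2).add j3
  have hz : ∀ τ, τ ∉ Ioo t₁ β → θ τ = 0 ∧ deriv θ τ = 0 := fun τ hτ => by
    have h := eventuallyEq_zero_of_notMem_tsupport (fun h => hτ (hI h))
    exact ⟨h.eq_of_nhds, by rw [h.deriv_eq, deriv_const]⟩
  have hsub : Ioo t₁ β ×ˢ Ω ⊆ Ioi (0 : ℝ) ×ˢ Ω :=
    prod_mono (fun x hx => ht₁.trans hx.1) subset_rfl
  rw [setIntegral_eq_of_subset_of_forall_sdiff_eq_zero (measurableSet_Ioi.prod hΩm) hsub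
    (fun z hz' => by
      have hz1 : z.1 ∉ Ioo t₁ β := fun h => hz'.2 ⟨h, hz'.1.2⟩
      obtain ⟨e1, e2⟩ := hz z.1 hz1
      simp [e1, e2])] at h0
  rw [setIntegral_eq_of_subset_of_forall_sdiff_eq_zero measurableSet_Ioi
    (fun x hx => hx.1 : Ioo t₁ β ⊆ Ioi t₁) (fun τ hτ => by
      obtain ⟨e1, e2⟩ := hz τ hτ.2
      simp [e1, e2])]
  rw [← h0]
  rw [volume_restrict_prod] at i1 i2 hInt ⊢
  rw [integral_prod]
  · refine integral_congr_ae ?_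
    filter_upwards [i1.prod_right_ae, i2.prod_right_ae] with τ k1 k2
    have e : ∀ x, v τ x ^ p * (deriv θ τ * ψ x) - θ τ * inner ℝ (G τ x) (gradient ψ x) +
        c * v τ x ^ p * (θ τ * ψ x) = (deriv θ τ + c * θ τ) * (v τ x ^ p * ψ x) -
          θ τ * inner ℝ (G τ x) (gradient ψ x) := fun x => by ring
    simp only [e]
    rw [integral_sub (k1.const_mul _) (k2.const_mul _), integral_const_mul, integral_const_mul]
    ring
  · refine hInt.congr (Eventually.of_forall fun z => ?_)
    simp only [Pi.add_apply, Pi.sub_apply]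
    ring

/-- `∃ᶠ s → t⁺` in a set of full measure. -/
theorem frequently_nhdsGT_of_ae {P : ℝ → Prop} {t₁ t : ℝ}
    (h : ∀ᵐ s ∂volume.restrict (Ici t₁), P s) (ht : t₁ ≤ t) : ∃ᶠ s in 𝓝[>] t, P s := by
  intro hcon
  obtain ⟨b, hb, hsub⟩ := mem_nhdsGT_iff_exists_Ioo_subset.1 hcon
  have h1 : ∀ᵐ s ∂volume.restrict (Ioo t b), P s :=
    ae_restrict_of_ae_restrict_of_subset (fun x hx => ht.trans hx.1.le) h
  have h2 : ∀ᵐ s ∂volume.restrict (Ioo t b), False := by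
    filter_upwards [h1, ae_restrict_mem measurableSet_Ioo] with s hs hs' using hsub hs' hs
  rw [eventually_false_iff_eq_bot, ae_eq_bot, Measure.restrict_eq_zero, Real.volume_Ioo] at h2
  have : t < b := hb
  simp at h2
  linarith

/-- The relative bound, known for almost every time, holds for every time by `L¹` continuity. -/
theorem ae_abs_sub_le_of_ae_prod [IsFiniteMeasure (volume.restrict Ω)] (hΩm : MeasurableSet Ω)
    {v : ℝ → 𝔼 → ℝ} {V : 𝔼 → ℝ} {p δ t₁ M : ℝ} (hp : 0 < p) (hδ : δ ≤ 1) (hδ0 : 0 ≤ δ)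
    (ht₁ : 0 < t₁)
    (hV0 : ∀ x ∈ Ω, 0 < V x) (hVM : ∀ x ∈ Ω, V x ≤ M)
    (hVm : AEStronglyMeasurable V (volume.restrict Ω))
    (hnn : ∀ t, 0 ≤ t → ∀ᵐ x ∂volume.restrict Ω, 0 ≤ v t x)
    (hint : ∀ t, 0 ≤ t → IntegrableOn (fun x => v t x ^ p) Ω)
    (hcont : ∀ s, 0 ≤ s →
      Tendsto (fun t => ∫ x in Ω, |v t x ^ p - v s x ^ p|) (𝓝[Ici 0] s) (𝓝 0))
    (h : ∀ᵐ z : ℝ × 𝔼 ∂volume.restrict (Ici t₁ ×ˢ Ω), |v z.1 z.2 - V z.2| ≤ δ * V z.2)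
    {t : ℝ} (ht : t₁ ≤ t) : ∀ᵐ x ∂volume.restrict Ω, |v t x - V x| ≤ δ * V x := by
  have ht0 : 0 ≤ t := ht₁.le.trans ht
  rw [volume_restrict_prod] at h
  have h1 := frequently_nhdsGT_of_ae (Measure.ae_ae_of_ae_prod h) ht
  have hVΩ : ∀ᵐ x ∂volume.restrict Ω, 0 < V x ∧ V x ≤ M := by
    filter_upwards [ae_restrict_mem hΩm] with x hx using ⟨hV0 x hx, hVM x hx⟩
  set U : 𝔼 → ℝ := fun x => ((1 + δ) * V x) ^ p with hU
  set L : 𝔼 → ℝ := fun x => ((1 - δ) * V x) ^ p with hL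
  have hpowint : ∀ k : ℝ, 0 ≤ k → Integrable (fun x => (k * V x) ^ p) (volume.restrict Ω) := by
    intro k hk
    refine Integrable.mono' (g := fun _ => (k * M) ^ p) (integrable_const _)
      (((hVm.const_mul k).aemeasurable.pow_const p).aestronglyMeasurable) ?_
    filter_upwards [hVΩ] with x hx
    rw [Real.norm_of_nonneg (Real.rpow_nonneg (mul_nonneg hk hx.1.le) _)]
    exact Real.rpow_le_rpow (mul_nonneg hk hx.1.le) (mul_le_mul_of_nonneg_left hx.2 hk) hp.le
  have hUi := hpowint (1 + δ) (by linarith)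
  have hLi := hpowint (1 - δ) (by linarith)
  -- d measures how far v(t)^p leaves the interval [L, U] allowed by the relative bound. At a good
  -- time s it is at most 2|v(s)^p - v(t)^p|, so L¹ continuity along good times s → t⁺ forces ∫d =
  -- 0.
  set d : 𝔼 → ℝ := fun x => max (v t x ^ p - U x) 0 + max (L x - v t x ^ p) 0 with hd
  have hwi := hint t ht0
  have hdi : Integrable d (volume.restrict Ω) :=
    (hwi.sub hUi).pos_part.add (hLi.sub hwi).pos_part
  have hd0 : ∀ x, 0 ≤ d x := fun x => add_nonneg (le_max_right _ _) (le_max_right _ _)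
  have hle : ∫ x in Ω, d x ≤ 0 := by
    have hlim : Tendsto (fun s => 2 * ∫ x in Ω, |v s x ^ p - v t x ^ p|) (𝓝[>] t) (𝓝 0) := by
      have : 𝓝[>] t ≤ 𝓝[Ici 0] t := nhdsWithin_mono _ fun x hx => ht0.trans (le_of_lt hx)
      simpa using ((hcont t ht0).mono_left this).const_mul 2
    refine ge_of_tendsto_of_frequently hlim ?_
    refine (h1.and_eventually self_mem_nhdsWithin).mono fun s hs => ?_
    obtain ⟨hs, hts⟩ := hs
    have hs0 : 0 ≤ s := ht0.trans (le_of_lt hts)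
    rw [← integral_const_mul]
    refine integral_mono_ae hdi (((hint s hs0).sub hwi).abs.const_mul 2) ?_
    filter_upwards [hs, hVΩ] with x hx hVx
    have e1 : L x ≤ v s x ^ p := Real.rpow_le_rpow (mul_nonneg (by linarith) hVx.1.le)
      (by linarith [(abs_le.1 hx).1]) hp.le
    have hvs : 0 ≤ v s x := by
      nlinarith [(abs_le.1 hx).1, mul_nonneg (show 0 ≤ 1 - δ by linarith) hVx.1.le]
    have e2 : v s x ^ p ≤ U x := Real.rpow_le_rpow hvs (by linarith [(abs_le.1 hx).2]) hp.le
    have e3 := le_abs_self (v s x ^ p - v t x ^ p)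
    have e4 := neg_abs_le (v s x ^ p - v t x ^ p)
    have e5 := abs_nonneg (v s x ^ p - v t x ^ p)
    have e6 : max (v t x ^ p - U x) 0 ≤ |v s x ^ p - v t x ^ p| := max_le (by linarith) e5
    have e7 : max (L x - v t x ^ p) 0 ≤ |v s x ^ p - v t x ^ p| := max_le (by linarith) e5
    simp only [hd]
    linarith
  have hz : d =ᵐ[volume.restrict Ω] 0 :=
    (integral_eq_zero_iff_of_nonneg hd0 hdi).1
      (le_antisymm hle (integral_nonneg hd0))
  filter_upwards [hz, hVΩ, hnn t ht0] with x hx hVx hvx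
  have e1 : max (v t x ^ p - U x) 0 ≤ 0 := by
    have : d x = 0 := hx
    have := le_max_right (L x - v t x ^ p) 0
    simp only [hd] at *
    linarith
  have e2 : max (L x - v t x ^ p) 0 ≤ 0 := by
    have : d x = 0 := hx
    have := le_max_right (v t x ^ p - U x) 0
    simp only [hd] at *
    linarith
  have e3 : v t x ^ p ≤ U x := by linarith [le_max_left (v t x ^ p - U x) 0]
  have e4 : L x ≤ v t x ^ p := by linarith [le_max_left (L x - v t x ^ p) 0]
  have e5 := (Real.rpow_le_rpow_iff hvx (mul_nonneg (by linarith) hVx.1.le) hp).1 e3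
  have e6 := (Real.rpow_le_rpow_iff (mul_nonneg (by linarith) hVx.1.le) hvx hp).1 e4
  rw [abs_le]
  constructor <;> linarith

end SpaceTime

/-! ### Time translates in space-time L². -/

section TimeTranslation

variable {N : ℕ} {H : Type*} [NormedAddCommGroup H] [InnerProductSpace ℝ H]

local notation "𝔼" => EuclideanSpace ℝ (Fin N)

theorem measurePreserving_timeShift (σ : ℝ) :
    MeasurePreserving (fun z : ℝ × 𝔼 => (z.1 - σ, z.2)) volume volume := by
  rw [Measure.volume_eq_prod]
  exact (measurePreserving_sub_right volume σ).prod (MeasurePreserving.id volume)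

/-- Translation in time is continuous in `L²`. -/
theorem continuous_integral_inner_timeShift {u w : ℝ × 𝔼 → H} (hu : MemLp u 2 volume)
    (hw : MemLp w 2 volume) :
    Continuous fun σ : ℝ => ∫ z : ℝ × 𝔼, inner ℝ (u (z.1 - σ, z.2)) (w z) := by
  let g : ℝ → C(ℝ × 𝔼, ℝ × 𝔼) := fun σ => ⟨fun z => (z.1 - σ, z.2), by fun_prop⟩
  have hg : Continuous g := by
    refine ContinuousMap.continuous_of_continuous_uncurry _ ?_
    change Continuous fun q : ℝ × (ℝ × 𝔼) => (q.2.1 - q.1, q.2.2)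
    fun_prop
  have h := (continuous_const (y := hu.toLp u)).compMeasurePreservingLp hg
    (fun σ => measurePreserving_timeShift σ) (by simp)
  have h2 : Continuous fun σ => inner ℝ (Lp.compMeasurePreserving (g σ)
      (measurePreserving_timeShift σ) (hu.toLp u)) (hw.toLp w) := h.inner continuous_const
  refine h2.congr fun σ => ?_
  have e := Lp.toLp_compMeasurePreserving hu (measurePreserving_timeShift σ)
  change inner ℝ (Lp.compMeasurePreserving (fun z : ℝ × 𝔼 => (z.1 - σ, z.2)) _ (hu.toLp u)) _ = _
  rw [e]
  exact (hu.comp_measurePreserving (measurePreserving_timeShift σ)).inner_toLp hw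

/-- The shear (σ, t, x) ↦ (σ, t - σ, x) preserves measure, so both factors are square integrable
over the finite range of σ. -/
theorem integrable_inner_timeShift {u w : ℝ × 𝔼 → H} (hu : MemLp u 2 volume)
    (hw : MemLp w 2 volume) (h : ℝ) :
    Integrable (fun q : ℝ × (ℝ × 𝔼) => inner ℝ (u (q.2.1 - q.1, q.2.2)) (w q.2))
      ((volume.restrict (Ioc 0 h)).prod volume) := by
  have hmp : MeasurePreserving (fun q : ℝ × (ℝ × 𝔼) => (q.1, ((q.2.1 - q.1, q.2.2) : ℝ × 𝔼)))
      ((volume.restrict (Ioc 0 h)).prod volume) ((volume.restrict (Ioc 0 h)).prod volume) :=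
    (MeasurePreserving.id _).skew_product
      (g := fun (σ : ℝ) (z : ℝ × 𝔼) => ((z.1 - σ, z.2) : ℝ × 𝔼))
      (by change Measurable fun q : ℝ × (ℝ × 𝔼) => (q.2.1 - q.1, q.2.2); fun_prop)
      (Eventually.of_forall fun σ => (measurePreserving_timeShift σ).map_eq)
  have h1 := (hu.comp_snd (volume.restrict (Ioc 0 h))).comp_measurePreserving hmp
  exact h1.integrable_inner_two (hw.comp_snd (volume.restrict (Ioc 0 h)))

/-- Averages of time translates. -/
theorem integral_timeShift_eq {u w : ℝ × 𝔼 → H} (hu : MemLp u 2 volume)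
    (hw : MemLp w 2 volume) (h : ℝ) :
    Integrable (fun t : ℝ => ∫ σ in Ioc 0 h, ∫ x : 𝔼, inner ℝ (u (t - σ, x)) (w (t, x))) ∧
    (∀ᵐ t : ℝ, IntegrableOn (fun σ => ∫ x : 𝔼, inner ℝ (u (t - σ, x)) (w (t, x))) (Ioc 0 h)) ∧
    ∫ t : ℝ, ∫ σ in Ioc 0 h, ∫ x : 𝔼, inner ℝ (u (t - σ, x)) (w (t, x)) =
      ∫ σ in Ioc 0 h, ∫ z : ℝ × 𝔼, inner ℝ (u (z.1 - σ, z.2)) (w z) := by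
  have h1 := integrable_inner_timeShift hu hw h
  have h2 : Integrable (fun r : (ℝ × ℝ) × 𝔼 => inner ℝ (u (r.1.2 - r.1.1, r.2)) (w (r.1.2, r.2)))
      (((volume.restrict (Ioc 0 h)).prod volume).prod volume) :=
    (measurePreserving_prodAssoc (volume.restrict (Ioc 0 h)) (volume : Measure ℝ)
      (volume : Measure 𝔼)).integrable_comp_of_integrable h1
  have h3 : Integrable (fun r : ℝ × ℝ => ∫ x : 𝔼, inner ℝ (u (r.2 - r.1, x)) (w (r.2, x)))
      ((volume.restrict (Ioc 0 h)).prod volume) := h2.integral_prod_left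
  refine ⟨h3.integral_prod_right, h3.prod_left_ae, ?_⟩
  have h4 := integral_integral_swap (f := fun (σ t : ℝ) =>
    ∫ x : 𝔼, inner ℝ (u (t - σ, x)) (w (t, x))) h3
  rw [← h4]
  refine integral_congr_ae ?_
  filter_upwards [h1.prod_right_ae] with σ hσ
  rw [Measure.volume_eq_prod] at hσ ⊢
  exact (integral_prod _ hσ).symm

end TimeTranslation

/-- Comparison of right derivatives at `0` of ordered functions that agree at `0`. -/
theorem le_of_hasDerivAt_zero_of_le {u w : ℝ → ℝ} {u' w' h₀ : ℝ} (hh : 0 < h₀)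
    (hu : HasDerivAt u u' 0) (hw : HasDerivAt w w' 0) (hu0 : u 0 = 0) (hw0 : w 0 = 0)
    (h : ∀ s, 0 < s → s < h₀ → u s ≤ w s) : u' ≤ w' := by
  have h1 := hu.tendsto_slope_zero_right
  have h2 := hw.tendsto_slope_zero_right
  refine le_of_tendsto_of_tendsto h1 h2 ?_
  filter_upwards [Ioo_mem_nhdsGT hh] with s hs
  simp only [zero_add, hu0, hw0, sub_zero, smul_eq_mul]
  exact mul_le_mul_of_nonneg_left (h s hs.1 hs.2) (inv_nonneg.2 hs.1.le)

/-! ### Reduction of energy solutions to flows near the stationary state. -/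

section NearbyFlow

variable {N : ℕ} {Ω : Set (EuclideanSpace ℝ (Fin N))}

local notation "𝔼" => EuclideanSpace ℝ (Fin N)

/-- `V` is measurable on `Ω` with `0 < V ≤ M`. -/
structure IsPositiveBounded (Ω : Set 𝔼) (M : ℝ) (V : 𝔼 → ℝ) : Prop where
  measurableSet : MeasurableSet Ω
  pos : ∀ x ∈ Ω, 0 < V x
  le : ∀ x ∈ Ω, V x ≤ M
  meas : AEStronglyMeasurable V (volume.restrict Ω)

/-- A solution `v` of the flow that stays relatively close to the stationary state `V` for times
`t ≥ t₁`; the equation is stated for the perturbation, in time-integrated form, and `F` is the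
gradient of `v - V`. -/
structure IsNearbyFlow (Ω : Set 𝔼) (p c t₁ δ : ℝ) (V : 𝔼 → ℝ) (v : ℝ → 𝔼 → ℝ)
    (F : ℝ → 𝔼 → 𝔼) : Prop where
  meas : ∀ t, t₁ ≤ t → AEStronglyMeasurable (v t) (volume.restrict Ω)
  close : ∀ t, t₁ ≤ t → ∀ᵐ x ∂volume.restrict Ω, |v t x - V x| ≤ δ * V x
  cont : ∀ s, t₁ ≤ s →
    Tendsto (fun t => ∫ x in Ω, |v t x ^ p - v s x ^ p|) (𝓝[Ici t₁] s) (𝓝 0)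
  grad : ∀ᵐ t ∂volume.restrict (Ioi t₁), HasH10Gradient Ω (fun x => v t x - V x) (F t)
  meas_prod : ∀ b, AEStronglyMeasurable (fun z : ℝ × 𝔼 => v z.1 z.2)
    (volume.restrict (Ioo t₁ b ×ˢ Ω))
  close_prod : ∀ b, ∀ᵐ z : ℝ × 𝔼 ∂volume.restrict (Ioo t₁ b ×ˢ Ω),
    |v z.1 z.2 - V z.2| ≤ δ * V z.2
  memLp_grad : ∀ b, MemLp (fun z : ℝ × 𝔼 => F z.1 z.2) 2 (volume.restrict (Ioo t₁ b ×ˢ Ω))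
  weak : ∀ f g, HasH10Gradient Ω f g → ∀ s t, t₁ < s → s ≤ t →
    (∫ x in Ω, (v t x ^ p - V x ^ p) * f x) - ∫ x in Ω, (v s x ^ p - V x ^ p) * f x =
      ∫ τ in s..t, (-(∫ x in Ω, inner ℝ (F τ x) (g x)) +
        c * ∫ x in Ω, (v τ x ^ p - V x ^ p) * f x)

theorem IsPositiveBounded.ae {M : ℝ} {V : 𝔼 → ℝ} (h : IsPositiveBounded Ω M V) :
    ∀ᵐ x ∂volume.restrict Ω, 0 < V x ∧ V x ≤ M := by
  filter_upwards [ae_restrict_mem h.measurableSet] with x hx using ⟨h.pos x hx, h.le x hx⟩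

theorem abs_rpow_le_of_abs_sub_le {p V v M δ : ℝ} (hp : 0 < p) (hδ : δ ≤ 1) (hV : 0 < V)
    (hVM : V ≤ M) (h : |v - V| ≤ δ * V) : |v ^ p| ≤ (2 * M) ^ p := by
  have h1 := abs_le.1 h
  have hv : 0 ≤ v := by nlinarith
  rw [abs_of_nonneg (Real.rpow_nonneg hv _)]
  exact Real.rpow_le_rpow hv (by nlinarith) hp.le

theorem abs_rpow_sub_rpow_le {p V v M δ : ℝ} (hp : 0 < p) (hδ : δ ≤ 1) (hδ0 : 0 ≤ δ) (hV : 0 < V)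
    (hVM : V ≤ M) (h : |v - V| ≤ δ * V) : |v ^ p - V ^ p| ≤ 2 * (2 * M) ^ p := by
  have h1 := abs_rpow_le_of_abs_sub_le hp hδ hV hVM h
  have h2 := abs_rpow_le_of_abs_sub_le hp hδ hV hVM (v := V)
    (by simpa using mul_nonneg hδ0 hV.le)
  exact (abs_sub _ _).trans (by linarith)

theorem intervalIntegrable_slice {t₁ b s t : ℝ} {h : ℝ × 𝔼 → ℝ}
    (hi : Integrable h (volume.restrict (Ioo t₁ b ×ˢ Ω))) (hs : t₁ ≤ s) (hst : s ≤ t)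
    (htb : t ≤ b) : IntervalIntegrable (fun τ => ∫ x in Ω, h (τ, x)) volume s t := by
  rw [intervalIntegrable_iff_integrableOn_Ioo_of_le hst]
  rw [volume_restrict_prod] at hi
  exact hi.integral_prod_left.mono_measure
    (Measure.restrict_mono (Ioo_subset_Ioo hs htb) le_rfl)

/-- A modulus of continuity in terms of the `L¹` distance gives continuity in time. -/
theorem continuousOn_of_L1_modulus {w : ℝ → 𝔼 → ℝ} {t₁ : ℝ} {Φ m : ℝ → ℝ}
    (hw : ∀ s, t₁ ≤ s → Tendsto (fun t => ∫ x in Ω, |w t x - w s x|) (𝓝[Ici t₁] s) (𝓝 0))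
    (hm : Tendsto m (𝓝 0) (𝓝 0))
    (h : ∀ s t, t₁ ≤ s → t₁ ≤ t → |Φ t - Φ s| ≤ m (∫ x in Ω, |w t x - w s x|)) :
    ContinuousOn Φ (Ici t₁) := by
  intro s hs
  refine tendsto_iff_dist_tendsto_zero.2 ?_
  refine squeeze_zero' (Eventually.of_forall fun _ => dist_nonneg) ?_ (hm.comp (hw s hs))
  filter_upwards [self_mem_nhdsWithin] with t ht
  exact h s t hs ht

theorem abs_integral_mul_sub_integral_mul_le {μ : Measure 𝔼} {w₁ w₂ ψ : 𝔼 → ℝ} {C : ℝ}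
    (h₁ : Integrable (fun x => w₁ x * ψ x) μ)
    (h₂ : Integrable (fun x => w₂ x * ψ x) μ) (hd : Integrable (fun x => w₁ x - w₂ x) μ)
    (hψ : ∀ᵐ x ∂μ, |ψ x| ≤ C) :
    |(∫ x, w₁ x * ψ x ∂μ) - ∫ x, w₂ x * ψ x ∂μ| ≤ C * ∫ x, |w₁ x - w₂ x| ∂μ := by
  rw [← integral_sub h₁ h₂, ← integral_const_mul]
  refine (abs_integral_le_integral_abs).trans (integral_mono_ae (h₁.sub h₂).abs
    (hd.abs.const_mul C) ?_)
  filter_upwards [hψ] with x hx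
  rw [← sub_mul, abs_mul, mul_comm]
  exact mul_le_mul_of_nonneg_right hx (abs_nonneg _)

variable [IsFiniteMeasure (volume.restrict Ω)]

theorem memLp_rpow_sub_rpow {p M δ : ℝ} {V v : 𝔼 → ℝ} (hV : IsPositiveBounded Ω M V) (hp : 0 < p)
    (hδ : δ ≤ 1) (hδ0 : 0 ≤ δ) (hv : AEStronglyMeasurable v (volume.restrict Ω))
    (h : ∀ᵐ x ∂volume.restrict Ω, |v x - V x| ≤ δ * V x) (q : ℝ≥0∞) :
    MemLp (fun x => v x ^ p - V x ^ p) q (volume.restrict Ω) := by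
  refine MemLp.of_bound ((hv.aemeasurable.pow_const p).sub
    (hV.meas.aemeasurable.pow_const p)).aestronglyMeasurable (2 * (2 * M) ^ p) ?_
  filter_upwards [h, hV.ae] with x hx hVx
  exact abs_rpow_sub_rpow_le hp hδ hδ0 hVx.1 hVx.2 hx

theorem integral_mul_eq_integral_inner {μ : Measure 𝔼} (u w : 𝔼 → ℝ) :
    ∫ x, u x * w x ∂μ = ∫ x, inner ℝ (u x) (w x) ∂μ :=
  integral_congr_ae (Eventually.of_forall fun x => by simp [mul_comm])

/-- Extension of the time-integrated weak formulation from test functions to `H¹₀(Ω)`. -/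
theorem weak_form_extend {M p c t₁ δ : ℝ} {V : 𝔼 → ℝ} {v : ℝ → 𝔼 → ℝ} {F : ℝ → 𝔼 → 𝔼}
    (hV : IsPositiveBounded Ω M V) (hp : 0 < p) (hδ : δ ≤ 1) (hδ0 : 0 ≤ δ)
    (meas : ∀ t, t₁ ≤ t → AEStronglyMeasurable (v t) (volume.restrict Ω))
    (close : ∀ t, t₁ ≤ t → ∀ᵐ x ∂volume.restrict Ω, |v t x - V x| ≤ δ * V x)
    (meas_prod : ∀ b, AEStronglyMeasurable (fun z : ℝ × 𝔼 => v z.1 z.2)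
      (volume.restrict (Ioo t₁ b ×ˢ Ω)))
    (close_prod : ∀ b, ∀ᵐ z : ℝ × 𝔼 ∂volume.restrict (Ioo t₁ b ×ˢ Ω),
      |v z.1 z.2 - V z.2| ≤ δ * V z.2)
    (grad : ∀ᵐ t ∂volume.restrict (Ioi t₁), MemLp (F t) 2 (volume.restrict Ω))
    (memLp_grad : ∀ b, MemLp (fun z : ℝ × 𝔼 => F z.1 z.2) 2 (volume.restrict (Ioo t₁ b ×ˢ Ω)))
    (weak : ∀ ψ, IsTestFunction Ω ψ → ∀ s t, t₁ < s → s ≤ t →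
      (∫ x in Ω, (v t x ^ p - V x ^ p) * ψ x) - ∫ x in Ω, (v s x ^ p - V x ^ p) * ψ x =
        ∫ τ in s..t, (-(∫ x in Ω, inner ℝ (F τ x) (gradient ψ x)) +
          c * ∫ x in Ω, (v τ x ^ p - V x ^ p) * ψ x))
    {f : 𝔼 → ℝ} {g : 𝔼 → 𝔼} (hf : HasH10Gradient Ω f g) {s t : ℝ} (hs : t₁ < s) (hst : s ≤ t) :
    (∫ x in Ω, (v t x ^ p - V x ^ p) * f x) - ∫ x in Ω, (v s x ^ p - V x ^ p) * f x =
      ∫ τ in s..t, (-(∫ x in Ω, inner ℝ (F τ x) (g x)) +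
        c * ∫ x in Ω, (v τ x ^ p - V x ^ p) * f x) := by
  obtain ⟨hf2, hg2, ψ, hψ, h1, h2⟩ := hf
  have hw2 : ∀ τ, t₁ ≤ τ → MemLp (fun x => v τ x ^ p - V x ^ p) 2 (volume.restrict Ω) :=
    fun τ hτ => memLp_rpow_sub_rpow hV hp hδ hδ0 (meas τ hτ) (close τ hτ) 2
  have hψ2 : ∀ n, MemLp (ψ n) 2 (volume.restrict Ω) := fun n => (hψ n).memLp _
  have hψg2 : ∀ n, MemLp (gradient (ψ n)) 2 (volume.restrict Ω) := fun n => (hψ n).memLp_gradient _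
  have hlimw : ∀ τ, t₁ ≤ τ → Tendsto (fun n => ∫ x in Ω, (v τ x ^ p - V x ^ p) * ψ n x) atTop
      (𝓝 (∫ x in Ω, (v τ x ^ p - V x ^ p) * f x)) := fun τ hτ => by
    simpa only [integral_mul_eq_integral_inner] using tendsto_integral_inner (hw2 τ hτ) hf2 hψ2 h1
  have hL := (hlimw t (hs.le.trans hst)).sub (hlimw s hs.le)
  refine tendsto_nhds_unique hL ?_
  simp only [weak _ (hψ _) s t hs hst]
  obtain ⟨B1, hB1⟩ := exists_bound_integral_sq hf2 hψ2 h1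
  obtain ⟨B2, hB2⟩ := exists_bound_integral_sq hg2 hψg2 h2
  set K := 2 * (2 * M) ^ p
  have hst' : uIoc s t ⊆ Ioi t₁ := by
    rw [uIoc_of_le hst]; exact fun x hx => hs.trans hx.1
  have hwK : ∀ τ, t₁ ≤ τ → ∫ x in Ω, ‖v τ x ^ p - V x ^ p‖ ^ 2 ≤ ∫ x in Ω, K ^ 2 := fun τ hτ => by
    refine integral_mono_ae ((hw2 τ hτ).integrable_norm_pow (by simp)) (integrable_const _) ?_
    filter_upwards [close τ hτ, hV.ae] with x hx hVx
    exact pow_le_pow_left₀ (norm_nonneg _) (abs_rpow_sub_rpow_le hp hδ hδ0 hVx.1 hVx.2 hx) 2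
  have hsq : IntervalIntegrable (fun τ => ∫ x in Ω, ‖F τ x‖ ^ 2) volume s t :=
    intervalIntegrable_slice ((memLp_grad t).integrable_norm_pow (by simp)) hs.le hst le_rfl
  have hmw : AEStronglyMeasurable (fun z : ℝ × 𝔼 => v z.1 z.2 ^ p - V z.2 ^ p)
      (volume.restrict (Ioo t₁ t ×ˢ Ω)) := by
    refine ((meas_prod t).aemeasurable.pow_const p).aestronglyMeasurable.sub ?_
    rw [volume_restrict_prod]
    exact (hV.meas.comp_snd (μ := volume.restrict (Ioo t₁ t))).aemeasurable.pow_const p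
      |>.aestronglyMeasurable
  have hmK : ∀ᵐ z : ℝ × 𝔼 ∂volume.restrict (Ioo t₁ t ×ˢ Ω), |v z.1 z.2 ^ p - V z.2 ^ p| ≤ K := by
    have : ∀ᵐ z : ℝ × 𝔼 ∂volume.restrict (Ioo t₁ t ×ˢ Ω), z.2 ∈ Ω := by
      filter_upwards [ae_restrict_mem (measurableSet_Ioo.prod hV.measurableSet)] with z hz using hz.2
    filter_upwards [close_prod t, this] with z hz hzΩ
    exact abs_rpow_sub_rpow_le hp hδ hδ0 (hV.pos _ hzΩ) (hV.le _ hzΩ) hz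
  have hterms : ∀ n, IntervalIntegrable (fun τ => (-(∫ x in Ω, inner ℝ (F τ x) (gradient (ψ n) x)) +
          c * ∫ x in Ω, (v τ x ^ p - V x ^ p) * ψ n x)) volume s t := fun n => by
    obtain ⟨i1, i2⟩ := integrable_weak_terms (w := fun τ x => v τ x ^ p - V x ^ p) hmw hmK
      (memLp_grad t) (hψ n)
    exact (intervalIntegrable_slice i2 hs.le hst le_rfl).neg.add
      ((intervalIntegrable_slice i1 hs.le hst le_rfl).const_mul c)
  -- The slice integrals are dominated by ‖F(τ)‖² in L²(Ω), which is integrable in τ, plus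
  -- constants, because the approximating test functions and their gradients are bounded in L².
  refine intervalIntegral.tendsto_integral_filter_of_dominated_convergence
    (fun τ => ((∫ x in Ω, ‖F τ x‖ ^ 2) + B2) + |c| * ((∫ x in Ω, K ^ 2) + B1)) ?_ ?_ ?_ ?_
  · exact Eventually.of_forall fun n => (hterms n).def'.aestronglyMeasurable
  · refine Eventually.of_forall fun n => ?_
    filter_upwards [(ae_restrict_iff' measurableSet_Ioi).1 grad] with τ hF hτ
    have hτ' : t₁ < τ := hst' hτ
    refine (norm_add_le _ _).trans (add_le_add ?_ ?_)
    · rw [norm_neg, Real.norm_eq_abs]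
      exact ((hF hτ').abs_integral_inner_le (hψg2 n)).trans (by linarith [hB2 n])
    · rw [norm_mul, integral_mul_eq_integral_inner]
      refine mul_le_mul_of_nonneg_left ?_ (norm_nonneg _)
      exact ((hw2 τ hτ'.le).abs_integral_inner_le (hψ2 n)).trans
        (add_le_add (hwK τ hτ'.le) (hB1 n))
  · exact (hsq.add intervalIntegrable_const).add intervalIntegrable_const
  · filter_upwards [(ae_restrict_iff' measurableSet_Ioi).1 grad] with τ hF hτ
    have hτ' : t₁ < τ := hst' hτ
    exact (tendsto_integral_inner (hF hτ') hg2 hψg2 h2).neg.add ((hlimw τ hτ'.le).const_mul c)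

/-- An energy solution satisfying the relative bound is a nearby flow. -/
theorem FastDiffusion.IsRCDPSolution.exists_isNearbyFlow {M p c δ : ℝ} {V u₀ : 𝔼 → ℝ}
    {v : ℝ → 𝔼 → ℝ} (hV : IsPositiveBounded Ω M V)
    (hsol : SolvesDirichlet Ω (fun x => c * V x ^ p) V) (hp : 0 < p) (hδ : δ ≤ 1) (hδ0 : 0 ≤ δ)
    (hv : IsRCDPSolution Ω p c u₀ v) (h1 : H1prime Ω V δ v) :
    ∃ t₁ F, IsNearbyFlow Ω p c t₁ δ V v F := by
  obtain ⟨t₁, ht₁, hclose⟩ := h1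
  obtain ⟨gV, hgV, hVsol⟩ := hsol
  obtain ⟨G, hG, hmem, heq⟩ := hv.equation
  have close : ∀ t, t₁ ≤ t → ∀ᵐ x ∂volume.restrict Ω, |v t x - V x| ≤ δ * V x := fun t ht =>
    ae_abs_sub_le_of_ae_prod hV.measurableSet hp hδ hδ0 ht₁ hV.pos hV.le hV.meas hv.nonneg
      hv.integrable hv.continuous hclose ht
  -- At an individual time only v^p is known to be measurable; nonnegativity allows taking the p-th
  -- root.
  have meas : ∀ t, t₁ ≤ t → AEStronglyMeasurable (v t) (volume.restrict Ω) := fun t ht => by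
    have h2 := (((hv.integrable t (ht₁.le.trans ht)).aestronglyMeasurable.aemeasurable).pow_const
      p⁻¹).aestronglyMeasurable
    refine h2.congr ?_
    filter_upwards [hv.nonneg t (ht₁.le.trans ht)] with x hx
    exact Real.rpow_rpow_inv hx hp.ne'
  have cont : ∀ s, t₁ ≤ s →
      Tendsto (fun t => ∫ x in Ω, |v t x ^ p - v s x ^ p|) (𝓝[Ici t₁] s) (𝓝 0) := fun s hs =>
    (hv.continuous s (ht₁.le.trans hs)).mono_left (nhdsWithin_mono _ (Ici_subset_Ici.2 ht₁.le))
  have grad : ∀ᵐ t ∂volume.restrict (Ioi t₁),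
      HasH10Gradient Ω (fun x => v t x - V x) (fun x => G t x - gV x) := by
    filter_upwards [ae_restrict_of_ae_restrict_of_subset (Ioi_subset_Ioi ht₁.le) hG] with t ht
    exact ht.sub hgV
  have hmem' : ∀ b, MemLp (fun z : ℝ × 𝔼 => v z.1 z.2) 2 (volume.restrict (Ioo t₁ b ×ˢ Ω)) ∧
      MemLp (fun z : ℝ × 𝔼 => G z.1 z.2) 2 (volume.restrict (Ioo t₁ b ×ˢ Ω)) := fun b => by
    by_cases hb : t₁ < b
    · exact hmem t₁ b ht₁ hb
    · rw [Ioo_eq_empty hb]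
      simp
  have meas_prod := fun b => (hmem' b).1.aestronglyMeasurable
  have close_prod : ∀ b, ∀ᵐ z : ℝ × 𝔼 ∂volume.restrict (Ioo t₁ b ×ˢ Ω),
      |v z.1 z.2 - V z.2| ≤ δ * V z.2 := fun b =>
    ae_restrict_of_ae_restrict_of_subset (prod_mono (fun x hx => hx.1.le) subset_rfl) hclose
  have memLp_grad : ∀ b, MemLp (fun z : ℝ × 𝔼 => G z.1 z.2 - gV z.2) 2
      (volume.restrict (Ioo t₁ b ×ˢ Ω)) := fun b => by
    refine (hmem' b).2.sub ?_
    rw [volume_restrict_prod]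
    exact hgV.2.1.comp_snd _
  have hK : ∀ b, ∀ᵐ z : ℝ × 𝔼 ∂volume.restrict (Ioo t₁ b ×ˢ Ω), |v z.1 z.2 ^ p| ≤ (2 * M) ^ p :=
    fun b => by
      have : ∀ᵐ z : ℝ × 𝔼 ∂volume.restrict (Ioo t₁ b ×ˢ Ω), z.2 ∈ Ω := by
        filter_upwards [ae_restrict_mem (measurableSet_Ioo.prod hV.measurableSet)] with z hz
          using hz.2
      filter_upwards [close_prod b, this] with z hz hzΩ
      exact abs_rpow_le_of_abs_sub_le hp hδ (hV.pos _ hzΩ) (hV.le _ hzΩ) hz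
  have hVp2 : MemLp (fun x => V x ^ p) 2 (volume.restrict Ω) := by
    refine MemLp.of_bound (hV.meas.aemeasurable.pow_const p).aestronglyMeasurable ((2 * M) ^ p) ?_
    filter_upwards [hV.ae] with x hx
    exact abs_rpow_le_of_abs_sub_le hp hδ hx.1 hx.2 (by simpa using mul_nonneg hδ0 hx.1.le)
  have hw2 : ∀ τ, t₁ ≤ τ → MemLp (fun x => v τ x ^ p) 2 (volume.restrict Ω) := fun τ hτ => by
    exact ((memLp_rpow_sub_rpow hV hp hδ hδ0 (meas τ hτ) (close τ hτ) 2).add hVp2).ae_eq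
      (Eventually.of_forall fun x => by simp)
  refine ⟨t₁, fun t x => G t x - gV x, meas, close, cont, grad, meas_prod, close_prod, memLp_grad,
    fun f g hfg s t hs hst => weak_form_extend hV hp hδ hδ0 meas close meas_prod close_prod
      (grad.mono fun t ht => ht.2.1) memLp_grad (fun ψ hψ s t hs hst => ?_) hfg hs hst⟩
  have hψ2 : MemLp ψ 2 (volume.restrict Ω) := hψ.memLp _
  have hψg2 : MemLp (gradient ψ) 2 (volume.restrict Ω) := hψ.memLp_gradient _
  have hwm := fun b => ((meas_prod b).aemeasurable.pow_const p).aestronglyMeasurable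
  have hac : ContinuousOn (fun τ => ∫ x in Ω, v τ x ^ p * ψ x) (Ici t₁) := by
    obtain ⟨C, hC⟩ := hψ.exists_bound
    refine continuousOn_of_L1_modulus (m := fun y => C * y) cont
      (by simpa using (continuous_const_mul C).tendsto 0) fun s t hs ht => ?_
    exact abs_integral_mul_sub_integral_mul_le ((hw2 t ht).integrable_mul hψ2)
      ((hw2 s hs).integrable_mul hψ2) (((hw2 t ht).sub (hw2 s hs)).integrable (by norm_num))
      (Eventually.of_forall hC)
  have hbi : ∀ s t, t₁ < s → s ≤ t → IntervalIntegrable (fun τ =>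
      (-(∫ x in Ω, inner ℝ (G τ x) (gradient ψ x)) + c * ∫ x in Ω, v τ x ^ p * ψ x))
      volume s t := fun s t hs hst => by
    obtain ⟨i1, i2⟩ := integrable_weak_terms (w := fun τ x => v τ x ^ p) (hwm t) (hK t)
      (hmem' t).2 hψ
    exact (intervalIntegrable_slice i2 hs.le hst le_rfl).neg.add
      ((intervalIntegrable_slice i1 hs.le hst le_rfl).const_mul c)
  have hkey := sub_eq_integral_of_weak (hac.mono Ioi_subset_Ici_self) hbi
    (fun θ hθ => weak_form_product ht₁ hwm hK (fun b => (hmem' b).2) heq hV.measurableSet hψ hθ)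
    hs hst
  have hsplit : ∀ τ, t₁ ≤ τ → ∫ x in Ω, (v τ x ^ p - V x ^ p) * ψ x =
      (∫ x in Ω, v τ x ^ p * ψ x) - ∫ x in Ω, V x ^ p * ψ x := fun τ hτ => by
    simp only [sub_mul]
    exact integral_sub ((hw2 τ hτ).integrable_mul hψ2) (hVp2.integrable_mul hψ2)
  -- Subtracting the equation of V: its terms are constant in time and cancel under the time
  -- integral.
  rw [hsplit t (hs.le.trans hst), hsplit s hs.le, sub_sub_sub_cancel_right, hkey]
  refine intervalIntegral.integral_congr_ae ?_
  filter_upwards [(ae_restrict_iff' measurableSet_Ioi).1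
    (ae_restrict_of_ae_restrict_of_subset (Ioi_subset_Ioi ht₁.le) hG)] with τ hG hτ
  rw [uIoc_of_le hst] at hτ
  have hτ' : t₁ < τ := hs.trans hτ.1
  rw [hsplit τ hτ'.le]
  simp only [inner_sub_left]
  rw [integral_sub ((hG hτ').2.1.integrable_inner_two hψg2) (hgV.2.1.integrable_inner_two hψg2),
    hVsol ψ hψ]
  simp only [mul_assoc, integral_const_mul]
  ring

end NearbyFlow

/-! ### Estimates at a fixed time. -/

section Slices

variable {N : ℕ} {Ω : Set (EuclideanSpace ℝ (Fin N))}

local notation "𝔼" => EuclideanSpace ℝ (Fin N)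

theorem abs_sub_le_half {V v δ : ℝ} (hV : 0 < V) (hδ : δ ≤ 1 / 2) (h : |v - V| ≤ δ * V) :
    |v - V| ≤ V / 2 := by nlinarith

variable {M p C : ℝ} {V : EuclideanSpace ℝ (Fin N) → ℝ} (hV : IsPositiveBounded Ω M V)

include hV

theorem IsPositiveBounded.ae_weight (hp : 1 < p) :
    ∀ᵐ x ∂volume.restrict Ω, 0 < V x ^ (p - 1) ∧ V x ^ (p - 1) ≤ M ^ (p - 1) := by
  filter_upwards [hV.ae] with x hx
  exact ⟨Real.rpow_pos_of_pos hx.1 _, Real.rpow_le_rpow hx.1.le hx.2 (by linarith)⟩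

theorem IsPositiveBounded.weight_meas :
    AEStronglyMeasurable (fun x => V x ^ (p - 1)) (volume.restrict Ω) :=
  (hV.meas.aemeasurable.pow_const _).aestronglyMeasurable

theorem IsPositiveBounded.memLp_weight_mul (hp : 1 < p) {φ : 𝔼 → ℝ}
    (hφ : MemLp φ 2 (volume.restrict Ω)) :
    MemLp (fun x => V x ^ (p - 1) * φ x) 2 (volume.restrict Ω) := by
  refine (hφ.const_mul (M ^ (p - 1))).of_le (hV.weight_meas.mul hφ.aestronglyMeasurable) ?_
  filter_upwards [hV.ae_weight hp] with x hx
  rw [norm_mul, norm_mul, Real.norm_of_nonneg hx.1.le, Real.norm_of_nonneg (hx.1.le.trans hx.2)]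
  exact mul_le_mul_of_nonneg_right hx.2 (norm_nonneg _)

/-- Splitting the weight evenly between two factors reduces the weighted Cauchy–Schwarz inequality
to the unweighted one. -/
theorem IsPositiveBounded.memLp_sqrt_weight_mul (hp : 1 < p) {φ : 𝔼 → ℝ}
    (hφ : MemLp φ 2 (volume.restrict Ω)) :
    MemLp (fun x => √(V x ^ (p - 1)) * φ x) 2 (volume.restrict Ω) := by
  refine (hφ.const_mul (√(M ^ (p - 1)))).of_le
    ((hV.weight_meas.aemeasurable.sqrt.aestronglyMeasurable).mul hφ.aestronglyMeasurable) ?_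
  filter_upwards [hV.ae_weight hp] with x hx
  rw [norm_mul, norm_mul, Real.norm_of_nonneg (Real.sqrt_nonneg _),
    Real.norm_of_nonneg (Real.sqrt_nonneg _)]
  exact mul_le_mul_of_nonneg_right (Real.sqrt_le_sqrt hx.2) (norm_nonneg _)

/-- Weighted Cauchy–Schwarz inequality. -/
theorem IsPositiveBounded.sq_integral_le (hp : 1 < p) {f φ h : 𝔼 → ℝ} {k : ℝ}
    (hf : MemLp f 2 (volume.restrict Ω)) (hφ : MemLp φ 2 (volume.restrict Ω))
    (hh : ∀ᵐ x ∂volume.restrict Ω, |h x| ≤ k * (V x ^ (p - 1) * |f x|)) :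
    (∫ x in Ω, h x * φ x) ^ 2 ≤
      k ^ 2 * (∫ x in Ω, V x ^ (p - 1) * f x ^ 2) * ∫ x in Ω, V x ^ (p - 1) * φ x ^ 2 := by
  have h1 := hV.memLp_sqrt_weight_mul hp hf.norm
  have h2 := hV.memLp_sqrt_weight_mul hp hφ.norm
  have hcs := h1.sq_integral_inner_le h2
  have hsq : ∀ ψ : 𝔼 → ℝ, ∫ x in Ω, ‖√(V x ^ (p - 1)) * ‖ψ x‖‖ ^ 2 =
      ∫ x in Ω, V x ^ (p - 1) * ψ x ^ 2 := fun ψ => by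
    refine integral_congr_ae ?_
    filter_upwards [hV.ae_weight hp] with x hx
    rw [Real.norm_eq_abs, sq_abs, mul_pow, Real.sq_sqrt hx.1.le, Real.norm_eq_abs, sq_abs]
  rw [hsq, hsq] at hcs
  have hle : |∫ x in Ω, h x * φ x| ≤
      k * ∫ x in Ω, inner ℝ (√(V x ^ (p - 1)) * ‖f x‖) (√(V x ^ (p - 1)) * ‖φ x‖) := by
    rw [← integral_const_mul]
    refine abs_integral_le_integral_abs.trans (integral_mono_of_nonneg
      (Eventually.of_forall fun _ => abs_nonneg _) ((h1.integrable_inner_two h2).const_mul k) ?_)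
    filter_upwards [hh, hV.ae_weight hp] with x hx hVx
    simp only [abs_mul, RCLike.inner_apply, conj_trivial, Real.norm_eq_abs]
    have : k * (√(V x ^ (p - 1)) * |φ x| * (√(V x ^ (p - 1)) * |f x|)) =
        k * (√(V x ^ (p - 1)) * √(V x ^ (p - 1)) * |f x|) * |φ x| := by ring
    rw [this, Real.mul_self_sqrt hVx.1.le]
    exact mul_le_mul_of_nonneg_right hx (abs_nonneg _)
  calc (∫ x in Ω, h x * φ x) ^ 2 = |∫ x in Ω, h x * φ x| ^ 2 := (sq_abs _).symm
    _ ≤ (k * ∫ x in Ω, inner ℝ (√(V x ^ (p - 1)) * ‖f x‖) (√(V x ^ (p - 1)) * ‖φ x‖)) ^ 2 :=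
      pow_le_pow_left₀ (abs_nonneg _) hle 2
    _ ≤ _ := by
      rw [mul_pow, mul_assoc]
      exact mul_le_mul_of_nonneg_left hcs (sq_nonneg _)

theorem IsPositiveBounded.integrable_weight_mul_sq (hp : 1 < p) {f : 𝔼 → ℝ}
    (hf : MemLp f 2 (volume.restrict Ω)) :
    Integrable (fun x => V x ^ (p - 1) * f x ^ 2) (volume.restrict Ω) := by
  refine ((hV.memLp_weight_mul hp hf).integrable_mul hf).congr (Eventually.of_forall fun x => ?_)
  simp only [Pi.mul_apply]; ring

variable [IsFiniteMeasure (volume.restrict Ω)]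

theorem IsPositiveBounded.memLp_sub {u : 𝔼 → ℝ} {δ : ℝ} (hδ : δ ≤ 1)
    (hu : AEStronglyMeasurable u (volume.restrict Ω))
    (hc : ∀ᵐ x ∂volume.restrict Ω, |u x - V x| ≤ δ * V x) :
    MemLp (fun x => u x - V x) 2 (volume.restrict Ω) := by
  refine MemLp.of_bound (hu.sub hV.meas) M ?_
  filter_upwards [hc, hV.ae] with x hx hVx
  rw [Real.norm_eq_abs]
  nlinarith

/-- Entropy and weighted `L²` distance are comparable. -/
theorem IsPositiveBounded.entropy_bounds (hp : 1 < p) (hC : IsComparisonConstant p C)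
    {u : 𝔼 → ℝ} {δ : ℝ} (hδ : δ ≤ 1 / 2)
    (hu : AEStronglyMeasurable u (volume.restrict Ω))
    (hc : ∀ᵐ x ∂volume.restrict Ω, |u x - V x| ≤ δ * V x) :
    Integrable (fun x => (u x ^ (p + 1) - V x ^ (p + 1)) -
      (p + 1) / p * (u x ^ p - V x ^ p) * V x) (volume.restrict Ω) ∧
    (∫ x in Ω, V x ^ (p - 1) * (u x - V x) ^ 2) ≤ C * entropy Ω p V u ∧
    entropy Ω p V u ≤ C * ∫ x in Ω, V x ^ (p - 1) * (u x - V x) ^ 2 := by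
  have hf := hV.memLp_sub (by linarith) hu hc
  have hY := hV.integrable_weight_mul_sq hp hf
  have hC0 : 0 < C := by linarith [hC.1]
  have hpt : ∀ᵐ x ∂volume.restrict Ω,
      V x ^ (p - 1) * (u x - V x) ^ 2 ≤ C * ((u x ^ (p + 1) - V x ^ (p + 1)) -
      (p + 1) / p * (u x ^ p - V x ^ p) * V x) ∧ (u x ^ (p + 1) - V x ^ (p + 1)) -
      (p + 1) / p * (u x ^ p - V x ^ p) * V x ≤ C * (V x ^ (p - 1) * (u x - V x) ^ 2) := by
    filter_upwards [hc, hV.ae] with x hx hVx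
    have h1 := abs_sub_le_half hVx.1 hδ hx
    obtain ⟨-, h2, h3, -⟩ := hC.2 (V x) (u x) (u x) hVx.1 h1 h1
    exact ⟨h2, h3⟩
  have hint : Integrable (fun x => (u x ^ (p + 1) - V x ^ (p + 1)) -
      (p + 1) / p * (u x ^ p - V x ^ p) * V x) (volume.restrict Ω) := by
    refine (hY.const_mul C).mono' ?_ ?_
    · have hum := fun q : ℝ => (hu.aemeasurable.pow_const q).aestronglyMeasurable
      have hVm := fun q : ℝ => (hV.meas.aemeasurable.pow_const q).aestronglyMeasurable
      exact ((hum _).sub (hVm _)).sub ((((hum p).sub (hVm p)).const_mul _).mul hV.meas)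
    · filter_upwards [hpt, hV.ae_weight hp] with x hx hW
      rw [Real.norm_of_nonneg]
      · exact hx.2
      · by_contra hneg
        push Not at hneg
        have := mul_neg_of_pos_of_neg hC0 hneg
        have := mul_nonneg hW.1.le (sq_nonneg (u x - V x))
        linarith [hx.1]
  refine ⟨hint, ?_, ?_⟩
  · rw [entropy, ← integral_const_mul]
    exact integral_mono_ae hY (hint.const_mul C) (hpt.mono fun x hx => hx.1)
  · rw [entropy, ← integral_const_mul]
    exact integral_mono_ae hint (hY.const_mul C) (hpt.mono fun x hx => hx.2)

theorem IsPositiveBounded.entropy_nonneg (hp : 1 < p) (hC : IsComparisonConstant p C)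
    {u : 𝔼 → ℝ} {δ : ℝ} (hδ : δ ≤ 1 / 2)
    (hu : AEStronglyMeasurable u (volume.restrict Ω))
    (hc : ∀ᵐ x ∂volume.restrict Ω, |u x - V x| ≤ δ * V x) : 0 ≤ entropy Ω p V u := by
  have h1 := (hV.entropy_bounds hp hC hδ hu hc).2.1
  have h2 : 0 ≤ ∫ x in Ω, V x ^ (p - 1) * (u x - V x) ^ 2 :=
    integral_nonneg_of_ae ((hV.ae_weight hp).mono fun x hx => mul_nonneg hx.1.le (sq_nonneg _))
  have hC0 : 0 < C := by linarith [hC.1]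
  exact nonneg_of_mul_nonneg_right (h2.trans h1) hC0

/-- Linearization error of the modes. -/
theorem IsPositiveBounded.sq_mode_sub_le (hp : 1 < p) (hC : IsComparisonConstant p C)
    {u φ : 𝔼 → ℝ} {δ ε : ℝ} (hδ : δ ≤ 1 / 2) (hδ0 : 0 ≤ δ)
    (hu : AEStronglyMeasurable u (volume.restrict Ω))
    (hc : ∀ᵐ x ∂volume.restrict Ω, |u x - V x| ≤ δ * V x)
    (hc' : ∀ᵐ x ∂volume.restrict Ω, |u x - V x| ≤ ε * V x)
    (hφ : MemLp φ 2 (volume.restrict Ω)) :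
    ((∫ x in Ω, (u x ^ p - V x ^ p) * φ x) -
      p * ∫ x in Ω, V x ^ (p - 1) * (u x - V x) * φ x) ^ 2 ≤
      (C ^ 3 * ∫ x in Ω, V x ^ (p - 1) * φ x ^ 2) * ε ^ 2 * entropy Ω p V u := by
  have hC0 : 0 < C := by linarith [hC.1]
  have hf := hV.memLp_sub (by linarith) hu hc
  have hw := memLp_rpow_sub_rpow hV (by linarith : 0 < p) (by linarith) hδ0 hu hc 2
  have h1 := hV.sq_integral_le hp (h := fun x => u x ^ p - V x ^ p - p * V x ^ (p - 1) * (u x - V x))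
    (k := C * ε) hf hφ (by
      filter_upwards [hc, hc', hV.ae] with x hx hx' hVx
      have h1 := abs_sub_le_half hVx.1 hδ hx
      exact (hC.2 (V x) (u x) (u x) hVx.1 h1 h1).1 ε hx')
  have h2 := (hV.entropy_bounds hp hC hδ hu hc).2.1
  have e : ∫ x in Ω, (u x ^ p - V x ^ p - p * V x ^ (p - 1) * (u x - V x)) * φ x =
      (∫ x in Ω, (u x ^ p - V x ^ p) * φ x) -
      p * ∫ x in Ω, V x ^ (p - 1) * (u x - V x) * φ x := by
    have k1 : Integrable (fun x => (u x ^ p - V x ^ p) * φ x) (volume.restrict Ω) :=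
      hw.integrable_mul hφ
    have k2 : Integrable (fun x => p * (V x ^ (p - 1) * (u x - V x) * φ x)) (volume.restrict Ω) :=
      ((hV.memLp_weight_mul hp hf).integrable_mul hφ).const_mul p
    rw [← integral_const_mul, ← integral_sub k1 k2]
    exact integral_congr_ae (Eventually.of_forall fun x => by ring)
  rw [e] at h1
  have h3 : 0 ≤ ∫ x in Ω, V x ^ (p - 1) * φ x ^ 2 :=
    integral_nonneg_of_ae ((hV.ae_weight hp).mono fun x hx => mul_nonneg hx.1.le (sq_nonneg _))
  -- Of the power C³, two factors come from squaring the linearization error Cε and one from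
  -- bounding the weighted L² distance by C times the entropy.
  refine h1.trans ?_
  calc _ ≤ (C * ε) ^ 2 * (C * entropy Ω p V u) * ∫ x in Ω, V x ^ (p - 1) * φ x ^ 2 := by gcongr
    _ = _ := by ring

/-- Linearization error of the zeroth order term of the energy identity. -/
theorem IsPositiveBounded.integral_rpow_sub_mul_le (hp : 1 < p) (hC : IsComparisonConstant p C)
    {u : 𝔼 → ℝ} {δ : ℝ} (hδ : δ ≤ 1 / 2) (hδ0 : 0 ≤ δ)
    (hu : AEStronglyMeasurable u (volume.restrict Ω))
    (hc : ∀ᵐ x ∂volume.restrict Ω, |u x - V x| ≤ δ * V x) :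
    ∫ x in Ω, (u x ^ p - V x ^ p) * (u x - V x) ≤
      (p + C * δ) * ∫ x in Ω, V x ^ (p - 1) * (u x - V x) ^ 2 := by
  have hf := hV.memLp_sub (by linarith) hu hc
  have hw := memLp_rpow_sub_rpow hV (by linarith : 0 < p) (by linarith) hδ0 hu hc 2
  rw [← integral_const_mul]
  refine integral_mono_ae (hw.integrable_mul hf)
    ((hV.integrable_weight_mul_sq hp hf).const_mul _) ?_
  filter_upwards [hc, hV.ae] with x hx hVx
  have h1 := abs_sub_le_half hVx.1 hδ hx
  have h2 := (hC.2 (V x) (u x) (u x) hVx.1 h1 h1).1 δ hx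
  have h3 := mul_le_mul_of_nonneg_right h2 (abs_nonneg (u x - V x))
  rw [← abs_mul] at h3
  have h4 := (abs_le.1 h3).2
  have h5 := sq_abs (u x - V x)
  have e1 : C * δ * (V x ^ (p - 1) * |u x - V x|) * |u x - V x| =
    C * δ * (V x ^ (p - 1) * (u x - V x) ^ 2) := by rw [← h5]; ring
  rw [e1] at h4
  linarith

end Slices

/-! ### Continuity and evolution of the modes. -/

section Modes

variable {N : ℕ} {Ω : Set (EuclideanSpace ℝ (Fin N))}

local notation "𝔼" => EuclideanSpace ℝ (Fin N)

theorem MeasureTheory.MemLp.integral_mul_sub_integral_mul {μ : Measure 𝔼} {u w φ : 𝔼 → ℝ}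
    (hu : MemLp u 2 μ) (hw : MemLp w 2 μ) (hφ : MemLp φ 2 μ) :
    (∫ x, u x * φ x ∂μ) - ∫ x, w x * φ x ∂μ = ∫ x, (u x - w x) * φ x ∂μ := by
  simp only [sub_mul]
  exact (integral_sub (hu.integrable_mul hφ) (hw.integrable_mul hφ)).symm

/-- φ is only in L², while the flow is continuous in L¹. Boundedness of d bridges the two: |h| ≤
k|d| and |d| ≤ B give ∫h² ≤ k²B∫|d|, and Cauchy–Schwarz applies. -/
theorem abs_integral_mul_le_sqrt {μ : Measure 𝔼} [IsFiniteMeasure μ] {h d φ : 𝔼 → ℝ} {k B : ℝ}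
    (hm : AEStronglyMeasurable h μ) (hk : 0 ≤ k) (hd : Integrable d μ)
    (hh : ∀ᵐ x ∂μ, |h x| ≤ k * |d x|) (hdB : ∀ᵐ x ∂μ, |d x| ≤ B) (hφ : MemLp φ 2 μ) :
    |∫ x, h x * φ x ∂μ| ≤ √(k ^ 2 * B * (∫ x, |d x| ∂μ) * ∫ x, φ x ^ 2 ∂μ) := by
  have hh2 : MemLp h 2 μ := by
    refine MemLp.of_bound hm (k * B) ?_
    filter_upwards [hh, hdB] with x h1 h2
    exact h1.trans (mul_le_mul_of_nonneg_left h2 hk)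
  refine Real.abs_le_sqrt ?_
  have h1 := hh2.sq_integral_inner_le hφ
  rw [← integral_mul_eq_integral_inner] at h1
  simp only [Real.norm_eq_abs, sq_abs] at h1
  refine h1.trans (mul_le_mul_of_nonneg_right ?_ (integral_nonneg fun x => sq_nonneg _))
  rw [← integral_const_mul]
  refine integral_mono_ae hh2.integrable_sq (hd.abs.const_mul _) ?_
  filter_upwards [hh, hdB] with x h1 h2
  rw [← sq_abs]
  calc |h x| ^ 2 ≤ (k * |d x|) ^ 2 := pow_le_pow_left₀ (abs_nonneg _) h1 2
    _ = k ^ 2 * |d x| * |d x| := by ring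
    _ ≤ k ^ 2 * B * |d x| := by gcongr

variable {M p C c t₁ δ : ℝ}
  {V : EuclideanSpace ℝ (Fin N) → ℝ} {v : ℝ → EuclideanSpace ℝ (Fin N) → ℝ}
  {F : ℝ → EuclideanSpace ℝ (Fin N) → EuclideanSpace ℝ (Fin N)}

theorem IsNearbyFlow.ae_rpow_sub_le (hV : IsPositiveBounded Ω M V)
    (h : IsNearbyFlow Ω p c t₁ δ V v F) (hp : 1 < p) (hδ : δ ≤ 1 / 2)
    {s t : ℝ} (hs : t₁ ≤ s) (ht : t₁ ≤ t) :
    ∀ᵐ x ∂volume.restrict Ω, |v t x ^ p - v s x ^ p| ≤ 2 * |(2 * M) ^ p| := by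
  filter_upwards [h.close t ht, h.close s hs, hV.ae] with x h1 h2 hx
  have e1 := abs_rpow_le_of_abs_sub_le (by linarith : 0 < p) (by linarith) hx.1 hx.2 h1
  have e2 := abs_rpow_le_of_abs_sub_le (by linarith : 0 < p) (by linarith) hx.1 hx.2 h2
  have e3 := le_abs_self ((2 * M) ^ p)
  exact (abs_sub _ _).trans (by linarith)

variable [IsFiniteMeasure (volume.restrict Ω)]

theorem IsNearbyFlow.memLp_rpow (hV : IsPositiveBounded Ω M V)
    (h : IsNearbyFlow Ω p c t₁ δ V v F) (hp : 1 < p) (hδ : δ ≤ 1 / 2) (hδ0 : 0 ≤ δ)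
    {t : ℝ} (ht : t₁ ≤ t) : MemLp (fun x => v t x ^ p - V x ^ p) 2 (volume.restrict Ω) :=
  memLp_rpow_sub_rpow hV (by linarith) (by linarith) hδ0 (h.meas t ht) (h.close t ht) 2

theorem IsNearbyFlow.integrable_rpow_sub (hV : IsPositiveBounded Ω M V)
    (h : IsNearbyFlow Ω p c t₁ δ V v F) (hp : 1 < p) (hδ : δ ≤ 1 / 2) (hδ0 : 0 ≤ δ)
    {s t : ℝ} (hs : t₁ ≤ s) (ht : t₁ ≤ t) :
    Integrable (fun x => v t x ^ p - v s x ^ p) (volume.restrict Ω) := by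
  refine (((h.memLp_rpow hV hp hδ hδ0 ht).sub (h.memLp_rpow hV hp hδ hδ0 hs)).integrable
    (by norm_num)).congr (Eventually.of_forall fun x => ?_)
  simp

theorem tendsto_sqrt_modulus (a b : ℝ) : Tendsto (fun y => √(a * y * b)) (𝓝 0) (𝓝 0) := by
  have : Continuous fun y => √(a * y * b) := by fun_prop
  simpa using this.tendsto 0

theorem IsNearbyFlow.continuousOn_mode (hV : IsPositiveBounded Ω M V)
    (h : IsNearbyFlow Ω p c t₁ δ V v F) (hp : 1 < p) (hδ : δ ≤ 1 / 2) (hδ0 : 0 ≤ δ)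
    {φ : 𝔼 → ℝ} (hφ : MemLp φ 2 (volume.restrict Ω)) :
    ContinuousOn (fun t => ∫ x in Ω, (v t x ^ p - V x ^ p) * φ x) (Ici t₁) := by
  refine continuousOn_of_L1_modulus h.cont
    (tendsto_sqrt_modulus (1 ^ 2 * (2 * |(2 * M) ^ p|)) (∫ x in Ω, φ x ^ 2)) fun s t hs ht => ?_
  have hd := h.integrable_rpow_sub hV hp hδ hδ0 hs ht
  have h1 := abs_integral_mul_le_sqrt (h := fun x => v t x ^ p - v s x ^ p)
    (d := fun x => v t x ^ p - v s x ^ p) (k := 1) (B := 2 * |(2 * M) ^ p|)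
    hd.aestronglyMeasurable zero_le_one hd
    (Eventually.of_forall fun x => by simp) (h.ae_rpow_sub_le hV hp hδ hs ht) hφ
  rw [(h.memLp_rpow hV hp hδ hδ0 ht).integral_mul_sub_integral_mul
    (h.memLp_rpow hV hp hδ hδ0 hs) hφ]
  simpa only [sub_sub_sub_cancel_right] using h1

theorem IsNearbyFlow.memLp_sub (hV : IsPositiveBounded Ω M V)
    (h : IsNearbyFlow Ω p c t₁ δ V v F) (hδ : δ ≤ 1 / 2) {t : ℝ} (ht : t₁ ≤ t) :
    MemLp (fun x => v t x - V x) 2 (volume.restrict Ω) :=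
  hV.memLp_sub (by linarith) (h.meas t ht) (h.close t ht)

/-- The weight V^{p-1} is what makes |v - v'| controllable by |v^p - v'^p| down to the boundary
where V may vanish, so continuity of v^p passes to the linearized mode. -/
theorem IsNearbyFlow.continuousOn_linear_mode (hV : IsPositiveBounded Ω M V)
    (h : IsNearbyFlow Ω p c t₁ δ V v F) (hp : 1 < p) (hC : IsComparisonConstant p C)
    (hδ : δ ≤ 1 / 2) (hδ0 : 0 ≤ δ) {φ : 𝔼 → ℝ} (hφ : MemLp φ 2 (volume.restrict Ω)) :
    ContinuousOn (fun t => ∫ x in Ω, V x ^ (p - 1) * (v t x - V x) * φ x) (Ici t₁) := by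
  refine continuousOn_of_L1_modulus h.cont
    (tendsto_sqrt_modulus (C ^ 2 * (2 * |(2 * M) ^ p|)) (∫ x in Ω, φ x ^ 2)) fun s t hs ht => ?_
  have hd := h.integrable_rpow_sub hV hp hδ hδ0 hs ht
  have hft := hV.memLp_weight_mul hp (h.memLp_sub hV hδ ht)
  have hfs := hV.memLp_weight_mul hp (h.memLp_sub hV hδ hs)
  have h1 := abs_integral_mul_le_sqrt
    (h := (fun x => V x ^ (p - 1) * (v t x - V x)) - fun x => V x ^ (p - 1) * (v s x - V x))
    (d := fun x => v t x ^ p - v s x ^ p) (k := C) (B := 2 * |(2 * M) ^ p|)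
    (hft.sub hfs).aestronglyMeasurable (by linarith [hC.1]) hd
    (by
      filter_upwards [h.close t ht, h.close s hs, hV.ae, hV.ae_weight hp] with x h1 h2 hx hW
      have e := (hC.2 (V x) (v t x) (v s x) hx.1 (abs_sub_le_half hx.1 hδ h1)
        (abs_sub_le_half hx.1 hδ h2)).2.2.2.2.1
      rw [Pi.sub_apply, ← mul_sub, sub_sub_sub_cancel_right, abs_mul, abs_of_pos hW.1]
      exact e)
    (h.ae_rpow_sub_le hV hp hδ hs ht) hφ
  rw [hft.integral_mul_sub_integral_mul hfs hφ]
  exact h1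

theorem IsNearbyFlow.continuousOn_entropy (hV : IsPositiveBounded Ω M V)
    (h : IsNearbyFlow Ω p c t₁ δ V v F) (hp : 1 < p) (hC : IsComparisonConstant p C)
    (hδ : δ ≤ 1 / 2) (hδ0 : 0 ≤ δ) :
    ContinuousOn (fun t => entropy Ω p V (v t)) (Ici t₁) := by
  refine continuousOn_of_L1_modulus (m := fun y => C * M * y) h.cont
    (by simpa using (continuous_const_mul (C * M)).tendsto 0) fun s t hs ht => ?_
  have hd := h.integrable_rpow_sub hV hp hδ hδ0 hs ht
  rw [entropy, entropy, ← integral_sub (hV.entropy_bounds hp hC hδ (h.meas t ht) (h.close t ht)).1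
    (hV.entropy_bounds hp hC hδ (h.meas s hs) (h.close s hs)).1, ← integral_const_mul]
  refine abs_integral_le_integral_abs.trans (integral_mono_of_nonneg
    (Eventually.of_forall fun _ => abs_nonneg _) (hd.abs.const_mul _) ?_)
  filter_upwards [h.close t ht, h.close s hs, hV.ae] with x h1 h2 hx
  refine (hC.2 (V x) (v t x) (v s x) hx.1 (abs_sub_le_half hx.1 hδ h1)
    (abs_sub_le_half hx.1 hδ h2)).2.2.2.2.2.trans ?_
  have hC0 : 0 ≤ C := by linarith [hC.1]
  have := hx.2
  gcongr

/-- The evolution of a single mode. -/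
theorem IsNearbyFlow.hasDerivAt_mode (hV : IsPositiveBounded Ω M V)
    (h : IsNearbyFlow Ω p c t₁ δ V v F) (hp : 1 < p) (hC : IsComparisonConstant p C)
    (hδ : δ ≤ 1 / 2) (hδ0 : 0 ≤ δ) {lam : ℝ} {χ : 𝔼 → ℝ}
    (hχ : SolvesDirichlet Ω (fun x => lam * V x ^ (p - 1) * χ x) χ) {t : ℝ} (ht : t₁ < t) :
    HasDerivAt (fun t => ∫ x in Ω, (v t x ^ p - V x ^ p) * χ x)
      (c * (∫ x in Ω, (v t x ^ p - V x ^ p) * χ x) -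
        lam * ∫ x in Ω, V x ^ (p - 1) * (v t x - V x) * χ x) t := by
  obtain ⟨g, hg, hsol⟩ := hχ
  set A := fun t => ∫ x in Ω, (v t x ^ p - V x ^ p) * χ x with hA
  set β := fun t => ∫ x in Ω, V x ^ (p - 1) * (v t x - V x) * χ x with hβ
  have hAc : ContinuousOn A (Ici t₁) := h.continuousOn_mode hV hp hδ hδ0 hg.1
  have hβc : ContinuousOn β (Ici t₁) := h.continuousOn_linear_mode hV hp hC hδ hδ0 hg.1
  have hcont : ContinuousOn (fun τ => c * A τ - lam * β τ) (Ici t₁) := by fun_prop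
  have hh : MemLp (fun x => lam * V x ^ (p - 1) * χ x) 2 (volume.restrict Ω) := by
    simpa only [mul_assoc] using (hV.memLp_weight_mul hp hg.1).const_mul lam
  have hint : ∀ s t, t₁ < s → s ≤ t → A t - A s = ∫ τ in s..t, (c * A τ - lam * β τ) := by
    intro s t hs hst
    rw [h.weak χ g hg s t hs hst]
    refine intervalIntegral.integral_congr_ae ?_
    filter_upwards [(ae_restrict_iff' measurableSet_Ioi).1 h.grad] with τ hτ hτ'
    rw [uIoc_of_le hst] at hτ'
    -- The eigenvalue equation, tested with v(τ) - V, converts the gradient term of the flow into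
    -- λβ.
    have h1 := integral_inner_eq_of_hasH10Gradient hg.2.1 hh hsol (hτ (hs.trans hτ'.1))
    simp only [real_inner_comm (g _) (F τ _)] at h1 ⊢
    rw [h1]
    simp only [hA, hβ, ← integral_const_mul]
    rw [neg_add_eq_sub]
    congr 1
    exact integral_congr_ae (Eventually.of_forall fun x => by ring)
  set s := (t₁ + t) / 2
  have hs : t₁ < s := by simp only [s]; linarith
  have hst : s < t := by simp only [s]; linarith
  -- The integrand is continuous in time, so the integrated identity yields a classical derivative
  -- at every t > t₁.
  have hD : HasDerivAt (fun u => ∫ τ in s..u, (c * A τ - lam * β τ)) (c * A t - lam * β t) t := by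
    refine intervalIntegral.integral_hasDerivAt_right ?_ ?_ ?_
    · exact (hcont.mono (by rw [uIcc_of_le hst.le]; exact fun x hx => hs.le.trans hx.1)).intervalIntegrable
    · exact ContinuousOn.stronglyMeasurableAtFilter_nhdsWithin (hcont.mono Ioi_subset_Ici_self)
        measurableSet_Ioi t |>.filter_mono (by rw [isOpen_Ioi.nhdsWithin_eq ht])
    · exact hcont.continuousAt (Ici_mem_nhds ht)
  refine (hD.const_add (A s)).congr_of_eventuallyEq ?_
  filter_upwards [Ioi_mem_nhds hst] with u hu
  rw [← hint s u hs (le_of_lt hu)]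
  ring

end Modes

/-! ### Dissipation of the entropy without a time derivative of v. -/

section EnergyInequality

variable {N : ℕ} {Ω : Set (EuclideanSpace ℝ (Fin N))}

local notation "𝔼" => EuclideanSpace ℝ (Fin N)

/-- Time translation acts on functions on the whole space-time, hence the extension by zero; at
admissible times the slices reduce to integrals over Ω. -/
theorem integral_inner_indicator_prod {H : Type*} [NormedAddCommGroup H] [InnerProductSpace ℝ H]
    (hΩm : MeasurableSet Ω) {I J : Set ℝ} {s t : ℝ} (hs : s ∈ I) (ht : t ∈ J) (u w : ℝ × 𝔼 → H) :
    ∫ x : 𝔼, inner ℝ ((I ×ˢ Ω).indicator u (s, x)) ((J ×ˢ Ω).indicator w (t, x)) =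
      ∫ x in Ω, inner ℝ (u (s, x)) (w (t, x)) := by
  rw [← integral_indicator hΩm]
  refine integral_congr_ae (Eventually.of_forall fun x => ?_)
  by_cases hx : x ∈ Ω
  · simp [hx, hs, ht]
  · simp [hx]

variable [IsFiniteMeasure (volume.restrict Ω)] {M p C c t₁ δ : ℝ}
  {V : EuclideanSpace ℝ (Fin N) → ℝ} {v : ℝ → EuclideanSpace ℝ (Fin N) → ℝ}
  {F : ℝ → EuclideanSpace ℝ (Fin N) → EuclideanSpace ℝ (Fin N)}

theorem IsNearbyFlow.memLp_prod (hV : IsPositiveBounded Ω M V)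
    (h : IsNearbyFlow Ω p c t₁ δ V v F) (hp : 1 < p) (hδ : δ ≤ 1 / 2) (hδ0 : 0 ≤ δ) (b : ℝ) :
    MemLp (fun z : ℝ × 𝔼 => v z.1 z.2 - V z.2) 2 (volume.restrict (Ioo t₁ b ×ˢ Ω)) ∧
    MemLp (fun z : ℝ × 𝔼 => v z.1 z.2 ^ p - V z.2 ^ p) 2 (volume.restrict (Ioo t₁ b ×ˢ Ω)) := by
  have : IsFiniteMeasure ((volume : Measure (ℝ × 𝔼)).restrict (Ioo t₁ b ×ˢ Ω)) := by
    rw [volume_restrict_prod]; infer_instance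
  have hVm : AEStronglyMeasurable (fun z : ℝ × 𝔼 => V z.2) (volume.restrict (Ioo t₁ b ×ˢ Ω)) := by
    rw [volume_restrict_prod]
    exact hV.meas.comp_snd
  have hΩ : ∀ᵐ z : ℝ × 𝔼 ∂volume.restrict (Ioo t₁ b ×ˢ Ω), z.2 ∈ Ω := by
    filter_upwards [ae_restrict_mem (measurableSet_Ioo.prod hV.measurableSet)] with z hz using hz.2
  constructor
  · refine MemLp.of_bound ((h.meas_prod b).sub hVm) M ?_
    filter_upwards [h.close_prod b, hΩ] with z hz hzΩ
    have h1 := hV.pos _ hzΩ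
    have h2 := hV.le _ hzΩ
    rw [Real.norm_eq_abs]
    nlinarith
  · refine MemLp.of_bound (((h.meas_prod b).aemeasurable.pow_const p).aestronglyMeasurable.sub
      (hVm.aemeasurable.pow_const p).aestronglyMeasurable) (2 * (2 * M) ^ p) ?_
    filter_upwards [h.close_prod b, hΩ] with z hz hzΩ
    exact abs_rpow_sub_rpow_le (by linarith) (by linarith) hδ0 (hV.pos _ hzΩ) (hV.le _ hzΩ) hz

/-- Convexity: the entropy increment between two times. -/
theorem IsNearbyFlow.entropy_sub_le_integral (hV : IsPositiveBounded Ω M V)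
    (h : IsNearbyFlow Ω p c t₁ δ V v F) (hp : 1 < p) (hC : IsComparisonConstant p C)
    (hδ : δ ≤ 1 / 2) (hδ0 : 0 ≤ δ) {s t : ℝ} (hs : t₁ ≤ s) (ht : t₁ ≤ t) :
    entropy Ω p V (v t) - entropy Ω p V (v s) ≤
      (p + 1) / p * ((∫ x in Ω, (v t x ^ p - V x ^ p) * (v t x - V x)) -
        ∫ x in Ω, (v s x ^ p - V x ^ p) * (v t x - V x)) := by
  have it := (hV.entropy_bounds hp hC hδ (h.meas t ht) (h.close t ht)).1
  have is := (hV.entropy_bounds hp hC hδ (h.meas s hs) (h.close s hs)).1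
  have hwt := h.memLp_rpow hV hp hδ hδ0 ht
  have hws := h.memLp_rpow hV hp hδ hδ0 hs
  have hft := h.memLp_sub hV hδ ht
  rw [hwt.integral_mul_sub_integral_mul hws hft, entropy, entropy, ← integral_sub it is,
    ← integral_const_mul]
  refine integral_mono_ae (it.sub is) (((hwt.sub hws).integrable_mul hft).const_mul _) ?_
  filter_upwards [h.close t ht, h.close s hs, hV.ae] with x h1 h2 hx
  have e1 := abs_le.1 (abs_sub_le_half hx.1 hδ h1)
  have e2 := abs_le.1 (abs_sub_le_half hx.1 hδ h2)
  have e3 := rpow_add_one_sub_le hp (v := v t x) (v' := v s x) (by linarith) (by linarith)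
  have e4 : (p + 1) / p * ((v t x ^ p - V x ^ p - (v s x ^ p - V x ^ p)) * (v t x - V x)) =
    (p + 1) / p * (v t x * (v t x ^ p - v s x ^ p)) -
      (p + 1) / p * (v t x ^ p - v s x ^ p) * V x := by ring
  rw [e4]
  linarith

/-- The energy inequality. -/
theorem IsNearbyFlow.entropy_sub_le (hV : IsPositiveBounded Ω M V)
    (h : IsNearbyFlow Ω p c t₁ δ V v F) (hp : 1 < p) (hC : IsComparisonConstant p C)
    (hδ : δ ≤ 1 / 2) (hδ0 : 0 ≤ δ) {a b : ℝ} (ha : t₁ < a) (hab : a ≤ b) :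
    entropy Ω p V (v b) - entropy Ω p V (v a) ≤
      (p + 1) / p * ∫ τ in a..b, (-(∫ x in Ω, inner ℝ (F τ x) (F τ x)) +
        c * ∫ x in Ω, (v τ x ^ p - V x ^ p) * (v τ x - V x)) := by
  set E := fun t => entropy Ω p V (v t) with hE
  have hEc : ContinuousOn E (Ici t₁) := h.continuousOn_entropy hV hp hC hδ hδ0
  have hΩm := hV.measurableSet
  obtain ⟨hf2, hw2⟩ := h.memLp_prod hV hp hδ hδ0 b
  have hF2 := h.memLp_grad b
  have hSm : MeasurableSet (Ioo t₁ b ×ˢ Ω) := measurableSet_Ioo.prod hΩm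
  have hRm : MeasurableSet (Ioo a b ×ˢ Ω) := measurableSet_Ioo.prod hΩm
  have hRS : Ioo a b ×ˢ Ω ⊆ Ioo t₁ b ×ˢ Ω := prod_mono (Ioo_subset_Ioo_left ha.le) subset_rfl
  have hRSm := Measure.restrict_mono hRS (le_refl (volume : Measure (ℝ × 𝔼)))
  have kF := (memLp_indicator_iff_restrict hSm).2 hF2
  have kF' := (memLp_indicator_iff_restrict hRm).2 (hF2.mono_measure hRSm)
  have kw := (memLp_indicator_iff_restrict hSm).2 hw2
  have kf := (memLp_indicator_iff_restrict hRm).2 (hf2.mono_measure hRSm)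
  -- Correlations of the data with their time translates. They are continuous in the shift σ, and at
  -- σ = 0 they give the two terms of the dissipation.
  set ρF := fun σ : ℝ => ∫ z : ℝ × 𝔼, inner ℝ
    ((Ioo t₁ b ×ˢ Ω).indicator (fun z => F z.1 z.2) (z.1 - σ, z.2))
    ((Ioo a b ×ˢ Ω).indicator (fun z => F z.1 z.2) z) with hρF
  set ρw := fun σ : ℝ => ∫ z : ℝ × 𝔼, inner ℝ
    ((Ioo t₁ b ×ˢ Ω).indicator (fun z => v z.1 z.2 ^ p - V z.2 ^ p) (z.1 - σ, z.2))
    ((Ioo a b ×ˢ Ω).indicator (fun z => v z.1 z.2 - V z.2) z) with hρw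
  have cF : Continuous ρF := continuous_integral_inner_timeShift kF kF'
  have cw : Continuous ρw := continuous_integral_inner_timeShift kw kf
  set k := (p + 1) / p with hk
  have hk0 : 0 ≤ k := by simp only [hk]; positivity
  have hρ0 : -ρF 0 + c * ρw 0 = ∫ τ in a..b, (-(∫ x in Ω, inner ℝ (F τ x) (F τ x)) +
        c * ∫ x in Ω, (v τ x ^ p - V x ^ p) * (v τ x - V x)) := by
    have i1 := (hF2.mono_measure hRSm).integrable_inner_two (hF2.mono_measure hRSm)
    have i2 := (hw2.mono_measure hRSm).integrable_inner_two (hf2.mono_measure hRSm)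
    have e1 : ρF 0 = ∫ z in Ioo a b ×ˢ Ω, inner ℝ (F z.1 z.2) (F z.1 z.2) := by
      rw [← integral_indicator hRm]
      refine integral_congr_ae (Eventually.of_forall fun z => ?_)
      by_cases hz : z ∈ Ioo a b ×ˢ Ω
      · simp only [sub_zero, indicator_of_mem hz, indicator_of_mem (hRS hz)]
      · simp only [indicator_of_notMem hz, inner_zero_right]
    have e2 : ρw 0 = ∫ z in Ioo a b ×ˢ Ω, inner ℝ (v z.1 z.2 ^ p - V z.2 ^ p)
        (v z.1 z.2 - V z.2) := by
      rw [← integral_indicator hRm]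
      refine integral_congr_ae (Eventually.of_forall fun z => ?_)
      by_cases hz : z ∈ Ioo a b ×ˢ Ω
      · simp only [sub_zero, indicator_of_mem hz, indicator_of_mem (hRS hz)]
      · simp only [indicator_of_notMem hz, inner_zero_right]
    rw [e1, e2, intervalIntegral.integral_of_le hab, integral_Ioc_eq_integral_Ioo]
    rw [volume_restrict_prod] at i1 i2 ⊢
    simp only [integral_mul_eq_integral_inner]
    rw [integral_prod _ i1, integral_prod _ i2, ← integral_neg, ← integral_const_mul]
    exact (integral_add i1.integral_prod_left.neg (i2.integral_prod_left.const_mul c)).symm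
  rw [← hρ0]
  -- Shifts σ < a - a' keep t - σ above a' > t₁ for every t in (a, b).
  set a' := (t₁ + a) / 2 with ha'
  have ha1 : t₁ < a' := by simp only [ha']; linarith
  have ha2 : a' < a := by simp only [ha']; linarith
  have hEi : ∀ x y, t₁ ≤ x → t₁ ≤ y → IntervalIntegrable E volume x y := fun x y hx hy =>
    (hEc.mono fun z hz => (le_min hx hy).trans hz.1).intervalIntegrable
  have hP : ∀ y, a' < y → HasDerivAt (fun y => ∫ τ in a'..y, E τ) (E y) y := fun y hy => by
    have hy' : t₁ < y := ha1.trans hy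
    refine intervalIntegral.integral_hasDerivAt_right (hEi _ _ ha1.le hy'.le) ?_
      (hEc.continuousAt (Ici_mem_nhds hy'))
    exact ContinuousOn.stronglyMeasurableAtFilter_nhdsWithin (hEc.mono Ioi_subset_Ici_self)
        measurableSet_Ioi y |>.filter_mono (by rw [isOpen_Ioi.nhdsWithin_eq hy'])
  have hP' : ∀ y, a' < y → HasDerivAt (fun σ : ℝ => ∫ τ in a'..(y - σ), E τ) (-E y) 0 :=
    fun y hy => by
      have h1 : HasDerivAt (fun σ : ℝ => y - σ) (-1) 0 := by
        simpa using (hasDerivAt_id (0 : ℝ)).const_sub y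
      have h2 := (hP y hy)
      rw [show y = y - 0 by simp] at h2
      exact (h2.scomp (0 : ℝ) h1).congr_deriv (by simp)
  -- The left function is ∫ₐᵇ (E(t) - E(t - σ)) dt, with derivative E(b) - E(a) at 0; the right one
  -- has derivative k times the dissipation. Both vanish at 0, so comparison for small σ > 0 is
  -- enough.
  refine le_of_hasDerivAt_zero_of_le (h₀ := a - a') (by linarith)
    (u := fun σ => (∫ τ in a..b, E τ) -
      ((∫ τ in a'..(b - σ), E τ) - ∫ τ in a'..(a - σ), E τ))
    (w := fun σ => k * ∫ σ' in (0 : ℝ)..σ, (-ρF σ' + c * ρw σ')) ?_ ?_ ?_ (by simp) ?_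
  · have := ((hP' b (ha2.trans_le hab)).sub (hP' a ha2)).const_sub (∫ τ in a..b, E τ)
    exact this.congr_deriv (by ring)
  · have hc : Continuous fun σ => -ρF σ + c * ρw σ := by fun_prop
    exact (hc.integral_hasStrictDerivAt 0 0).hasDerivAt.const_mul k
  · have e := intervalIntegral.integral_interval_sub_left (hEi a' b ha1.le (by linarith))
      (hEi a' a ha1.le ha.le)
    simp only [sub_zero]
    rw [e, sub_self]
  intro σ hσ0 hσ
  obtain ⟨jF, mF, eF⟩ := integral_timeShift_eq kF kF' σ
  obtain ⟨jw, mw, ew⟩ := integral_timeShift_eq kw kf σ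
  set IF := fun t : ℝ => ∫ σ' in Ioc 0 σ, ∫ x : 𝔼, inner ℝ
    ((Ioo t₁ b ×ˢ Ω).indicator (fun z => F z.1 z.2) (t - σ', x))
    ((Ioo a b ×ˢ Ω).indicator (fun z => F z.1 z.2) (t, x)) with hIF
  set Iw := fun t : ℝ => ∫ σ' in Ioc 0 σ, ∫ x : 𝔼, inner ℝ
    ((Ioo t₁ b ×ˢ Ω).indicator (fun z => v z.1 z.2 ^ p - V z.2 ^ p) (t - σ', x))
    ((Ioo a b ×ˢ Ω).indicator (fun z => v z.1 z.2 - V z.2) (t, x)) with hIw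
  have hzero : ∀ t, t ∉ Ioo a b → -IF t + c * Iw t = 0 := fun t ht => by
    have : ∀ x, ((t, x) : ℝ × 𝔼) ∉ Ioo a b ×ˢ Ω := fun x hx => ht hx.1
    simp only [hIF, hIw, indicator_of_notMem (this _), inner_zero_right, integral_zero, neg_zero,
      mul_zero, add_zero]
  have cF' : IntervalIntegrable (fun σ => -ρF σ) volume 0 σ := cF.neg.intervalIntegrable _ _
  have cw' : IntervalIntegrable (fun σ => c * ρw σ) volume 0 σ :=
    (cw.intervalIntegrable _ _).const_mul c
  have jF' : Integrable (fun t => -IF t) := jF.neg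
  have jw' : Integrable (fun t => c * Iw t) := jw.const_mul c
  have hshift : IntervalIntegrable (fun t => E (t - σ)) volume a b := by
    refine (hEc.comp (by fun_prop) fun t ht => ?_).intervalIntegrable
    rw [uIcc_of_le hab] at ht
    have := ht.1
    simp only [mem_Ici]
    linarith
  have hright : ∫ σ' in (0 : ℝ)..σ, (-ρF σ' + c * ρw σ') =
      ∫ t in Ioo a b, (-IF t + c * Iw t) := by
    rw [setIntegral_eq_integral_of_forall_compl_eq_zero hzero,
      integral_add jF' jw', integral_neg, integral_const_mul, eF, ew,
      intervalIntegral.integral_add cF' cw', intervalIntegral.integral_neg,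
      intervalIntegral.integral_const_mul, intervalIntegral.integral_of_le hσ0.le,
      intervalIntegral.integral_of_le hσ0.le]
  have hleft : (∫ τ in a..b, E τ) - ((∫ τ in a'..(b - σ), E τ) - ∫ τ in a'..(a - σ), E τ) =
      ∫ t in Ioo a b, (E t - E (t - σ)) := by
    rw [intervalIntegral.integral_interval_sub_left (hEi a' (b - σ) ha1.le (by linarith))
      (hEi a' (a - σ) ha1.le (by linarith)), ← intervalIntegral.integral_comp_sub_right,
      ← intervalIntegral.integral_sub (hEi a b ha.le (by linarith)) hshift,
      intervalIntegral.integral_of_le hab, integral_Ioc_eq_integral_Ioo]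
  rw [hright, hleft, ← integral_const_mul]
  refine setIntegral_mono_ae_restrict ?_ ?_ ?_
  · exact (intervalIntegrable_iff_integrableOn_Ioo_of_le hab).1
      ((hEi a b ha.le (by linarith)).sub hshift)
  · exact ((jF'.add jw').const_mul k).integrableOn
  filter_upwards [ae_restrict_of_ae mF, ae_restrict_of_ae mw, ae_restrict_mem measurableSet_Ioo,
    ae_restrict_of_ae_restrict_of_subset
      (fun x hx => ha.trans hx.1 : Ioo a b ⊆ Ioi t₁) h.grad] with t nF nw ht hgt
  have hst : t₁ < t - σ := by linarith [ht.1]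
  refine (h.entropy_sub_le_integral hV hp hC hδ hδ0 hst.le (ha.le.trans ht.1.le)).trans ?_
  refine mul_le_mul_of_nonneg_left (le_of_eq ?_) hk0
  -- The frozen slice v(t) - V, which is in H¹₀ for almost every t, is the test function between
  -- times t - σ and t.
  rw [h.weak _ _ hgt (t - σ) t hst (by linarith)]
  have hσt : ∀ σ' ∈ Ioc 0 σ, t - σ' ∈ Ioo t₁ b := fun σ' hσ' =>
    ⟨by linarith [hσ'.2], by linarith [hσ'.1, ht.2]⟩
  have e := intervalIntegral.integral_comp_sub_left (a := 0) (b := σ) (fun τ =>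
    (-(∫ x in Ω, inner ℝ (F τ x) (F t x)) + c * ∫ x in Ω, (v τ x ^ p - V x ^ p) * (v t x - V x))) t
  rw [sub_zero] at e
  rw [← e, intervalIntegral.integral_of_le hσ0.le]
  simp only [hIF, hIw]
  have nF' : Integrable (fun σ' => -∫ x : 𝔼, inner ℝ
    ((Ioo t₁ b ×ˢ Ω).indicator (fun z => F z.1 z.2) (t - σ', x))
    ((Ioo a b ×ˢ Ω).indicator (fun z => F z.1 z.2) (t, x))) (volume.restrict (Ioc 0 σ)) := nF.neg
  rw [← integral_neg, ← integral_const_mul, ← integral_add nF' (nw.const_mul c)]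
  refine setIntegral_congr_fun measurableSet_Ioc fun σ' hσ' => ?_
  rw [integral_inner_indicator_prod hΩm (hσt σ' hσ') ht, integral_inner_indicator_prod hΩm
    (hσt σ' hσ') ht, integral_mul_eq_integral_inner]

end EnergyInequality

/-! ### Decay of the entropy near the stationary state. -/

section Decay

variable {N : ℕ} {Ω : Set (EuclideanSpace ℝ (Fin N))}

local notation "𝔼" => EuclideanSpace ℝ (Fin N)

variable [IsFiniteMeasure (volume.restrict Ω)] {M p C c t₁ δ : ℝ}
  {V : EuclideanSpace ℝ (Fin N) → ℝ} {v : ℝ → EuclideanSpace ℝ (Fin N) → ℝ}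
  {F : ℝ → EuclideanSpace ℝ (Fin N) → EuclideanSpace ℝ (Fin N)}

theorem IsNearbyFlow.exists_bound_mode (hV : IsPositiveBounded Ω M V)
    (h : IsNearbyFlow Ω p c t₁ δ V v F) (hp : 1 < p) (hδ : δ ≤ 1 / 2) (hδ0 : 0 ≤ δ)
    {φ : 𝔼 → ℝ} (hφ : MemLp φ 2 (volume.restrict Ω)) :
    ∃ B, ∀ t, t₁ ≤ t → |∫ x in Ω, (v t x ^ p - V x ^ p) * φ x| ≤ B := by
  refine ⟨∫ x in Ω, 2 * (2 * M) ^ p * |φ x|, fun t ht => ?_⟩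
  have hφ1 : Integrable φ (volume.restrict Ω) := hφ.integrable (by norm_num)
  refine abs_integral_le_integral_abs.trans (integral_mono_of_nonneg
    (Eventually.of_forall fun _ => abs_nonneg _) (hφ1.abs.const_mul _) ?_)
  filter_upwards [h.close t ht, hV.ae] with x h1 hx
  rw [abs_mul]
  exact mul_le_mul_of_nonneg_right (abs_rpow_sub_rpow_le (by linarith) (by linarith) hδ0 hx.1 hx.2
    h1) (abs_nonneg _)

theorem IsPositiveBounded.integral_weight_sq_nonneg {Ω : Set 𝔼} {V : 𝔼 → ℝ}
    (hV : IsPositiveBounded Ω M V) (hp : 1 < p)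
    (f : 𝔼 → ℝ) : 0 ≤ ∫ x in Ω, V x ^ (p - 1) * f x ^ 2 :=
  integral_nonneg_of_ae ((hV.ae_weight hp).mono fun _ hx => mul_nonneg hx.1.le (sq_nonneg _))

/-- The energy inequality combined with a spectral gap. -/
theorem IsNearbyFlow.entropy_sub_le_of_gap (hV : IsPositiveBounded Ω M V)
    (h : IsNearbyFlow Ω p c t₁ δ V v F) (hp : 1 < p) (hC : IsComparisonConstant p C)
    (hc : 0 < c) (hδ : δ ≤ 1 / 2) (hδ0 : 0 ≤ δ) {m : ℕ} {χ : Fin m → 𝔼 → ℝ} {Λ D : ℝ}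
    (hΛ : p * c < Λ) (hD : 0 ≤ D)
    (hχ : ∀ i, MemLp (χ i) 2 (volume.restrict Ω))
    (hgap : ∀ f g, HasH10Gradient Ω f g → Λ * (∫ x in Ω, V x ^ (p - 1) * f x ^ 2) ≤
      (∫ x in Ω, ‖g x‖ ^ 2) + D * ∑ i, (∫ x in Ω, V x ^ (p - 1) * χ i x * f x) ^ 2)
    (hs1 : c * C * δ ≤ (Λ - p * c) / 2)
    (hs2 : 2 * D * (C ^ 3 * ∑ i, ∫ x in Ω, V x ^ (p - 1) * χ i x ^ 2) * δ ≤
      (Λ - p * c) / (4 * C))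
    {a b : ℝ} (ha : t₁ < a) (hab : a ≤ b) :
    entropy Ω p V (v b) - entropy Ω p V (v a) ≤
      ∫ τ in a..b, (-((p + 1) / p * ((Λ - p * c) / (4 * C))) * entropy Ω p V (v τ) +
        ((p + 1) / p * (2 * D)) * ∑ i, (∫ x in Ω, (v τ x ^ p - V x ^ p) * χ i x) ^ 2) := by
  refine (h.entropy_sub_le hV hp hC hδ hδ0 ha hab).trans ?_
  have hC0 : 0 < C := by linarith [hC.1]
  have hk0 : 0 ≤ (p + 1) / p := by positivity
  have hEc := h.continuousOn_entropy hV hp hC hδ hδ0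
  have hAc := fun i => h.continuousOn_mode hV hp hδ hδ0 (hχ i)
  have hsub : uIcc a b ⊆ Ici t₁ := by
    rw [uIcc_of_le hab]; exact fun x hx => ha.le.trans hx.1
  have hR : IntervalIntegrable (fun τ =>
      -((Λ - p * c) / (4 * C)) * entropy Ω p V (v τ) +
        (2 * D) * ∑ i, (∫ x in Ω, (v τ x ^ p - V x ^ p) * χ i x) ^ 2) volume a b := by
    refine ContinuousOn.intervalIntegrable (ContinuousOn.mono (s := Ici t₁) ?_ hsub)
    fun_prop
  have hL : IntervalIntegrable (fun τ => -(∫ x in Ω, inner ℝ (F τ x) (F τ x)) +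
      c * ∫ x in Ω, (v τ x ^ p - V x ^ p) * (v τ x - V x)) volume a b := by
    obtain ⟨hf2, hw2⟩ := h.memLp_prod hV hp hδ hδ0 b
    exact (intervalIntegrable_slice ((h.memLp_grad b).integrable_inner_two (h.memLp_grad b))
      ha.le hab le_rfl).neg.add ((intervalIntegrable_slice (hw2.integrable_mul hf2)
      ha.le hab le_rfl).const_mul c)
  have e : ∀ τ, -((p + 1) / p * ((Λ - p * c) / (4 * C))) * entropy Ω p V (v τ) +
        ((p + 1) / p * (2 * D)) * ∑ i, (∫ x in Ω, (v τ x ^ p - V x ^ p) * χ i x) ^ 2 =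
      (p + 1) / p * (-((Λ - p * c) / (4 * C)) * entropy Ω p V (v τ) +
        (2 * D) * ∑ i, (∫ x in Ω, (v τ x ^ p - V x ^ p) * χ i x) ^ 2) := fun τ => by ring
  simp only [e]
  rw [intervalIntegral.integral_const_mul]
  refine mul_le_mul_of_nonneg_left ?_ hk0
  rw [intervalIntegral.integral_of_le hab, intervalIntegral.integral_of_le hab]
  refine setIntegral_mono_ae_restrict hL.1 hR.1 ?_
  filter_upwards [ae_restrict_of_ae_restrict_of_subset
      (fun x hx => ha.trans hx.1 : Ioc a b ⊆ Ioi t₁) h.grad, ae_restrict_mem measurableSet_Ioc]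
    with τ hg hτ
  have hτ1 : t₁ ≤ τ := ha.le.trans hτ.1.le
  have g1 := hgap _ _ hg
  have g2 := hV.integral_rpow_sub_mul_le hp hC hδ hδ0 (h.meas τ hτ1) (h.close τ hτ1)
  obtain ⟨-, g3, g4⟩ := hV.entropy_bounds hp hC hδ (h.meas τ hτ1) (h.close τ hτ1)
  have g5 := hV.entropy_nonneg hp hC hδ (h.meas τ hτ1) (h.close τ hτ1)
  -- The gap involves linearized modes β, the evolution nonlinear modes A: as p ≥ 1, β² ≤ (pβ)² ≤
  -- 2A² + 2(A - pβ)².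
  have g6 : ∀ i, (∫ x in Ω, V x ^ (p - 1) * χ i x * (v τ x - V x)) ^ 2 ≤
      2 * (∫ x in Ω, (v τ x ^ p - V x ^ p) * χ i x) ^ 2 +
      2 * ((C ^ 3 * ∫ x in Ω, V x ^ (p - 1) * χ i x ^ 2) * δ ^ 2 * entropy Ω p V (v τ)) := fun i => by
    have k1 := hV.sq_mode_sub_le hp hC hδ hδ0 (h.meas τ hτ1) (h.close τ hτ1) (h.close τ hτ1) (hχ i)
    have k2 : ∫ x in Ω, V x ^ (p - 1) * χ i x * (v τ x - V x) =
        ∫ x in Ω, V x ^ (p - 1) * (v τ x - V x) * χ i x :=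
      integral_congr_ae (Eventually.of_forall fun x => by ring)
    rw [k2]
    set A := ∫ x in Ω, (v τ x ^ p - V x ^ p) * χ i x
    set β := ∫ x in Ω, V x ^ (p - 1) * (v τ x - V x) * χ i x
    have k3 : β ^ 2 ≤ (p * β) ^ 2 := by
      rw [mul_pow]
      exact le_mul_of_one_le_left (sq_nonneg _) (one_le_pow₀ hp.le)
    nlinarith [sq_nonneg (A + (A - p * β))]
  have g7 := Finset.sum_le_sum fun i (_ : i ∈ Finset.univ) => g6 i
  rw [Finset.sum_add_distrib, ← Finset.mul_sum, ← Finset.mul_sum, ← Finset.sum_mul,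
    ← Finset.sum_mul, ← Finset.mul_sum] at g7
  simp only [real_inner_self_eq_norm_sq]
  have hΦ : 0 ≤ ∑ i, ∫ x in Ω, V x ^ (p - 1) * χ i x ^ 2 :=
    Finset.sum_nonneg fun i _ => hV.integral_weight_sq_nonneg hp _
  have hY := hV.integral_weight_sq_nonneg hp (fun x => v τ x - V x)
  set E := entropy Ω p V (v τ)
  set Y := ∫ x in Ω, V x ^ (p - 1) * (v τ x - V x) ^ 2
  set Φ := ∑ i, ∫ x in Ω, V x ^ (p - 1) * χ i x ^ 2
  set Q := ∑ i, (∫ x in Ω, (v τ x ^ p - V x ^ p) * χ i x) ^ 2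
  set γ := Λ - p * c with hγ
  have hγ0 : 0 < γ := by simp only [hγ]; linarith
  have g8 := mul_le_mul_of_nonneg_left g7 hD
  have g9 := mul_le_mul_of_nonneg_left g2 hc.le
  -- With Y the weighted L² distance, the gap leaves -γY. Half of it absorbs the linearization error
  -- of the zeroth-order term; the other half gives -γ/(2C) E through E ≤ CY, and half of that
  -- absorbs the error of the modes.
  have g10 : 2 * D * (C ^ 3 * Φ) * δ ^ 2 * E ≤ γ / (4 * C) * E := by
    refine mul_le_mul_of_nonneg_right ?_ g5
    refine le_trans ?_ hs2
    refine mul_le_mul_of_nonneg_left ?_ (by positivity)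
    nlinarith
  have g11 : γ / (2 * C) * E ≤ γ / 2 * Y := by
    have := mul_le_mul_of_nonneg_left g4 (show 0 ≤ γ / (2 * C) by positivity)
    refine this.trans (le_of_eq ?_)
    field_simp
  have g12 : c * C * δ * Y ≤ γ / 2 * Y := mul_le_mul_of_nonneg_right hs1 hY
  have g13 : γ / (2 * C) * E = 2 * (γ / (4 * C) * E) := by field_simp; ring
  have g14 : γ * Y = Λ * Y - p * c * Y := by rw [hγ]; ring
  have hΛY : ∫ x in Ω, ‖F τ x‖ ^ 2 ≥ Λ * Y - D * ∑ i,
    (∫ x in Ω, V x ^ (p - 1) * χ i x * (v τ x - V x)) ^ 2 := by linarith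
  nlinarith

/-- Growth of the unstable modes. -/
theorem IsNearbyFlow.le_sum_sq_mode_sub (hV : IsPositiveBounded Ω M V)
    (h : IsNearbyFlow Ω p c t₁ δ V v F) (hp : 1 < p) (hC : IsComparisonConstant p C)
    (hδ : δ ≤ 1 / 2) (hδ0 : 0 ≤ δ) {m : ℕ} {χ : Fin m → 𝔼 → ℝ} {lam : Fin m → ℝ}
    {μ : ℝ} (hμ : 0 < μ) (hlam0 : ∀ i, 0 < lam i) (hlam : ∀ i, lam i < p * c)
    (hlamμ : ∀ i, μ ≤ c - lam i / p)
    (hχ : ∀ i, SolvesDirichlet Ω (fun x => lam i * V x ^ (p - 1) * χ i x) (χ i))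
    {a b : ℝ} (ha : t₁ < a) (hab : a ≤ b) :
    ∫ τ in a..b, (μ * ∑ i, (∫ x in Ω, (v τ x ^ p - V x ^ p) * χ i x) ^ 2 -
      (c ^ 2 * (C ^ 3 * ∑ i, ∫ x in Ω, V x ^ (p - 1) * χ i x ^ 2) / μ * δ) * entropy Ω p V (v τ)) ≤
      (∑ i, (∫ x in Ω, (v b x ^ p - V x ^ p) * χ i x) ^ 2) -
        ∑ i, (∫ x in Ω, (v a x ^ p - V x ^ p) * χ i x) ^ 2 := by
  have hχ2 : ∀ i, MemLp (χ i) 2 (volume.restrict Ω) := fun i => by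
    obtain ⟨g, hg, -⟩ := hχ i; exact hg.1
  have hC0 : 0 < C := by linarith [hC.1]
  have hEc := h.continuousOn_entropy hV hp hC hδ hδ0
  set A := fun i t => ∫ x in Ω, (v t x ^ p - V x ^ p) * χ i x with hA
  set β := fun i t => ∫ x in Ω, V x ^ (p - 1) * (v t x - V x) * χ i x with hβ
  have hAc : ∀ i, ContinuousOn (A i) (Ici t₁) := fun i => h.continuousOn_mode hV hp hδ hδ0 (hχ2 i)
  have hβc : ∀ i, ContinuousOn (β i) (Ici t₁) := fun i =>
    h.continuousOn_linear_mode hV hp hC hδ hδ0 (hχ2 i)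
  have hsub : uIcc a b ⊆ Ici t₁ := by
    rw [uIcc_of_le hab]; exact fun x hx => ha.le.trans hx.1
  have hderiv : ∀ τ ∈ uIcc a b, HasDerivAt (fun t => ∑ i, A i t ^ 2)
      (∑ i, 2 * A i τ * (c * A i τ - lam i * β i τ)) τ := fun τ hτ => by
    rw [uIcc_of_le hab] at hτ
    refine HasDerivAt.fun_sum fun i _ => ?_
    have := (h.hasDerivAt_mode hV hp hC hδ hδ0 (hχ i) (ha.trans_le hτ.1)).pow 2
    exact this.congr_deriv (by simp [hA, hβ])
  have hDi : IntervalIntegrable (fun τ => ∑ i, 2 * A i τ * (c * A i τ - lam i * β i τ)) volume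
      a b := by
    refine ContinuousOn.intervalIntegrable (ContinuousOn.mono (s := Ici t₁) ?_ hsub)
    fun_prop
  have hLi : IntervalIntegrable (fun τ => μ * ∑ i, A i τ ^ 2 -
      (c ^ 2 * (C ^ 3 * ∑ i, ∫ x in Ω, V x ^ (p - 1) * χ i x ^ 2) / μ * δ) *
        entropy Ω p V (v τ)) volume a b := by
    refine ContinuousOn.intervalIntegrable (ContinuousOn.mono (s := Ici t₁) ?_ hsub)
    fun_prop
  rw [← intervalIntegral.integral_eq_sub_of_hasDerivAt hderiv hDi]
  refine intervalIntegral.integral_mono_on hab hLi hDi fun τ hτ => ?_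
  have hτ1 : t₁ ≤ τ := ha.le.trans hτ.1
  have g5 := hV.entropy_nonneg hp hC hδ (h.meas τ hτ1) (h.close τ hτ1)
  have key : ∀ i, μ * A i τ ^ 2 - (c ^ 2 * (C ^ 3 * ∫ x in Ω, V x ^ (p - 1) * χ i x ^ 2) / μ * δ) *
      entropy Ω p V (v τ) ≤ 2 * A i τ * (c * A i τ - lam i * β i τ) := fun i => by
    have k1 : (A i τ - p * β i τ) ^ 2 ≤ _ :=
      hV.sq_mode_sub_le hp hC hδ hδ0 (h.meas τ hτ1) (h.close τ hτ1) (h.close τ hτ1) (hχ2 i)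
    have hΦ := hV.integral_weight_sq_nonneg hp (χ i)
    set Φ := ∫ x in Ω, V x ^ (p - 1) * χ i x ^ 2
    set E := entropy Ω p V (v τ)
    set x := A i τ
    set r := A i τ - p * β i τ with hr
    have hp0 : 0 < p := by linarith
    set l := lam i / p with hl
    have hl0 : 0 < l := div_pos (hlam0 i) hp0
    have hlc : l < c := by rw [hl, div_lt_iff₀ hp0]; linarith [hlam i]
    -- The mode equation is split into its linear growth rate c - λ/p and the linearization error r.
    have e1 : c * x - lam i * β i τ = (c - l) * x + l * r := by
      rw [hr, hl]; field_simp; ring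
    rw [e1]
    have k2 : l ^ 2 * r ^ 2 ≤ c ^ 2 * (C ^ 3 * Φ * δ * E) := by
      have k4 : r ^ 2 ≤ C ^ 3 * Φ * δ * E := by
        refine k1.trans (mul_le_mul_of_nonneg_right (mul_le_mul_of_nonneg_left ?_ (by positivity))
          g5)
        nlinarith
      exact mul_le_mul (pow_le_pow_left₀ hl0.le hlc.le 2) k4 (sq_nonneg _) (sq_nonneg _)
    -- Completing the square spends one of the two available copies of μx² on the cross term 2x l r.
    have k3 : 0 ≤ (μ * x + l * r) ^ 2 / μ := by positivity
    have e2 : (μ * x + l * r) ^ 2 / μ = μ * x ^ 2 + 2 * x * (l * r) + l ^ 2 * r ^ 2 / μ := by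
      field_simp; ring
    rw [e2] at k3
    have k5 : l ^ 2 * r ^ 2 / μ ≤ c ^ 2 * (C ^ 3 * Φ * δ * E) / μ := by gcongr
    have e3 : c ^ 2 * (C ^ 3 * Φ * δ * E) / μ = (c ^ 2 * (C ^ 3 * Φ) / μ * δ) * E := by ring
    rw [e3] at k5
    have k6 : μ * x ^ 2 ≤ (c - l) * x ^ 2 := mul_le_mul_of_nonneg_right (hlamμ i) (sq_nonneg _)
    nlinarith
  have := Finset.sum_le_sum fun i (_ : i ∈ Finset.univ) => key i
  refine le_trans (le_of_eq ?_) this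
  rw [Finset.sum_sub_distrib, ← Finset.mul_sum, ← Finset.sum_mul, ← Finset.sum_mul,
    ← Finset.sum_div, ← Finset.mul_sum, ← Finset.mul_sum]

/-- Nearby flows decay in entropy, monotonically after some time, when the relative distance is
small. -/
theorem exists_decay_threshold (hN : 1 ≤ N) (hΩb : Bornology.IsBounded Ω)
    (hV : IsPositiveBounded Ω M V) (hp : 1 < p) (hc : 0 < c)
    (hne : ∀ φ, SolvesDirichlet Ω (fun x => p * c * V x ^ (p - 1) * φ x) φ →
      ∀ᵐ x ∂volume.restrict Ω, φ x = 0) :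
    ∃ δ₀ : ℝ, 0 < δ₀ ∧ ∀ δ, 0 ≤ δ → δ ≤ 1 / 2 → δ ≤ δ₀ → ∀ t₁ v F,
      IsNearbyFlow Ω p c t₁ δ V v F →
        AntitoneOn (fun t => entropy Ω p V (v t)) (Ici (t₁ + 1)) ∧
        Tendsto (fun t => entropy Ω p V (v t)) atTop (𝓝 0) := by
  obtain ⟨C, hC⟩ := exists_isComparisonConstant hp
  have hp0 : 0 < p := by linarith
  obtain ⟨m, χ, lam, Λ, D, hΛ, hD, hχ, hgap⟩ := exists_dirichlet_gap hN hV.measurableSet hΩb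
    (W := fun x => V x ^ (p - 1)) hV.weight_meas ((hV.ae_weight hp).mono fun x hx => hx.1.le)
    ((hV.ae_weight hp).mono fun x hx => hx.2) (mul_pos hp0 hc) hne
  have hC0 : 0 < C := by linarith [hC.1]
  have hχ2 : ∀ i, MemLp (χ i) 2 (volume.restrict Ω) := fun i => by
    obtain ⟨g, hg, -⟩ := (hχ i).2.2; exact hg.1
  -- Smallest growth rate among the finitely many unstable modes; any positive number will do if
  -- there are none.
  obtain ⟨μ, hμ, hμl⟩ : ∃ μ > 0, ∀ i, μ ≤ c - lam i / p := by
    have : ∀ i, 0 < c - lam i / p := fun i => by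
      rw [sub_pos, div_lt_iff₀ hp0]; linarith [(hχ i).2.1]
    rcases isEmpty_or_nonempty (Fin m) with he | he
    · exact ⟨1, one_pos, fun i => he.elim i⟩
    · obtain ⟨i₀, hi₀⟩ := Finite.exists_min fun i => c - lam i / p
      exact ⟨_, this i₀, hi₀⟩
  set Φ := ∑ i, ∫ x in Ω, V x ^ (p - 1) * χ i x ^ 2 with hΦ
  have hγ : 0 < Λ - p * c := by linarith
  set ν := (p + 1) / p * ((Λ - p * c) / (4 * C)) with hν
  have hν0 : 0 < ν := by positivity
  -- The summand 1 keeps the coupling constant positive even if D = 0.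
  set C₁ := (p + 1) / p * (2 * D) + 1 with hC₁
  have hC₁0 : 0 < C₁ := by positivity
  -- Either summand alone secures one of θμ ≥ 2C₁ and θν ≥ 2C₁. The remaining condition, θ times the
  -- coupling at most ν/2, holds for small δ.
  set θ := 2 * C₁ / μ + 2 * C₁ / ν with hθ
  have hθ0 : 0 < θ := by positivity
  have hlin : ∀ k r : ℝ, 0 < r → ∃ d > 0, ∀ δ, 0 ≤ δ → δ ≤ d → k * δ ≤ r := fun k r hr => by
    refine ⟨r / (|k| + 1), by positivity, fun δ h0 hd => ?_⟩
    rw [le_div_iff₀ (by positivity)] at hd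
    have := le_abs_self k
    nlinarith
  obtain ⟨d1, hd1, h1⟩ := hlin (c * C) ((Λ - p * c) / 2) (by positivity)
  obtain ⟨d2, hd2, h2⟩ := hlin (2 * D * (C ^ 3 * Φ)) ((Λ - p * c) / (4 * C)) (by positivity)
  obtain ⟨d3, hd3, h3⟩ := hlin (θ * (c ^ 2 * (C ^ 3 * Φ) / μ)) (ν / 2) (by positivity)
  refine ⟨min d1 (min d2 d3), by positivity, fun δ hδ0 hδ hδm t₁ v F h => ?_⟩
  have hδ1 := hδm.trans (min_le_left _ _)
  have hδ2 := hδm.trans ((min_le_right _ _).trans (min_le_left _ _))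
  have hδ3 := hδm.trans ((min_le_right _ _).trans (min_le_right _ _))
  have hEc := h.continuousOn_entropy hV hp hC hδ hδ0
  have hAc := fun i => h.continuousOn_mode hV hp hδ hδ0 (hχ2 i)
  -- The integrated equation holds between times strictly after t₁, so the argument runs on a closed
  -- half-line starting later.
  have hsub : Ici (t₁ + 1) ⊆ Ici t₁ := Ici_subset_Ici.2 (by linarith)
  choose B hB using fun i => h.exists_bound_mode hV hp hδ hδ0 (hχ2 i)
  have hQc : ContinuousOn (fun t => ∑ i, (∫ x in Ω, (v t x ^ p - V x ^ p) * χ i x) ^ 2)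
      (Ici t₁) := by fun_prop
  refine antitone_tendsto_zero_of_coupled (ν := ν) (C := C₁) (μ := μ)
    (ε := c ^ 2 * (C ^ 3 * Φ) / μ * δ) (θ := θ) (B := ∑ i, B i ^ 2)
    (Q := fun t => ∑ i, (∫ x in Ω, (v t x ^ p - V x ^ p) * χ i x) ^ 2) hν0 hC₁0 hθ0 ?_ ?_ ?_
    (hEc.mono hsub) (hQc.mono hsub) ?_ ?_ ?_ ?_ ?_
  · rw [hθ, add_mul, div_mul_cancel₀ _ hμ.ne']
    have : 0 ≤ 2 * C₁ / ν * μ := by positivity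
    linarith
  · have := h3 δ hδ0 hδ3
    linarith
  · rw [hθ, add_mul, div_mul_cancel₀ _ hν0.ne']
    have : 0 ≤ 2 * C₁ / μ * ν := by positivity
    linarith
  · exact fun t ht => hV.entropy_nonneg hp hC hδ (h.meas t (hsub ht)) (h.close t (hsub ht))
  · exact fun t _ => Finset.sum_nonneg fun i _ => sq_nonneg _
  · refine fun t ht => Finset.sum_le_sum fun i _ => ?_
    rw [← sq_abs]
    exact pow_le_pow_left₀ (abs_nonneg _) (hB i t (hsub ht)) 2
  · intro s t hs hst
    have hs' : t₁ < s := by linarith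
    refine (h.entropy_sub_le_of_gap hV hp hC hc hδ hδ0 hΛ hD hχ2 hgap (h1 δ hδ0 hδ1)
      (h2 δ hδ0 hδ2) hs' hst).trans ?_
    have hss : uIcc s t ⊆ Ici t₁ := by
      rw [uIcc_of_le hst]; exact fun x hx => hs'.le.trans hx.1
    refine intervalIntegral.integral_mono_on hst
      (ContinuousOn.intervalIntegrable (ContinuousOn.mono (s := Ici t₁) (by fun_prop) hss))
      (ContinuousOn.intervalIntegrable (ContinuousOn.mono (s := Ici t₁) (by fun_prop) hss))
      fun τ _ => ?_
    have : 0 ≤ ∑ i, (∫ x in Ω, (v τ x ^ p - V x ^ p) * χ i x) ^ 2 :=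
      Finset.sum_nonneg fun i _ => sq_nonneg _
    rw [hC₁, add_mul]
    linarith
  · intro s t hs hst
    exact h.le_sum_sq_mode_sub hV hp hC hδ hδ0 hμ (fun i => (hχ i).1) (fun i => (hχ i).2.1) hμl
      (fun i => (hχ i).2.2) (by linarith) hst

end Decay

/-! ### Unstable modes, quotients and conclusion. -/

section Quotient

variable {N : ℕ} {Ω : Set (EuclideanSpace ℝ (Fin N))}

local notation "𝔼" => EuclideanSpace ℝ (Fin N)

/-- The default values are harmless: 1 ≤ k ≤ `kp` makes the supremum positive, so it is taken over a
nonempty bounded set and is attained. Monotonicity of `lamV` then carries the bound down to k. -/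
theorem FastDiffusion.lamV_lt_of_le_kp {p c : ℝ} {V : 𝔼 → ℝ} (hpc : 0 < p * c) {k : ℕ}
    (hk : 1 ≤ k) (hkp : k ≤ kp Ω p c V) : lamV Ω p V k < p * c := by
  set S := {k : ℕ | 1 ≤ k ∧ lamV Ω p V k < p * c} with hS
  have hkS : kp Ω p c V = sSup S := rfl
  have hpos : 0 < sSup S := by omega
  have hne : S.Nonempty := by
    by_contra he
    rw [not_nonempty_iff_eq_empty.1 he, csSup_empty] at hpos
    exact absurd hpos (lt_irrefl _)
  have hbdd : BddAbove S := by
    by_contra he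
    rw [csSup_of_not_bddAbove he, csSup_empty] at hpos
    exact absurd hpos (lt_irrefl _)
  have hmem : sSup S ∈ S := Nat.sSup_mem hne hbdd
  -- If no eigenvalue lay above `lamV j`, the infimum of the empty set would reset `lamV (j + 1)` to
  -- 0 and the recursion would be periodic. Then `lamV` would be below pc at infinitely many
  -- indices, contradicting boundedness.
  have hnonempty : ∀ j, {lam | lam ∈ dirichletSpectrum Ω p V ∧ lamV Ω p V j < lam}.Nonempty := by
    intro j
    by_contra he
    have h0 : lamV Ω p V (j + 1) = 0 := by
      rw [lamV, not_nonempty_iff_eq_empty.1 he, Real.sInf_empty]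
    have hper : ∀ i, lamV Ω p V (i + (j + 1)) = lamV Ω p V i := by
      intro i
      induction i with
      | zero => simpa [lamV] using h0
      | succ i ih => rw [show i + 1 + (j + 1) = i + (j + 1) + 1 by ring, lamV, lamV, ih]
    have hmul : ∀ i, lamV Ω p V (i * (j + 1)) = 0 := by
      intro i
      induction i with
      | zero => simp [lamV]
      | succ i ih => rw [Nat.succ_mul, hper, ih]
    obtain ⟨b, hb⟩ := hbdd
    have hin : (b + 1) * (j + 1) ∈ S := ⟨by nlinarith, by rw [hmul]; exact hpc⟩
    have := hb hin
    nlinarith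
  have hmono : Monotone (lamV Ω p V) := monotone_nat_of_le_succ fun j => by
    rw [lamV]
    exact le_csInf (hnonempty j) fun lam h => h.2.le
  exact (hmono (hkS ▸ hkp)).trans_lt hmem.2

theorem ae_abs_sub_le_of_eLpNorm_div {u V : 𝔼 → ℝ} {ε : ℝ} (hε : 0 ≤ ε)
    (hV : ∀ᵐ x ∂volume.restrict Ω, 0 < V x)
    (h : eLpNorm (fun x => u x / V x - 1) ⊤ (volume.restrict Ω) ≤ ENNReal.ofReal ε) :
    ∀ᵐ x ∂volume.restrict Ω, |u x - V x| ≤ ε * V x := by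
  rw [eLpNorm_exponent_top] at h
  filter_upwards [ae_le_eLpNormEssSup (f := fun x => u x / V x - 1) (μ := volume.restrict Ω), hV]
    with x hx hVx
  have h1 := hx.trans h
  rw [← ofReal_norm, ENNReal.ofReal_le_ofReal_iff hε, Real.norm_eq_abs] at h1
  have h2 : u x - V x = (u x / V x - 1) * V x := by field_simp
  rw [h2, abs_mul, abs_of_pos hVx]
  exact mul_le_mul_of_nonneg_right h1 hVx.le

variable [IsFiniteMeasure (volume.restrict Ω)] {M p C c t₁ δ : ℝ}
  {V : EuclideanSpace ℝ (Fin N) → ℝ} {v : ℝ → EuclideanSpace ℝ (Fin N) → ℝ}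
  {F : ℝ → EuclideanSpace ℝ (Fin N) → EuclideanSpace ℝ (Fin N)}

/-- An unstable mode is controlled by the nonlinear error at all later times. -/
theorem IsNearbyFlow.abs_mode_le (hV : IsPositiveBounded Ω M V)
    (h : IsNearbyFlow Ω p c t₁ δ V v F) (hp : 1 < p) (hC : IsComparisonConstant p C)
    (hδ : δ ≤ 1 / 2) (hδ0 : 0 ≤ δ) {lam : ℝ} {φ : 𝔼 → ℝ} (hlam : lam < p * c)
    (hφ : SolvesEigen Ω p V lam φ) {t ε : ℝ} (ht : t₁ < t) (hε : 0 ≤ ε)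
    (hE : ∀ s, t ≤ s → entropy Ω p V (v s) ≤ entropy Ω p V (v t))
    (hclose : ∀ s, t ≤ s → ∀ᵐ x ∂volume.restrict Ω, |v s x - V x| ≤ ε * V x) :
    |∫ x in Ω, (v t x ^ p - V x ^ p) * φ x| ≤
      |lam / p| * √(C ^ 3 * ∫ x in Ω, V x ^ (p - 1) * φ x ^ 2) / (c - lam / p) *
        ε * √(entropy Ω p V (v t)) := by
  have hp0 : 0 < p := by linarith
  have hC0 : 0 < C := by linarith [hC.1]
  have hμ : 0 < c - lam / p := by rw [sub_pos, div_lt_iff₀ hp0]; linarith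
  have hφ2 : MemLp φ 2 (volume.restrict Ω) := by obtain ⟨g, hg, -⟩ := hφ; exact hg.1
  obtain ⟨B, hB⟩ := h.exists_bound_mode hV hp hδ hδ0 hφ2
  have hΦ := hV.integral_weight_sq_nonneg hp φ
  set K := C ^ 3 * ∫ x in Ω, V x ^ (p - 1) * φ x ^ 2 with hK
  have hK0 : 0 ≤ K := by positivity
  -- The forcing is λ/p times the linearization error. The bound ε on the relative distance and the
  -- bound on the entropy at all later times make it uniformly small on [t, ∞).
  have key := abs_le_of_hasDerivAt_unstable (t := t) (μ := c - lam / p)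
    (A := fun s => ∫ x in Ω, (v s x ^ p - V x ^ p) * φ x)
    (n := fun s => lam / p * ((∫ x in Ω, (v s x ^ p - V x ^ p) * φ x) -
      p * ∫ x in Ω, V x ^ (p - 1) * (v s x - V x) * φ x))
    (D := |lam / p| * (√K * ε * √(entropy Ω p V (v t)))) (B := B) hμ
    (fun s hs => (h.hasDerivAt_mode hV hp hC hδ hδ0 hφ (ht.trans_le hs)).congr_deriv (by
      field_simp; ring))
    (fun s hs => by
      have hs1 : t₁ ≤ s := ht.le.trans hs
      rw [abs_mul]
      refine mul_le_mul_of_nonneg_left ?_ (abs_nonneg _)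
      have h1 := hV.sq_mode_sub_le hp hC hδ hδ0 (h.meas s hs1) (h.close s hs1) (hclose s hs) hφ2
      refine (Real.abs_le_sqrt h1).trans ?_
      rw [Real.sqrt_mul (by positivity), Real.sqrt_mul hK0, Real.sqrt_sq hε]
      gcongr
      exact hE s hs)
    (fun s hs => hB s (ht.le.trans hs))
  refine key.trans (le_of_eq ?_)
  ring

/-- Under an entropy-controlled relative error, the quotients of the unstable modes decay. -/
theorem IsNearbyFlow.eventually_quotient_le (hV : IsPositiveBounded Ω M V)
    (h : IsNearbyFlow Ω p c t₁ δ V v F) (hp : 1 < p)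
    (hδ : δ ≤ 1 / 2) (hδ0 : 0 ≤ δ) {a : ℝ}
    (hanti : AntitoneOn (fun t => entropy Ω p V (v t)) (Ici a))
    (hlim : Tendsto (fun t => entropy Ω p V (v t)) atTop (𝓝 0))
    {κ η t₀ : ℝ} (hκ : 0 < κ) (hη : 0 < η)
    (hent : ∀ t, t₀ ≤ t → eLpNorm (fun x => v t x / V x - 1) ⊤ (volume.restrict Ω)
      ≤ ENNReal.ofReal (κ * entropy Ω p V (v (t - 1)) ^ η))
    {lam : ℝ} {φ : 𝔼 → ℝ} (hlam : lam < p * c) (hφ : SolvesEigen Ω p V lam φ) :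
    ∀ᶠ t in atTop, quotient Ω p V (v t) φ ≤ entropy Ω p V (v (t - 1)) ^ (η / 2) := by
  obtain ⟨C, hC⟩ := exists_isComparisonConstant hp
  -- K multiplies 𝓔[v(t-1)]^η in the bound for the quotient. Since 𝓔 → 0, K 𝓔^{η/2} is eventually
  -- below 1, and half of the exponent remains.
  set K := |lam / p| * √(C ^ 3 * ∫ x in Ω, V x ^ (p - 1) * φ x ^ 2) / (c - lam / p) * κ with hK
  have hlim' : Tendsto (fun t => K * entropy Ω p V (v (t - 1)) ^ (η / 2)) atTop (𝓝 0) := by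
    have h1 : Tendsto (fun t : ℝ => t - 1) atTop atTop := tendsto_atTop_add_const_right _ (-1) tendsto_id
    have h2 := (hlim.comp h1).rpow_const (p := η / 2) (Or.inr (by positivity))
    rw [Real.zero_rpow (by positivity)] at h2
    simpa using h2.const_mul K
  filter_upwards [hlim'.eventually (gt_mem_nhds one_pos), eventually_ge_atTop t₀,
    eventually_ge_atTop (a + 1), eventually_ge_atTop (t₁ + 1), eventually_gt_atTop t₁]
    with t hKt ht0 hta ht1 htt
  have hEnn : ∀ s, t₁ ≤ s → 0 ≤ entropy Ω p V (v s) := fun s hs =>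
    hV.entropy_nonneg hp hC hδ (h.meas s hs) (h.close s hs)
  have hE1 := hEnn (t - 1) (by linarith)
  have hε : 0 ≤ κ * entropy Ω p V (v (t - 1)) ^ η := by positivity
  have hmode := h.abs_mode_le hV hp hC hδ hδ0 hlam hφ htt hε
    (fun s hs => hanti (show a ≤ t by linarith) (show a ≤ s by linarith) hs)
    -- At a later time s the hypothesis gives the relative error κ𝓔[v(s-1)]^η; monotonicity of the
    -- entropy replaces s - 1 by t - 1.
    (fun s hs => by
      have hEs := hEnn (s - 1) (by linarith)
      filter_upwards [ae_abs_sub_le_of_eLpNorm_div (by positivity) (hV.ae.mono fun x hx => hx.1)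
        (hent s (ht0.trans hs)), hV.ae] with x hx hVx
      refine hx.trans (mul_le_mul_of_nonneg_right (mul_le_mul_of_nonneg_left
        (Real.rpow_le_rpow hEs ?_ hη.le) hκ.le) hVx.1.le)
      exact hanti (show a ≤ t - 1 by linarith) (show a ≤ s - 1 by linarith) (by linarith))
  set E₁ := entropy Ω p V (v (t - 1))
  have hsplit : E₁ ^ η = E₁ ^ (η / 2) * E₁ ^ (η / 2) := by
    rw [← Real.rpow_add_of_nonneg hE1 (by positivity) (by positivity)]; ring_nf
  -- This form of the division step also covers zero entropy, where the quotient is 0 by convention.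
  refine div_le_of_le_mul₀ (Real.sqrt_nonneg _) (by positivity) (hmode.trans ?_)
  refine mul_le_mul_of_nonneg_right ?_ (Real.sqrt_nonneg _)
  calc _ = (K * E₁ ^ (η / 2)) * E₁ ^ (η / 2) := by rw [hsplit, hK]; ring
    _ ≤ 1 * E₁ ^ (η / 2) := mul_le_mul_of_nonneg_right hKt.le (by positivity)
    _ = _ := one_mul _

end Quotient

theorem FastDiffusion.rate_pos {p T : ℝ} (hp : 1 < p) (hT : 0 < T) : 0 < rate p T :=
  div_pos (by linarith) (mul_pos (by linarith) hT)

theorem FastDiffusion.IsStationary.exists_isPositiveBounded {N : ℕ}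
    {Ω : Set (EuclideanSpace ℝ (Fin N))} {p c : ℝ} {V : EuclideanSpace ℝ (Fin N) → ℝ}
    (hΩm : MeasurableSet Ω) (hV : IsStationary Ω p c V) : ∃ M, IsPositiveBounded Ω M V := by
  obtain ⟨M, hM⟩ := hV.bounded
  obtain ⟨g, hg, -⟩ := hV.solves
  exact ⟨M, hΩm, hV.pos, hM, hg.1.aestronglyMeasurable⟩

theorem mainTheorem6 (N : ℕ) (hN : 1 ≤ N)
    (Ω : Set (EuclideanSpace ℝ (Fin N))) (hΩo : IsOpen Ω) (hΩb : Bornology.IsBounded Ω)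
    (hΩne : Ω.Nonempty)
    (p T : ℝ) (hp : 1 < p) (hps : max ((N : ℝ) - 2) 0 / ((N : ℝ) + 2) < 1 / p) (hT : 0 < T)
    (V : EuclideanSpace ℝ (Fin N) → ℝ) (hV : IsStationary Ω p (rate p T) V)
    (hH2 : H2 Ω p (rate p T) V)
    (n : ℕ → ℕ) (φ : (k : ℕ) → Fin (n k) → EuclideanSpace ℝ (Fin N) → ℝ)
    (hφ : ∀ k, 1 ≤ k → IsEigenbasis Ω p V (lamV Ω p V k) (φ k)) :
    ∃ δ₀ : ℝ, 0 < δ₀ ∧ ∀ δ : ℝ, 0 < δ → δ < 1 / (2 * p) → δ < δ₀ →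
      ∀ (u₀ : EuclideanSpace ℝ (Fin N) → ℝ) (v : ℝ → EuclideanSpace ℝ (Fin N) → ℝ),
        IsRCDPSolution Ω p (rate p T) u₀ v → H1prime Ω V δ v →
        ∀ κ η t₀ : ℝ, 0 < κ → 0 < η → 1 ≤ t₀ →
          (∀ t, t₀ ≤ t → eLpNorm (fun x => v t x / V x - 1) ∞ (volume.restrict Ω)
            ≤ ENNReal.ofReal (κ * entropy Ω p V (v (t - 1)) ^ η)) →
          ∃ T₀ : ℝ, t₀ ≤ T₀ ∧ ∀ t, T₀ ≤ t → ∀ k, 1 ≤ k → k ≤ kp Ω p (rate p T) V →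
            ∀ j : Fin (n k),
              quotient Ω p V (v t) (φ k j) ≤ entropy Ω p V (v (t - 1)) ^ (η / 2) := by
  have hc := rate_pos hp hT
  have : IsFiniteMeasure (volume.restrict Ω) := ⟨by
    rw [Measure.restrict_apply_univ]; exact hΩb.measure_lt_top⟩
  obtain ⟨M, hVM⟩ := hV.exists_isPositiveBounded hΩo.measurableSet
  obtain ⟨δ₀, hδ₀, hdecay⟩ := exists_decay_threshold hN hΩb hVM hp hc
    (fun φ hφ => hH2 φ (by rwa [SolvesEigen, mul_comm (rate p T) p]))
  refine ⟨δ₀, hδ₀, fun δ hδ hδp hδ1 u₀ v hv hH1 κ η t₀ hκ hη _ hent => ?_⟩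
  -- From δ < 1/(2p) and p > 1: the range in which the comparison constant is valid.
  have hδ2 : δ ≤ 1 / 2 := hδp.le.trans (one_div_le_one_div_of_le two_pos (by linarith))
  obtain ⟨t₁, F, hF⟩ := hv.exists_isNearbyFlow hVM hV.solves (by linarith) (by linarith) hδ.le hH1
  obtain ⟨hanti, hlim⟩ := hdecay δ hδ.le hδ2 hδ1.le t₁ v F hF
  -- Only finitely many pairs (k, j) occur, so their individual thresholds merge into one time.
  have hev : ∀ᶠ t in atTop, ∀ k ∈ Finset.Icc 1 (kp Ω p (rate p T) V), ∀ j : Fin (n k),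
      quotient Ω p V (v t) (φ k j) ≤ entropy Ω p V (v (t - 1)) ^ (η / 2) := by
    refine (Filter.eventually_all_finset _).2 fun k hk => eventually_all.2 fun j => ?_
    rw [Finset.mem_Icc] at hk
    exact hF.eventually_quotient_le hVM hp hδ2 hδ.le hanti hlim hκ hη hent
      (lamV_lt_of_le_kp (mul_pos (by linarith) hc) hk.1 hk.2) ((hφ k hk.1).solves j)
  obtain ⟨T₀, hT₀⟩ := eventually_atTop.1 hev
  exact ⟨max t₀ T₀, le_max_left _ _, fun t ht k hk hkp j =>
    hT₀ t ((le_max_right _ _).trans ht) k (Finset.mem_Icc.2 ⟨hk, hkp⟩) j⟩
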